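/- Let $K$ be a field of characteristic zero with algebraic closure $\bar K$, and let $S$ be a non-trivial Severi--Brauer surface over $K$, that is, a projective variety over $K$ such that $S_{\bar K}\cong\mathbb{P}^2_{\bar K}$ over $\bar K$, but $S$ is not isomorphic to $\mathbb{P}^2_K$ over $K$. Let $G\subset\operatorname{Aut}(S)$ be a finite subgroup of the group of automorphisms of $S$ over $K$. Then (i) the group $G$ is either abelian, or contains a normal abelian subgroup of index $3$; (ii) there exists a $G$-invariant point of degree $3$ on $S$, that is, a closed point $P\in S$ whose residue field is an extension of $K$ of degree $3$ and such that $g(P)=P$ for every $g\in G$. -/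

import Mathlib

open CategoryTheory AlgebraicGeometry

namespace SeveriBrauer

universe u

attribute [local instance] MvPolynomial.gradedAlgebra

/-- The projective space `ℙⁿ` over a field `k`, as a scheme over `Spec k`: the scheme
`Proj k[x₀, …, xₙ]` with its structure morphism. -/
noncomputable def projectiveSpace (n : ℕ) (k : Type u) [Field k] : Over (Spec (.of k)) :=
  Over.mk (Proj.toSpecZero (MvPolynomial.homogeneousSubmodule (Fin (n + 1)) k) ≫
    Spec.map (CommRingCat.ofHom
      (algebraMap k (MvPolynomial.homogeneousSubmodule (Fin (n + 1)) k 0))))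

/-- A `k`-scheme is projective if it admits a closed immersion over `k` into some `ℙⁿ`. -/
def IsProjective {k : Type u} [Field k] (X : Over (Spec (.of k))) : Prop :=
  ∃ (n : ℕ) (i : X ⟶ projectiveSpace n k), IsClosedImmersion i.left

/-- The scalar extension of a `k`-scheme to the algebraic closure of `k`. -/
noncomputable def geometricFiber {k : Type u} [Field k] (X : Over (Spec (.of k))) :
    Over (Spec (.of (AlgebraicClosure k))) :=
  (Over.pullback (Spec.map (CommRingCat.ofHom (algebraMap k (AlgebraicClosure k))))).obj X

/-- A Severi–Brauer variety of dimension `n` over `k`: a (projective) variety over `k` which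
becomes isomorphic to `ℙⁿ` over the algebraic closure of `k`. -/
structure IsSeveriBrauerVariety {k : Type u} [Field k] (n : ℕ) (X : Over (Spec (.of k))) :
    Prop where
  isIntegral : IsIntegral X.left
  isProjective : IsProjective X
  geometricFiber_iso : Nonempty (geometricFiber X ≅ projectiveSpace n (AlgebraicClosure k))

/-- A non-trivial Severi–Brauer surface: a Severi–Brauer variety of dimension two that is not
isomorphic to `ℙ²` over the base field. -/
structure IsNontrivialSeveriBrauerSurface {k : Type u} [Field k] (X : Over (Spec (.of k))) :
    Prop where
  isSeveriBrauer : IsSeveriBrauerVariety 2 X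
  nontrivial : IsEmpty (X ≅ projectiveSpace 2 k)

/-- The homomorphism from the base field to the residue field of a point of a `k`-scheme. -/
noncomputable def toResidueField {k : Type u} [Field k] (X : Over (Spec (.of k))) (x : X.left) :
    k →+* X.left.residueField x :=
  (Spec.preimage (X.left.fromSpecResidueField x ≫ X.hom)).hom

/-- The degree over `k` of the residue field of a point of a `k`-scheme (zero if the extension is
infinite). -/
noncomputable def residueDegree {k : Type u} [Field k] (X : Over (Spec (.of k))) (x : X.left) :
    ℕ :=
  letI := (toResidueField X x).toAlgebra
  Module.finrank k (X.left.residueField x)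

/-- `x` is a point of degree `d` on `X`: a closed point whose residue field is an extension of the
base field of degree `d`. -/
def IsPointOfDegree {k : Type u} [Field k] (X : Over (Spec (.of k))) (d : ℕ) (x : X.left) :
    Prop :=
  IsClosed {x} ∧ residueDegree X x = d

/-- The point `x` of `X` is invariant under a group `G` of automorphisms of `X` over `k`. -/
def IsInvariantPoint {k : Type u} [Field k] {X : Over (Spec (.of k))} (G : Subgroup (Aut X))
    (x : X.left) : Prop :=
  ∀ g ∈ G, g.hom.left x = x

end SeveriBrauer

/-!
Let `k` be an algebraic closure of `K` and `Γ` its group of automorphisms over `K`. The scalar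
extension of the surface `S` to `k` is `ℙ²`, on which `Γ` acts by semilinear automorphisms, and
every semilinear automorphism of projective space is induced by a semilinear map
(`exists_semilinear`): it is given by coprime homogeneous polynomials, and comparing degrees with
the inverse shows that these are linear. So `S` gives a projective semilinear representation of `Γ`
on `k³` (`exists_projectiveAction`), and every automorphism of `S` gives an endomorphism of `k³`
that commutes with `Γ` up to scalars (`exists_linear_baseAut`).

By Châtelet's theorem (`exists_iso_of_fixed_pt`), which rests on Galois descent for vector spaces
(`SemilinearAction.span_invariants`) and faithfully flat descent for morphisms
(`exists_iso_of_galAut_eq`), no line in `k³` is invariant under `Γ` unless `S` is trivial. Kernel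
and image of an endomorphism commuting with `Γ` up to scalars are invariant, so if it is nonzero it
is invertible, for otherwise one of them would be a line
(`ProjectiveAction.NoFixedLine.eq_zero_of_apply_eq_zero`). It follows that such an endomorphism,
when it is not a scalar, has exactly three eigenlines, and that these are permuted transitively by
`Γ` (`ProjectiveAction.NoFixedLine.exists_eigenbasis`). They are the geometric points over a closed
point of `S` (`exists_eigenbasis_fiber`), which then has degree three because the number of
geometric points over a closed point is its degree (`natCard_fiber`).

Hence every nontrivial element of the finite group `G` has exactly three fixed points in `ℙ²`, the
fixed triples of two elements are equal or disjoint, and elements with the same triple commute,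
being simultaneously diagonalizable. There are no involutions, because the three eigenvalues of an
involution are distinct with the same square. The pointwise stabilizers of the triples partition
`G`, and the class equation shows that one of the triples is invariant under `G`
(`exists_invariant_fixedBy`). Its image is a point of degree three fixed by `G`, and its pointwise
stabilizer is abelian and normal, of index one or three (`exists_invariant_fixedBy_and_abelian`). If
`G` is trivial, any endomorphism that is not a scalar and commutes with `Γ` gives a point of degree
three; it exists because descent also applies to the space of endomorphisms
(`ProjectiveAction.exists_compatible_ne_algebraMap`).
-/

namespace SeveriBrauer

universe u

attribute [local instance] MvPolynomial.gradedAlgebra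

/-! ### Rational functions on projective space -/

section FunctionField

open MvPolynomial HomogeneousLocalization

variable {k : Type u} [Field k] {n : ℕ}

/-- The standard grading of `k[x₀, …, xₙ]`. -/
abbrev grading (k : Type u) [Field k] (n : ℕ) : ℕ → Submodule k (MvPolynomial (Fin (n + 1)) k) :=
  homogeneousSubmodule (Fin (n + 1)) k

lemma X_mem_grading (i : Fin (n + 1)) : (X i : MvPolynomial (Fin (n + 1)) k) ∈ grading k n 1 :=
  isHomogeneous_X k i

/-- A homogeneous prime ideal that avoids one of the coordinates is a point of projective space. -/
noncomputable def pointOfPrime (I : HomogeneousIdeal (grading k n)) (hI : I.toIdeal.IsPrime)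
    (i : Fin (n + 1)) (hi : (X i : MvPolynomial (Fin (n + 1)) k) ∉ I) :
    ProjectiveSpectrum (grading k n) :=
  ⟨I, hI, fun h ↦ hi (h (by
    change (X i : MvPolynomial (Fin (n + 1)) k) ∈ HomogeneousIdeal.irrelevant (grading k n)
    rw [HomogeneousIdeal.mem_irrelevant_iff]
    exact DirectSum.decompose_of_mem_ne (grading k n) (X_mem_grading i) one_ne_zero))⟩

/-- The irrelevant ideal is generated by the coordinates. -/
lemma irrelevant_le_of_X_mem (I : HomogeneousIdeal (grading k n))
    (h : ∀ i, (X i : MvPolynomial (Fin (n + 1)) k) ∈ I) :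
    HomogeneousIdeal.irrelevant (grading k n) ≤ I := by
  intro a ha
  change a ∈ HomogeneousIdeal.irrelevant _ at ha
  rw [HomogeneousIdeal.mem_irrelevant_iff] at ha
  have h0 : coeff 0 a = 0 := by
    have : homogeneousComponent 0 a = 0 := by
      rw [← ha, GradedRing.proj_apply]
      exact (decomposition.decompose'_apply a 0).symm
    rw [homogeneousComponent_zero] at this
    simpa using this
  change a ∈ I.toIdeal
  rw [a.as_sum]
  refine Ideal.sum_mem _ fun d hd ↦ ?_
  obtain ⟨i, hi⟩ : ∃ i, d i ≠ 0 := by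
    by_contra! hd'
    obtain rfl : d = 0 := Finsupp.ext hd'
    exact (mem_support_iff.mp hd) h0
  rw [show d = (d - Finsupp.single i 1) + Finsupp.single i 1 from
    (tsub_add_cancel_of_le (by
      rw [Finsupp.single_le_iff]; omega)).symm, monomial_add_single, pow_one]
  exact Ideal.mul_mem_left _ _ (h i)

/-- A point of projective space avoids one of the coordinates. -/
lemma exists_X_notMem (p : ProjectiveSpectrum (grading k n)) :
    ∃ i, (X i : MvPolynomial (Fin (n + 1)) k) ∉ p.asHomogeneousIdeal := by
  by_contra! h
  exact p.not_irrelevant_le (irrelevant_le_of_X_mem _ h)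

/-- The generic point of projective space. -/
noncomputable def genericPt (k : Type u) [Field k] (n : ℕ) : ProjectiveSpectrum (grading k n) :=
  pointOfPrime ⊥ (by simpa using Ideal.isPrime_bot) 0 (by
    change (X 0 : MvPolynomial (Fin (n + 1)) k) ∉ (⊥ : HomogeneousIdeal (grading k n)).toIdeal
    simp)

/-- The generic point lies in every nonempty open set. -/
lemma genericPt_mem {U : (Proj (grading k n)).Opens} {p : ProjectiveSpectrum (grading k n)}
    (hp : (show Proj (grading k n) from p) ∈ U) :
    (show Proj (grading k n) from genericPt k n) ∈ U := by
  have : genericPt k n ⤳ p := by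
    rw [specializes_iff_mem_closure]
    refine (ProjectiveSpectrum.le_iff_mem_closure (𝒜 := grading k n) _ _).mp ?_
    change (genericPt k n).asHomogeneousIdeal ≤ p.asHomogeneousIdeal
    exact bot_le
  exact this.mem_open U.2 hp

/-- The embedding of the local ring of `ℙⁿ` at a point into the fraction field of
`k[x₀, …, xₙ]`. -/
noncomputable def stalkToFrac (p : ProjectiveSpectrum (grading k n)) :
    AtPrime (grading k n) p.asHomogeneousIdeal.toIdeal →+*
      FractionRing (MvPolynomial (Fin (n + 1)) k) :=
  (IsLocalization.lift (M := p.asHomogeneousIdeal.toIdeal.primeCompl)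
    (g := algebraMap (MvPolynomial (Fin (n + 1)) k)
      (FractionRing (MvPolynomial (Fin (n + 1)) k))) (fun y ↦ by
      rw [isUnit_iff_ne_zero, Ne, IsFractionRing.to_map_eq_zero_iff]
      exact fun h ↦ y.2 (h ▸ zero_mem _))).comp
  (algebraMap _ (Localization p.asHomogeneousIdeal.toIdeal.primeCompl))

lemma stalkToFrac_mk (p : ProjectiveSpectrum (grading k n))
    (c : NumDenSameDeg (grading k n) p.asHomogeneousIdeal.toIdeal.primeCompl) :
    stalkToFrac p (.mk c) = algebraMap (MvPolynomial (Fin (n + 1)) k) (FractionRing _) c.num /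
      algebraMap (MvPolynomial (Fin (n + 1)) k) (FractionRing _) c.den := by
  have hden : algebraMap _ (FractionRing (MvPolynomial (Fin (n + 1)) k))
      (c.den : MvPolynomial (Fin (n + 1)) k) ≠ 0 := by
    rw [Ne, IsFractionRing.to_map_eq_zero_iff]
    exact fun h ↦ c.den_mem (h ▸ zero_mem _)
  rw [stalkToFrac, RingHom.comp_apply, HomogeneousLocalization.algebraMap_apply,
    val_mk, Localization.mk_eq_mk', IsLocalization.lift_mk'_spec, mul_div_cancel₀ _ hden]

/-- The rational function on `ℙⁿ` given by a section of the structure sheaf over a nonempty open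
set, as an element of the fraction field of `k[x₀, …, xₙ]`. -/
noncomputable def sectionToFrac (U : (Proj (grading k n)).Opens)
    (hU : (show Proj (grading k n) from genericPt k n) ∈ U) :
    Γ(Proj (grading k n), U) →+* FractionRing (MvPolynomial (Fin (n + 1)) k) :=
  (stalkToFrac (genericPt k n)).comp
    (openToLocalization (grading k n) U (genericPt k n) hU).hom

lemma sectionToFrac_res {U V : (Proj (grading k n)).Opens} (i : U ⟶ V)
    (hU : (show Proj (grading k n) from genericPt k n) ∈ U)
    (hV : (show Proj (grading k n) from genericPt k n) ∈ V) (s : Γ(Proj (grading k n), V)) :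
    sectionToFrac U hU ((Proj (grading k n)).presheaf.map i.op s) = sectionToFrac V hV s := by
  rfl

/-- Near a point `p` of its domain, a section is a fraction `a / b` of homogeneous polynomials of
the same degree, with `b` not vanishing at `p`; it vanishes at `p` exactly when `a` does. -/
lemma exists_sectionToFrac_eq {U : (Proj (grading k n)).Opens}
    {p : ProjectiveSpectrum (grading k n)}
    (hp : (show Proj (grading k n) from p) ∈ U) (s : Γ(Proj (grading k n), U)) :
    ∃ (m : ℕ) (a b : MvPolynomial (Fin (n + 1)) k), a.IsHomogeneous m ∧ b.IsHomogeneous m ∧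
      b ∉ p.asHomogeneousIdeal ∧ sectionToFrac U (genericPt_mem hp) s =
        algebraMap _ _ a / algebraMap _ _ b ∧
      ((show Proj (grading k n) from p) ∈ (Proj (grading k n)).basicOpen s ↔
        a ∉ p.asHomogeneousIdeal) := by
  obtain ⟨V, hpV, i, m, a, b, hb, H⟩ := s.2 ⟨p, hp⟩
  have hb' : (b : MvPolynomial (Fin (n + 1)) k) ∉ p.asHomogeneousIdeal := hb ⟨p, hpV⟩
  refine ⟨m, a, b, a.2, b.2, hb', ?_, ?_⟩
  · exact (congrArg (stalkToFrac (genericPt k n)) (H ⟨genericPt k n, genericPt_mem hpV⟩)).trans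
      (stalkToFrac_mk _ _)
  · have h1 : (show Proj (grading k n) from p) ∈ (Proj (grading k n)).basicOpen s ↔
        IsUnit ((Proj (grading k n)).presheaf.germ U p hp s) := Scheme.mem_basicOpen _ _ _ hp
    have h2 : IsUnit (Proj.stalkIso' (grading k n) p
        ((ProjectiveSpectrum.Proj.structureSheaf (grading k n)).presheaf.germ U p hp s)) ↔
        IsUnit ((Proj (grading k n)).presheaf.germ U p hp s) :=
      MulEquiv.isUnit_map (Proj.stalkIso' (grading k n) p)
    have h3 : Proj.stalkIso' (grading k n) p
        ((ProjectiveSpectrum.Proj.structureSheaf (grading k n)).presheaf.germ U p hp s) =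
        HomogeneousLocalization.mk (𝒜 := grading k n) ⟨m, a, b, hb'⟩ :=
      (Proj.stalkIso'_germ (grading k n) U p hp s).trans (H ⟨p, hpV⟩)
    rw [h1, ← h2, h3, ← isUnit_iff_isUnit_val, val_mk, Localization.mk_eq_mk',
      IsLocalization.AtPrime.isUnit_mk'_iff _ p.asHomogeneousIdeal.toIdeal]
    rfl

/-- The rational function given by an element of `k[x₀, …, xₙ]_{(f)}`. -/
lemma sectionToFrac_awayToSection {f : MvPolynomial (Fin (n + 1)) k}
    (hf : (show Proj (grading k n) from genericPt k n) ∈ Proj.basicOpen (grading k n) f)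
    (c : NumDenSameDeg (grading k n) (Submonoid.powers f)) :
    sectionToFrac _ hf (Proj.awayToSection (grading k n) f (HomogeneousLocalization.mk c)) =
      algebraMap (MvPolynomial (Fin (n + 1)) k) (FractionRing _) c.num /
      algebraMap (MvPolynomial (Fin (n + 1)) k) (FractionRing _) c.den :=
  stalkToFrac_mk (genericPt k n) ⟨c.deg, c.num, c.den, (Submonoid.powers_le.mpr hf) c.den_mem⟩

end FunctionField

/-! ### Homogeneous polynomials -/

section HomogeneousPolynomials

open MvPolynomial

variable {σ R S : Type*} [CommRing R] [CommRing S]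

/-- Homogeneity, for values in an arbitrary ring: scaling all arguments by `c` multiplies the value
by `c ^ m`. -/
lemma eval₂_mul_of_isHomogeneous {a : MvPolynomial σ R} {m : ℕ} (ha : a.IsHomogeneous m)
    (φ : R →+* S) (c : S) (g : σ → S) :
    eval₂ φ (fun i ↦ c * g i) a = c ^ m * eval₂ φ g a := by
  rw [eval₂_eq, eval₂_eq, Finset.mul_sum]
  refine Finset.sum_congr rfl fun d hd ↦ ?_
  have : m = ∑ i ∈ d.support, d i := ha.degree_eq_sum_deg_support hd
  simp_rw [mul_pow, Finset.prod_mul_distrib, Finset.prod_pow_eq_pow_sum, ← this]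
  ring

/-- Substituting `t * g i` for the variables separates the homogeneous components: the component of
degree `d` becomes the coefficient of `t ^ d`. -/
lemma coeff_eval₂_C_mul_X (φ : R →+* S) (g : σ → S) (a : MvPolynomial σ R) (d : ℕ) :
    (eval₂ (Polynomial.C.comp φ) (fun i ↦ Polynomial.X * Polynomial.C (g i)) a).coeff d =
      eval₂ φ g (homogeneousComponent d a) := by
  have key (m : ℕ) : eval₂ (Polynomial.C.comp φ) (fun i ↦ Polynomial.X * Polynomial.C (g i))
      (homogeneousComponent m a) = Polynomial.X ^ m *
        Polynomial.C (eval₂ φ g (homogeneousComponent m a)) := by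
    rw [eval₂_mul_of_isHomogeneous (homogeneousComponent_isHomogeneous m a),
      hom_eval₂ _ φ Polynomial.C]
  conv_lhs => rw [← sum_homogeneousComponent a, eval₂_sum]
  simp_rw [key, Polynomial.finsetSum_coeff]
  simp_rw [mul_comm (Polynomial.X ^ _), Polynomial.coeff_C_mul_X_pow]
  rw [Finset.sum_ite_eq (Finset.range (a.totalDegree + 1)) d]
  split_ifs with h
  · rfl
  · rw [homogeneousComponent_eq_zero _ _ (by simpa using h), eval₂_zero]

/-- A divisor of a nonzero homogeneous polynomial over a domain is homogeneous. -/
lemma exists_isHomogeneous_of_mul [IsDomain R] {a b : MvPolynomial σ R} {m : ℕ}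
    (h : (a * b).IsHomogeneous m) (hab : a * b ≠ 0) : ∃ d, a.IsHomogeneous d := by
  -- compare the lowest and the highest power of `t` in `a(tx) b(tx) = t ^ m (ab)(x)`
  let T : MvPolynomial σ R →+* Polynomial (MvPolynomial σ R) :=
    eval₂Hom (Polynomial.C.comp C) (fun i ↦ Polynomial.X * Polynomial.C (X i))
  have hT (p : MvPolynomial σ R) (d : ℕ) : (T p).coeff d = homogeneousComponent d p := by
    exact (coeff_eval₂_C_mul_X C X p d).trans (eval₂_eta _)
  have hTab : T (a * b) = Polynomial.monomial m (a * b) := by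
    ext1 d
    rw [hT, homogeneousComponent_of_mem (show a * b ∈ homogeneousSubmodule σ R m from h),
      Polynomial.coeff_monomial]
    simp only [eq_comm]
  have ha0 : T a ≠ 0 := fun h0 ↦ hab (by
    rw [map_mul, h0, zero_mul] at hTab
    exact (Polynomial.monomial_eq_zero_iff _ _).mp hTab.symm)
  have hb0 : T b ≠ 0 := fun h0 ↦ hab (by
    rw [map_mul, h0, mul_zero] at hTab
    exact (Polynomial.monomial_eq_zero_iff _ _).mp hTab.symm)
  have h1 : (T a).natDegree + (T b).natDegree = m := by
    rw [← Polynomial.natDegree_mul ha0 hb0, ← map_mul, hTab,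
      Polynomial.natDegree_monomial_eq _ hab]
  have h2 : (T a).natTrailingDegree + (T b).natTrailingDegree = m := by
    rw [← Polynomial.natTrailingDegree_mul ha0 hb0, ← map_mul, hTab,
      Polynomial.natTrailingDegree_monomial hab]
  have h3 := (T a).natTrailingDegree_le_natDegree
  have h4 := (T b).natTrailingDegree_le_natDegree
  refine ⟨(T a).natDegree, ?_⟩
  have : a = homogeneousComponent (T a).natDegree a := by
    conv_lhs => rw [← sum_homogeneousComponent a]
    refine (Finset.sum_eq_single _ (fun d _ hd ↦ ?_) fun hd ↦ ?_)
    · rw [← hT]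
      rcases lt_or_gt_of_ne hd with hd | hd
      · exact Polynomial.coeff_eq_zero_of_lt_natTrailingDegree (by omega)
      · exact Polynomial.coeff_eq_zero_of_natDegree_lt hd
    · exact homogeneousComponent_eq_zero _ _ (by simpa using hd)
  have hhom := homogeneousComponent_isHomogeneous (T a).natDegree a
  rwa [← this] at hhom

end HomogeneousPolynomials

/-! ### Points of projective space with given homogeneous coordinates -/

section Points

open MvPolynomial

variable {k : Type u} [Field k] {n : ℕ}

lemma homogeneousIdeal_ext {I J : HomogeneousIdeal (grading k n)}
    (h : ∀ (m : ℕ) (a : MvPolynomial (Fin (n + 1)) k), a.IsHomogeneous m → (a ∈ I ↔ a ∈ J)) :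
    I = J := by
  have key {I J : HomogeneousIdeal (grading k n)}
    (h : ∀ (m : ℕ) (a : MvPolynomial (Fin (n + 1)) k), a.IsHomogeneous m → a ∈ I → a ∈ J) :
    I ≤ J := fun a ha ↦ by
    change a ∈ I.toIdeal at ha
    change a ∈ J.toIdeal
    rw [← sum_homogeneousComponent a]
    refine Ideal.sum_mem _ fun m _ ↦ h m _ (homogeneousComponent_isHomogeneous m a) ?_
    exact homogeneousComponent_mem_of_mem I.isHomogeneous ha m
  exact le_antisymm (key fun m a ha ↦ (h m a ha).mp) (key fun m a ha ↦ (h m a ha).mpr)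

/-- The ideal of polynomials vanishing on the line through `v`, as the kernel of the substitution of
`t * v i` for the variables, which makes it visibly prime. -/
noncomputable def lineIdeal (v : Fin (n + 1) → k) : Ideal (MvPolynomial (Fin (n + 1)) k) :=
  RingHom.ker (eval₂Hom (Polynomial.C.comp (RingHom.id k))
    (fun i ↦ Polynomial.X * Polynomial.C (v i)))

lemma mem_lineIdeal {v : Fin (n + 1) → k} {a : MvPolynomial (Fin (n + 1)) k} :
    a ∈ lineIdeal v ↔ ∀ d, eval v (homogeneousComponent d a) = 0 := by
  rw [lineIdeal, RingHom.mem_ker, coe_eval₂Hom, Polynomial.ext_iff]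
  refine forall_congr' fun d ↦ ?_
  rw [coeff_eval₂_C_mul_X, Polynomial.coeff_zero]
  rfl

lemma mem_lineIdeal_of_isHomogeneous {v : Fin (n + 1) → k} {a : MvPolynomial (Fin (n + 1)) k}
    {m : ℕ} (ha : a.IsHomogeneous m) : a ∈ lineIdeal v ↔ eval v a = 0 := by
  rw [mem_lineIdeal]
  refine ⟨fun h ↦ by simpa [homogeneousComponent_eq_self ha] using h m, fun h d ↦ ?_⟩
  rw [homogeneousComponent_of_mem (show a ∈ homogeneousSubmodule _ k m from ha)]
  split_ifs <;> simp [h]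

/-- The point `[v₀ : ⋯ : vₙ]` of projective space: the prime ideal of the line through `v`. Only
homogeneous membership in this ideal is described by evaluation at `v`, see `mem_pt`. -/
noncomputable def pt (v : Fin (n + 1) → k) (hv : v ≠ 0) : ProjectiveSpectrum (grading k n) :=
  pointOfPrime ⟨lineIdeal v, fun d a ha ↦ by
      have ha' := mem_lineIdeal.mp ha d
      have e : (DirectSum.decompose (grading k n) a d : MvPolynomial (Fin (n + 1)) k) =
        homogeneousComponent d a := decomposition.decompose'_apply a d
      rwa [e, mem_lineIdeal_of_isHomogeneous (homogeneousComponent_isHomogeneous d a)]⟩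
    (RingHom.ker_isPrime _) (Function.ne_iff.mp hv).choose fun h ↦
      (Function.ne_iff.mp hv).choose_spec (by
        have := (mem_lineIdeal_of_isHomogeneous (isHomogeneous_X k _)).mp h
        simpa using this)

lemma mem_pt {v : Fin (n + 1) → k} (hv : v ≠ 0) {a : MvPolynomial (Fin (n + 1)) k}
    {m : ℕ} (ha : a.IsHomogeneous m) : a ∈ (pt v hv).asHomogeneousIdeal ↔ eval v a = 0 :=
  mem_lineIdeal_of_isHomogeneous ha

lemma isHomogeneous_minor (c d : k) (i j : Fin (n + 1)) :
    (C c * X i - C d * X j : MvPolynomial (Fin (n + 1)) k).IsHomogeneous 1 :=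
  ((isHomogeneous_X k i).C_mul c).sub ((isHomogeneous_X k j).C_mul d)

/-- A point of projective space satisfying the equations `v j * x i = v i * x j` is `[v]`. -/
lemma eq_pt_of_mem (p : ProjectiveSpectrum (grading k n)) (v : Fin (n + 1) → k) (hv : v ≠ 0)
    (j : Fin (n + 1)) (hj : v j ≠ 0)
    (h : ∀ i, C (v j) * X i - C (v i) * X j ∈ p.asHomogeneousIdeal) : p = pt v hv := by
  have h' (i) : Ideal.Quotient.mk p.asHomogeneousIdeal.toIdeal (C (v j) * X i) =
      Ideal.Quotient.mk p.asHomogeneousIdeal.toIdeal (C (v i) * X j) :=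
    Ideal.Quotient.eq.mpr (h i)
  have hprime : p.asHomogeneousIdeal.toIdeal.IsPrime := p.isPrime
  set π := Ideal.Quotient.mk p.asHomogeneousIdeal.toIdeal with hπ
  have hXj : π (X j) ≠ 0 := by
    intro h0
    obtain ⟨i, hi⟩ := exists_X_notMem p
    have := h' i
    rw [map_mul, map_mul, h0, mul_zero, mul_eq_zero] at this
    rcases this with h1 | h1
    · exact hj ((map_eq_zero (π.comp C)).mp h1)
    · exact hi (Ideal.Quotient.eq_zero_iff_mem.mp h1)
  apply ProjectiveSpectrum.ext
  refine homogeneousIdeal_ext fun m a ha ↦ ?_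
  rw [mem_pt hv ha]
  have e1 : π (C (v j)) ^ m * π a = π (X j) ^ m * π (C (eval v a)) := by
    have e2 : π a = eval₂ (π.comp C) (fun i ↦ π (X i)) a := by
      conv_lhs => rw [← eval₂_eta a, hom_eval₂]
    have e3 : π (C (eval v a)) = eval₂ (π.comp C) (fun i ↦ π (C (v i))) a := by
      rw [MvPolynomial.eval, coe_eval₂Hom, ← RingHom.comp_apply, hom_eval₂]
      rfl
    rw [e2, e3, ← eval₂_mul_of_isHomogeneous ha, ← eval₂_mul_of_isHomogeneous ha]
    congr 1
    ext i
    rw [← map_mul, h', map_mul, mul_comm]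
  change a ∈ p.asHomogeneousIdeal.toIdeal ↔ _
  rw [← Ideal.Quotient.eq_zero_iff_mem, ← hπ]
  have hvj : π (C (v j)) ≠ 0 := fun h0 ↦ hj ((map_eq_zero (π.comp C)).mp h0)
  constructor
  · intro h0
    rw [h0, mul_zero, eq_comm, mul_eq_zero] at e1
    exact (map_eq_zero (π.comp C)).mp (e1.resolve_left (pow_ne_zero _ hXj))
  · intro h0
    rw [h0, map_zero, map_zero, mul_zero, mul_eq_zero] at e1
    exact e1.resolve_left (pow_ne_zero _ hvj)

/-- Homogeneous coordinates are unique up to a scalar. -/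
lemma pt_eq_pt_iff {v w : Fin (n + 1) → k} (hv : v ≠ 0) (hw : w ≠ 0) :
    pt v hv = pt w hw ↔ ∃ c : k, w = c • v := by
  obtain ⟨j, hj⟩ := Function.ne_iff.mp hv
  constructor
  · intro h
    refine ⟨w j / v j, funext fun i ↦ ?_⟩
    have h1 : C (v j) * X i - C (v i) * X j ∈ (pt v hv).asHomogeneousIdeal :=
      (mem_pt hv (isHomogeneous_minor _ _ _ _)).mpr (by simp [mul_comm])
    rw [h, mem_pt hw (isHomogeneous_minor _ _ _ _)] at h1
    simp only [map_sub, map_mul, eval_C, eval_X, sub_eq_zero] at h1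
    have hj' : v j ≠ 0 := hj
    simp only [Pi.smul_apply, smul_eq_mul]
    field_simp
    linear_combination h1
  · rintro ⟨c, rfl⟩
    refine (eq_pt_of_mem _ v hv j hj fun i ↦ (mem_pt hw (isHomogeneous_minor _ _ _ _)).mpr ?_).symm
    simp
    ring

end Points

/-! ### The structure morphism of projective space and constant functions -/

section StructureMorphism

open MvPolynomial HomogeneousLocalization

variable {k : Type u} [Field k] {n : ℕ}

/-- The structure morphism of projective space. -/
noncomputable def projStr (k : Type u) [Field k] (n : ℕ) :
    Proj (grading k n) ⟶ Spec (.of k) :=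
  (projectiveSpace n k).hom

lemma le_preimage_top {X Y : Scheme.{u}} (f : X ⟶ Y) (U : X.Opens) : U ≤ f ⁻¹ᵁ ⊤ :=
  fun _ _ ↦ trivial

/-- The constants, as sections of the structure sheaf of a `k`-scheme. -/
noncomputable def constSection {X : Scheme.{u}} (f : X ⟶ Spec (.of k)) (U : X.Opens) :
    CommRingCat.of k ⟶ Γ(X, U) :=
  (Scheme.ΓSpecIso (.of k)).inv ≫ f.appLE ⊤ U (le_preimage_top f U)

/-- The inclusion of the constants in `k[x₀, …, xₙ]_{(f)}`. -/
noncomputable def constAway (f : MvPolynomial (Fin (n + 1)) k) : k →+* Away (grading k n) f :=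
  (fromZeroRingHom (grading k n) (Submonoid.powers f)).comp
    (algebraMap k (homogeneousSubmodule (Fin (n + 1)) k 0))

lemma awayι_projStr (f : MvPolynomial (Fin (n + 1)) k) {m : ℕ}
    (hf : f ∈ grading k n m) (hm : 0 < m) :
    Proj.awayι (grading k n) f hf hm ≫ projStr k n =
      Spec.map (CommRingCat.ofHom (constAway f)) := by
  dsimp [projStr, projectiveSpace]
  rw [Proj.awayι_toSpecZero_assoc, ← Spec.map_comp]
  rfl

lemma constSection_res {X : Scheme.{u}} (f : X ⟶ Spec (.of k)) {U V : X.Opens} (i : U ⟶ V) :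
    constSection f V ≫ X.presheaf.map i.op = constSection f U := by
  simp only [constSection, Category.assoc, Scheme.Hom.appLE_map]

lemma toSpecΓ_constSection {X : Scheme.{u}} (f : X ⟶ Spec (.of k)) (U : X.Opens) :
    U.toSpecΓ ≫ Spec.map (constSection f U) = U.ι ≫ f := by
  have h := Scheme.Opens.toSpecΓ_SpecMap_appLE f ⊤ U (le_preimage_top f U)
  rw [constSection, Spec.map_comp, reassoc_of% h, Scheme.Opens.toSpecΓ_top, Category.assoc,
    toSpecΓ_SpecMap_ΓSpecIso_inv]
  simp

/-- A `σ`-semilinear morphism acts on constants by `σ`. -/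
lemma constSection_app {X Y : Scheme.{u}} (f : X ⟶ Spec (.of k)) (g : Y ⟶ Spec (.of k))
    (ψ : X ⟶ Y) (σ : k →+* k) (hψ : ψ ≫ g = f ≫ Spec.map (CommRingCat.ofHom σ)) (U : Y.Opens) :
    constSection g U ≫ ψ.app U = CommRingCat.ofHom σ ≫ constSection f (ψ ⁻¹ᵁ U) := by
  simp only [constSection, Category.assoc, Scheme.Hom.app_eq_appLE, Scheme.Hom.appLE_comp_appLE]
  have : CommRingCat.ofHom σ ≫ (Scheme.ΓSpecIso (CommRingCat.of k)).inv =
      (Scheme.ΓSpecIso (CommRingCat.of k)).inv ≫ (Spec.map (CommRingCat.ofHom σ)).appTop :=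
    Scheme.ΓSpecIso_inv_naturality _
  rw [reassoc_of% this]
  congr 1
  simp only [hψ, Scheme.Hom.comp_appLE]
  rfl

lemma constSection_basicOpen (f : MvPolynomial (Fin (n + 1)) k) {m : ℕ}
    (hf : f ∈ grading k n m) (hm : 0 < m) :
    constSection (projStr k n) (Proj.basicOpen (grading k n) f) =
      CommRingCat.ofHom (constAway f) ≫ Proj.awayToSection (grading k n) f := by
  have haff : IsAffineOpen (Proj.basicOpen (grading k n) f) :=
    Proj.isAffineOpen_basicOpen _ _ hf hm
  apply Spec.map_injective
  rw [← cancel_epi haff.isoSpec.hom, IsAffineOpen.isoSpec_hom, toSpecΓ_constSection]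
  have h1 := awayι_projStr f hf hm
  rw [Proj.awayι, Category.assoc, Iso.inv_comp_eq, Proj.basicOpenIsoSpec_hom,
    Proj.basicOpenToSpec] at h1
  rw [h1, Spec.map_comp, Category.assoc]

lemma sectionToFrac_constSection (U : (Proj (grading k n)).Opens)
    (hU : (show Proj (grading k n) from genericPt k n) ∈ U) (c : k) :
    sectionToFrac U hU (constSection (projStr k n) U c) =
      algebraMap (MvPolynomial (Fin (n + 1)) k) (FractionRing _) (C c) := by
  obtain ⟨i, hi⟩ := exists_X_notMem (genericPt k n)
  set V := Proj.basicOpen (grading k n) (X i)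
  have hV : (show Proj (grading k n) from genericPt k n) ∈ V := hi
  have h1 (W : (Proj (grading k n)).Opens)
      (hW : (show Proj (grading k n) from genericPt k n) ∈ W) :
      sectionToFrac W hW (constSection (projStr k n) W c) =
      sectionToFrac ⊤ trivial (constSection (projStr k n) ⊤ c) := by
    rw [← constSection_res (projStr k n) (homOfLE (le_top : W ≤ ⊤))]
    rfl
  rw [h1, ← h1 V hV, constSection_basicOpen (X i) (X_mem_grading i) one_pos]
  refine (sectionToFrac_awayToSection hV _).trans ?_
  simp

end StructureMorphism

/-! ### Pulling back coordinate functions along an endomorphism of projective space -/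

section Coordinates

open MvPolynomial HomogeneousLocalization

variable {k : Type u} [Field k] {n : ℕ}

local notation "frac" => algebraMap (MvPolynomial (Fin (n + 1)) k)
  (FractionRing (MvPolynomial (Fin (n + 1)) k))

lemma frac_injective : Function.Injective (frac) := IsFractionRing.injective _ _

lemma frac_ne_zero {a : MvPolynomial (Fin (n + 1)) k} (ha : a ≠ 0) : frac a ≠ 0 :=
  (map_ne_zero_iff _ frac_injective).mpr ha

/-- The element `a / x j ^ m` of `k[x₀, …, xₙ]_{(x j)}`. -/
noncomputable def divX (j : Fin (n + 1)) {m : ℕ} {a : MvPolynomial (Fin (n + 1)) k}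
    (ha : a.IsHomogeneous m) : Away (grading k n) (X j : MvPolynomial (Fin (n + 1)) k) :=
  Away.mk (grading k n) (X_mem_grading j) m a (by simpa using ha)

/-- The fraction `a / x j ^ m` is the value of `a` at the ratios `x i / x j`. -/
lemma divX_eq_eval₂ (j : Fin (n + 1)) {m : ℕ} {a : MvPolynomial (Fin (n + 1)) k}
    (ha : a.IsHomogeneous m) :
    divX j ha = eval₂ (constAway (X j)) (fun i ↦ divX j (isHomogeneous_X k i)) a := by
  set L := Localization.Away (X j : MvPolynomial (Fin (n + 1)) k)
  have hinj : Function.Injective (algebraMap (Away (grading k n)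
    (X j : MvPolynomial (Fin (n + 1)) k)) L) := val_injective _
  have hu : IsUnit (algebraMap _ L (X j : MvPolynomial (Fin (n + 1)) k) ^ m) :=
    (IsLocalization.map_units L (⟨X j, Submonoid.mem_powers _⟩ : Submonoid.powers _)).pow m
  have hval {l : ℕ} {b : MvPolynomial (Fin (n + 1)) k} (hb : b.IsHomogeneous l) :
      algebraMap _ L (X j : MvPolynomial (Fin (n + 1)) k) ^ l * algebraMap _ L (divX j hb) =
        algebraMap _ L b := by
    rw [HomogeneousLocalization.algebraMap_apply, divX, Away.val_mk, Localization.mk_eq_mk',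
      ← map_pow]
    exact IsLocalization.mk'_spec' L b ⟨_, _⟩
  apply hinj
  apply hu.mul_left_cancel
  rw [hval ha, hom_eval₂, ← eval₂_mul_of_isHomogeneous ha]
  have h1 (i : Fin (n + 1)) :
      algebraMap (MvPolynomial (Fin (n + 1)) k) L (X j) *
        algebraMap _ L (divX j (isHomogeneous_X k i)) =
      algebraMap (MvPolynomial (Fin (n + 1)) k) L (X i) := by
    rw [← hval (isHomogeneous_X k i), pow_one]
  have h2 : (algebraMap (Away (grading k n) (X j : MvPolynomial (Fin (n + 1)) k)) L).comp
      (constAway (X j)) = (algebraMap (MvPolynomial (Fin (n + 1)) k) L).comp C := by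
    ext c
    change (constAway (X j) c).val = _
    change Localization.mk _ _ = _
    rw [Localization.mk_eq_mk', RingHom.comp_apply]
    exact IsLocalization.mk'_one L _
  simp only [h1, h2]
  conv_lhs => rw [← eval₂_eta a, hom_eval₂]

variable (ψ : Proj (grading k n) ⟶ Proj (grading k n))

/-- The ring homomorphism `k[x₀, …, xₙ]_{(f)} → k(x₀, …, xₙ)` which pulls back functions along a
morphism `ψ : ℙⁿ ⟶ ℙⁿ`. -/
noncomputable def pullFrac (f : MvPolynomial (Fin (n + 1)) k)
    (hf : (show Proj (grading k n) from genericPt k n) ∈ ψ ⁻¹ᵁ Proj.basicOpen (grading k n) f) :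
    Away (grading k n) f →+* FractionRing (MvPolynomial (Fin (n + 1)) k) :=
  ((sectionToFrac _ hf).comp (ψ.app _).hom).comp (Proj.awayToSection (grading k n) f).hom

lemma pullFrac_constAway {σ : k →+* k}
    (hψ : ψ ≫ projStr k n = projStr k n ≫ Spec.map (CommRingCat.ofHom σ))
    {f : MvPolynomial (Fin (n + 1)) k} {m : ℕ} (hfm : f ∈ grading k n m) (hm : 0 < m)
    (hf : (show Proj (grading k n) from genericPt k n) ∈ ψ ⁻¹ᵁ Proj.basicOpen (grading k n) f)
    (c : k) : pullFrac ψ f hf (constAway f c) = frac (C (σ c)) := by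
  have h1 := constSection_app (projStr k n) (projStr k n) ψ σ hψ (Proj.basicOpen (grading k n) f)
  have h2 := congrArg (fun φ ↦ φ.hom c) h1
  have h3 := congrArg (fun φ ↦ φ.hom c) (constSection_basicOpen f hfm hm)
  simp only [CommRingCat.hom_comp, RingHom.comp_apply, CommRingCat.hom_ofHom] at h2 h3
  rw [h3] at h2
  rw [pullFrac, RingHom.comp_apply, RingHom.comp_apply]
  exact (congrArg (sectionToFrac _ hf) h2).trans (sectionToFrac_constSection _ hf _)

/-- Pulling back functions is compatible with restriction to a smaller basic open set. -/
lemma pullFrac_awayMap {f g : MvPolynomial (Fin (n + 1)) k} {m : ℕ} (hg : g ∈ grading k n m)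
    {x : MvPolynomial (Fin (n + 1)) k} (hx : x = f * g)
    (hf : (show Proj (grading k n) from genericPt k n) ∈ ψ ⁻¹ᵁ Proj.basicOpen (grading k n) f)
    (hfg : (show Proj (grading k n) from genericPt k n) ∈ ψ ⁻¹ᵁ Proj.basicOpen (grading k n) x)
    (y : Away (grading k n) f) :
    pullFrac ψ x hfg (awayMap (grading k n) hg hx y) = pullFrac ψ f hf y := by
  have h1 := Proj.awayMap_awayToSection (grading k n) hg hx
  have h2 := ψ.naturality
    (homOfLE (Proj.basicOpen_mono (grading k n) f x ⟨_, hx⟩)).op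
  have h3 := congrArg (fun φ ↦ φ.hom y) h1
  have h4 := congrArg (fun φ ↦ φ.hom ((Proj.awayToSection (grading k n) f).hom y)) h2
  simp only [CommRingCat.hom_comp, RingHom.comp_apply, CommRingCat.hom_ofHom] at h3 h4
  rw [pullFrac, RingHom.comp_apply, RingHom.comp_apply, h3, pullFrac, RingHom.comp_apply,
    RingHom.comp_apply, h4]
  exact sectionToFrac_res _ hfg hf _

variable (hgen : ∀ f : MvPolynomial (Fin (n + 1)) k, f ≠ 0 →
  (show Proj (grading k n) from genericPt k n) ∈ ψ ⁻¹ᵁ Proj.basicOpen (grading k n) f)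

/-- The rational function obtained by pulling back `x i / x j` along `ψ`, which is required to send
the generic point into every nonempty basic open set. -/
noncomputable def pullRatio (i j : Fin (n + 1)) : FractionRing (MvPolynomial (Fin (n + 1)) k) :=
  pullFrac ψ (X j) (hgen _ (X_ne_zero j)) (divX j (isHomogeneous_X k i))

lemma pullRatio_mul (i j l : Fin (n + 1)) :
    pullRatio ψ hgen i j * pullRatio ψ hgen j l = pullRatio ψ hgen i l := by
  have hne : (X j * X l : MvPolynomial (Fin (n + 1)) k) ≠ 0 :=
    mul_ne_zero (X_ne_zero j) (X_ne_zero l)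
  simp only [pullRatio]
  rw [← pullFrac_awayMap ψ (X_mem_grading l) rfl _ (hgen _ hne),
    ← pullFrac_awayMap ψ (X_mem_grading j) (mul_comm _ _) (hgen _ (X_ne_zero l)) (hgen _ hne),
    ← pullFrac_awayMap ψ (X_mem_grading j) (mul_comm _ _) (hgen _ (X_ne_zero l)) (hgen _ hne),
    ← map_mul]
  congr 1
  apply val_injective
  simp only [divX, val_mul, val_awayMap_mk, Away.mk, Localization.mk_mul]
  rw [Localization.mk_eq_mk_iff, Localization.r_iff_exists]
  refine ⟨1, ?_⟩
  simp
  ring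

lemma pullRatio_self (j : Fin (n + 1)) : pullRatio ψ hgen j j = 1 := by
  have : divX j (isHomogeneous_X k j) = 1 := by
    apply val_injective
    simp only [divX, Away.mk, val_mk, val_one]
    simp only [pow_one]
    exact Localization.mk_self ⟨X j, _⟩
  rw [pullRatio, this, map_one]

/-- A semilinear `ψ` is determined by the pullbacks of the ratios `x i / x j`: the pullback of
`a / x j ^ m` is the value at these of `a`, with `σ` applied to its coefficients. -/
lemma pullFrac_divX {σ : k →+* k}
    (hψ : ψ ≫ projStr k n = projStr k n ≫ Spec.map (CommRingCat.ofHom σ)) (j : Fin (n + 1))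
    {m : ℕ} {a : MvPolynomial (Fin (n + 1)) k} (ha : a.IsHomogeneous m) :
    pullFrac ψ (X j) (hgen _ (X_ne_zero j)) (divX j ha) =
      eval₂ ((frac).comp (C.comp σ)) (fun i ↦ pullRatio ψ hgen i j) a := by
  rw [divX_eq_eval₂, hom_eval₂]
  congr 1
  ext c
  exact pullFrac_constAway ψ hψ (X_mem_grading j) one_pos _ c

/-- Locally at `p`, the pullback of `a / x j ^ m` is a fraction with denominator not vanishing at
`p`; its numerator vanishes at `p` exactly when `a` vanishes at `q = ψ p`. -/
lemma exists_pullFrac_divX_eq {p q : ProjectiveSpectrum (grading k n)}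
    (hpq : ψ p = q) {j : Fin (n + 1)}
    (hj : (X j : MvPolynomial (Fin (n + 1)) k) ∉ q.asHomogeneousIdeal)
    {m : ℕ} {a : MvPolynomial (Fin (n + 1)) k} (ha : a.IsHomogeneous m) :
    ∃ (m' : ℕ) (b c : MvPolynomial (Fin (n + 1)) k), b.IsHomogeneous m' ∧ c.IsHomogeneous m' ∧
      c ∉ p.asHomogeneousIdeal ∧
      pullFrac ψ (X j) (hgen _ (X_ne_zero j)) (divX j ha) = frac b / frac c ∧
      (a ∈ q.asHomogeneousIdeal ↔ b ∈ p.asHomogeneousIdeal) := by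
  set s := Proj.awayToSection (grading k n) (X j) (divX j ha) with hs
  have hq : (show Proj (grading k n) from q) ∈ Proj.basicOpen (grading k n) (X j) := hj
  have hp : (show Proj (grading k n) from p) ∈ ψ ⁻¹ᵁ Proj.basicOpen (grading k n) (X j) := by
    rw [← hpq] at hq
    exact hq
  obtain ⟨m', b, c, hb, hc, hcp, hbc, hmem⟩ := exists_sectionToFrac_eq hp (ψ.app _ s)
  refine ⟨m', b, c, hb, hc, hcp, hbc, ?_⟩
  have h1 : (show Proj (grading k n) from q) ∈ (Proj (grading k n)).basicOpen s ↔
      a ∉ q.asHomogeneousIdeal := by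
    obtain ⟨m₁, b₁, c₁, hb₁, hc₁, hcp₁, hbc₁, hmem₁⟩ := exists_sectionToFrac_eq hq s
    have hX : frac (X j) ≠ 0 := frac_ne_zero (X_ne_zero j)
    have h2 := sectionToFrac_awayToSection (genericPt_mem hq)
      ⟨m • 1, ⟨a, by simpa using ha⟩, ⟨X j ^ m, SetLike.pow_mem_graded m (X_mem_grading j)⟩,
        ⟨m, rfl⟩⟩
    have h3 : frac b₁ / frac c₁ = frac a / frac (X j ^ m) := hbc₁.symm.trans h2
    have hc0 : frac c₁ ≠ 0 := frac_ne_zero fun h ↦ hcp₁ (h ▸ zero_mem _)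
    rw [div_eq_div_iff hc0 (by rw [map_pow]; exact pow_ne_zero _ hX), ← map_mul, ← map_mul] at h3
    have h4 := frac_injective h3
    rw [hmem₁, not_iff_not]
    have hprime : q.asHomogeneousIdeal.toIdeal.IsPrime := q.isPrime
    have e1 : b₁ ∈ q.asHomogeneousIdeal ↔ b₁ * X j ^ m ∈ q.asHomogeneousIdeal.toIdeal := by
      rw [hprime.mul_mem_iff_mem_or_mem]
      exact ⟨Or.inl, fun h ↦ h.resolve_right fun h ↦ hj (hprime.mem_of_pow_mem _ h)⟩
    have e2 : a ∈ q.asHomogeneousIdeal ↔ a * c₁ ∈ q.asHomogeneousIdeal.toIdeal := by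
      rw [hprime.mul_mem_iff_mem_or_mem]
      exact ⟨Or.inl, fun h ↦ h.resolve_right hcp₁⟩
    rw [e1, e2, h4]
  rw [← not_iff_not, ← h1, ← hmem, ← Scheme.preimage_basicOpen]
  change _ ↔ ψ p ∈ (Proj (grading k n)).basicOpen s
  rw [hpq]

end Coordinates

/-! ### Semilinear automorphisms of projective space -/

section Automorphisms

open MvPolynomial HomogeneousLocalization

local notation "frac" => algebraMap (MvPolynomial (Fin (_ + 1)) _)
  (FractionRing (MvPolynomial (Fin (_ + 1)) _))

/-- A family of elements of a factorial ring can be divided by its greatest common divisor. -/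
lemma exists_primitive {R ι : Type*} [CommRing R] [IsDomain R] [UniqueFactorizationMonoid R]
    [Fintype ι] [Nonempty ι] (B : ι → R) :
    ∃ (e : R) (g : ι → R), (∀ i, B i = e * g i) ∧
      ∀ x a : R, (∀ i, x ∣ g i * a) → x ∣ a := by
  classical
  let _ : StrongNormalizationMonoid R := UniqueFactorizationMonoid.strongNormalizationMonoid
  let _ := UniqueFactorizationMonoid.toStrongNormalizedGCDMonoid R
  obtain ⟨g, hg, hg1⟩ := Finset.extract_gcd B (Finset.univ_nonempty (α := ι))
  refine ⟨_, g, fun i ↦ hg i (Finset.mem_univ i), fun x a h ↦ ?_⟩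
  have h1 : x ∣ Finset.univ.gcd fun i ↦ g i * a := Finset.dvd_gcd fun i _ ↦ h i
  rw [Finset.gcd_mul_right, hg1, one_mul] at h1
  exact h1.trans (normalize_associated a).dvd

variable {k : Type u} [Field k] {n : ℕ}

/-- The pullback of `x i / x j` is a quotient of homogeneous polynomials of the same degree. -/
lemma exists_frac_eq (ψ : Proj (grading k n) ⟶ Proj (grading k n))
    (hgen : ∀ f : MvPolynomial (Fin (n + 1)) k, f ≠ 0 →
      (show Proj (grading k n) from genericPt k n) ∈ ψ ⁻¹ᵁ Proj.basicOpen (grading k n) f)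
    (i j : Fin (n + 1)) : ∃ (m : ℕ) (b c : MvPolynomial (Fin (n + 1)) k), b.IsHomogeneous m ∧
      c.IsHomogeneous m ∧ c ≠ 0 ∧ pullRatio ψ hgen i j = frac b / frac c := by
  obtain ⟨m, b, c, hb, hc, hc0, h, -⟩ := exists_sectionToFrac_eq (p := genericPt k n)
    (hgen _ (X_ne_zero j)) (ψ.app _ (Proj.awayToSection (grading k n) (X j)
      (divX j (isHomogeneous_X k i))))
  exact ⟨m, b, c, hb, hc, fun h0 ↦ hc0 (h0 ▸ zero_mem _), h⟩

/-- The value at `v` of the polynomial obtained from `a` by applying `σ` to the coefficients and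
substituting `g`, when `g` takes the values `σ (u i)` at `v`. -/
lemma eval_eval₂_C {σ : k →+* k} {g : Fin (n + 1) → MvPolynomial (Fin (n + 1)) k}
    {u v : Fin (n + 1) → k} (h : ∀ i, σ (u i) = eval v (g i)) (a : MvPolynomial (Fin (n + 1)) k) :
    eval v (eval₂ (C.comp σ) g a) = σ (eval u a) := by
  have h1 : (MvPolynomial.eval v).comp (C.comp σ) = σ := by
    ext x
    simp
  have h2 : (fun i ↦ MvPolynomial.eval v (g i)) = fun i ↦ σ (u i) := funext fun i ↦ (h i).symm
  rw [hom_eval₂, h1, h2]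
  conv_rhs => rw [MvPolynomial.eval, coe_eval₂Hom, hom_eval₂]
  rfl

/-- A dominant semilinear morphism `ℙⁿ ⟶ ℙⁿ` is given by a tuple of homogeneous polynomials of the
same degree, namely by any tuple of coprime polynomials with the right ratios. -/
lemma exists_polynomials (ψ : Proj (grading k n) ⟶ Proj (grading k n))
    (hgen : ∀ f : MvPolynomial (Fin (n + 1)) k, f ≠ 0 →
      (show Proj (grading k n) from genericPt k n) ∈ ψ ⁻¹ᵁ Proj.basicOpen (grading k n) f)
    {σ : k →+* k} (hψ : ψ ≫ projStr k n = projStr k n ≫ Spec.map (CommRingCat.ofHom σ)) :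
    ∃ (d : ℕ) (g : Fin (n + 1) → MvPolynomial (Fin (n + 1)) k), (∀ i, (g i).IsHomogeneous d) ∧
      ∀ (v : Fin (n + 1) → k) (hv : v ≠ 0), (∃ j, eval v (g j) ≠ 0) ∧
        ∀ (u : Fin (n + 1) → k) (hu : u ≠ 0), (∀ i, σ (u i) = eval v (g i)) →
          ψ (pt v hv) = pt u hu := by
  -- Clearing denominators in the pullbacks of `x i / x 0` and dividing by the greatest common
  -- divisor gives coprime polynomials `g i` whose ratios are the pullbacks of `x i / x j`.
  choose m b c hb hc hc0 hbc using fun i ↦ exists_frac_eq ψ hgen i 0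
  have hw0 (i j) : pullRatio ψ hgen i j ≠ 0 := fun h ↦ by
    have := pullRatio_mul ψ hgen i j i
    rw [h, zero_mul, pullRatio_self] at this
    exact zero_ne_one this
  have hb0 (i) : b i ≠ 0 := fun h ↦ hw0 i 0 (by rw [hbc, h, map_zero, zero_div])
  obtain ⟨e, g, hBg, hprim⟩ := exists_primitive fun i ↦ b i * ∏ l ∈ Finset.univ.erase i, c l
  have hB0 (i) : e * g i ≠ 0 := by
    rw [← hBg]
    exact mul_ne_zero (hb0 i) (Finset.prod_ne_zero_iff.mpr fun l _ ↦ hc0 l)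
  have hBhom (i) : (e * g i).IsHomogeneous (∑ l, m l) := by
    rw [← hBg, ← Finset.add_sum_erase _ _ (Finset.mem_univ i)]
    exact (hb i).mul (IsHomogeneous.prod _ _ _ fun l _ ↦ hc l)
  have hfracB (i) : frac (e * g i) = pullRatio ψ hgen i 0 * frac (∏ l, c l) := by
    rw [← hBg, ← Finset.mul_prod_erase _ _ (Finset.mem_univ i), hbc, map_mul, map_mul,
      ← mul_assoc, div_mul_cancel₀ _ (frac_ne_zero (hc0 i))]
  have hg0 (i) : g i ≠ 0 := right_ne_zero_of_mul (hB0 i)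
  have he0 : e ≠ 0 := left_ne_zero_of_mul (hB0 0)
  have hratio (i j) : frac (g i) = frac (g j) * pullRatio ψ hgen i j := by
    have h1 := hfracB i
    rw [← pullRatio_mul ψ hgen i j 0, mul_assoc, ← hfracB j, map_mul, map_mul] at h1
    apply mul_left_cancel₀ (frac_ne_zero he0)
    rw [h1]
    ring
  obtain ⟨d', he⟩ := exists_isHomogeneous_of_mul (hBhom 0) (hB0 0)
  obtain ⟨d, hd⟩ := exists_isHomogeneous_of_mul (a := g 0) (b := e) (mul_comm e (g 0) ▸ hBhom 0)
    (mul_comm e (g 0) ▸ hB0 0)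
  have hdm := (he.mul hd).inj_right (hBhom 0) (hB0 0)
  have hg (i) : (g i).IsHomogeneous d := by
    obtain ⟨d₁, hd₁⟩ := exists_isHomogeneous_of_mul (a := g i) (b := e)
      (mul_comm e (g i) ▸ hBhom i) (mul_comm e (g i) ▸ hB0 i)
    have := (he.mul hd₁).inj_right (hBhom i) (hB0 i)
    rwa [show d = d₁ by omega]
  refine ⟨d, g, hg, fun v hv ↦ ?_⟩
  obtain ⟨q, hq⟩ : ∃ q : ProjectiveSpectrum (grading k n), ψ (pt v hv) = q := ⟨_, rfl⟩
  obtain ⟨j, hj⟩ := exists_X_notMem q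
  have hprime : (pt v hv).asHomogeneousIdeal.toIdeal.IsPrime := (pt v hv).isPrime
  -- At `v` the ratios `g i / g j` have denominators `c₁ i` not vanishing at `v`. By coprimality,
  -- `g j` divides their product, so that it does not vanish at `v` either.
  have hgj : eval v (g j) ≠ 0 := by
    choose m₁ b₁ c₁ hb₁ hc₁ hcp hbc₁ _ using fun i ↦
      exists_pullFrac_divX_eq ψ hgen hq hj (isHomogeneous_X k i)
    have hc₁0 (i) : c₁ i ≠ 0 := fun h0 ↦ hcp i (h0 ▸ zero_mem _)
    have hdvd : g j ∣ ∏ i, c₁ i := hprim _ _ fun i ↦ by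
      refine Dvd.dvd.trans ⟨b₁ i, ?_⟩ (mul_dvd_mul_left (g i)
        (Finset.dvd_prod_of_mem c₁ (Finset.mem_univ i)))
      apply frac_injective
      rw [map_mul, map_mul, hratio i j, pullRatio, hbc₁ i, mul_assoc,
        div_mul_cancel₀ _ (frac_ne_zero (hc₁0 i))]
    rw [Ne, ← mem_pt hv (hg j)]
    intro hmem
    obtain ⟨i, -, hi⟩ := (hprime.prod_mem_iff).mp (Ideal.mem_of_dvd _ hdvd hmem)
    exact hcp i hi
  refine ⟨⟨j, hgj⟩, fun u hu hug ↦ ?_⟩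
  rw [hq]
  apply ProjectiveSpectrum.ext
  refine homogeneousIdeal_ext fun l a ha ↦ ?_
  obtain ⟨m', b', c', hb', hc', hcp', hbc', hiff⟩ := exists_pullFrac_divX_eq ψ hgen hq hj ha
  have hc'0 : c' ≠ 0 := fun h0 ↦ hcp' (h0 ▸ zero_mem _)
  -- The pullback of `a / x j ^ l` is both `b' / c'` and the value of `a` at the `g i / g j`.
  have key : g j ^ l * b' = c' * eval₂ (C.comp σ) g a := by
    apply frac_injective
    rw [pullFrac_divX ψ hgen hψ j ha, eq_div_iff (frac_ne_zero hc'0)] at hbc'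
    rw [map_mul, map_mul, map_pow, ← hbc', ← mul_assoc, ← eval₂_mul_of_isHomogeneous ha,
      hom_eval₂, mul_comm]
    congr 2
    ext i
    exact (hratio i j).symm
  have key' := congrArg (eval v) key
  rw [map_mul, map_mul, map_pow, eval_eval₂_C hug] at key'
  rw [hiff, mem_pt hu ha, mem_pt hv hb']
  have hcv : MvPolynomial.eval v c' ≠ 0 := (mem_pt hv hc').not.mp hcp'
  constructor
  · intro h0
    rw [h0, mul_zero, eq_comm, mul_eq_zero] at key'
    exact (map_eq_zero σ).mp (key'.resolve_left hcv)
  · intro h0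
    rw [h0, map_zero, mul_zero, mul_eq_zero] at key'
    exact key'.resolve_left (pow_ne_zero _ hgj)

lemma eval_add_of_isHomogeneous_one {a : MvPolynomial (Fin (n + 1)) k} (ha : a.IsHomogeneous 1)
    (v w : Fin (n + 1) → k) : eval (v + w) a = eval v a + eval w a := by
  have ha' : a ∈ Submodule.span k (Set.range X) := by
    rw [← homogeneousSubmodule_one_eq_span_X]
    exact ha
  clear ha
  induction ha' using Submodule.span_induction with
  | mem x hx => obtain ⟨i, rfl⟩ := hx; simp
  | zero => simp
  | add x y hx hy h1 h2 => rw [map_add, map_add, map_add, h1, h2]; ring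
  | smul c x hx h => rw [smul_eval, smul_eval, smul_eval, h, mul_add]

lemma eval_smul_of_isHomogeneous {a : MvPolynomial (Fin (n + 1)) k} {m : ℕ}
    (ha : a.IsHomogeneous m) (c : k) (v : Fin (n + 1) → k) :
    eval (c • v) a = c ^ m * eval v a :=
  eval₂_mul_of_isHomogeneous ha _ c v

/-- Homogeneous polynomials whose values at every vector `v` are proportional to `v`, with a
nonzero factor, are linear. -/
lemma eq_one_of_eval_eq_smul [IsAlgClosed k] [CharZero k] {D : ℕ}
    (H : Fin (n + 1 + 1) → MvPolynomial (Fin (n + 1 + 1)) k) (hH : ∀ i, (H i).IsHomogeneous D)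
    (h : ∀ v : Fin (n + 1 + 1) → k, v ≠ 0 → ∃ c : k, c ≠ 0 ∧ ∀ i, eval v (H i) = c * v i) :
    D = 1 := by
  -- a polynomial without roots is constant
  have key (p : Polynomial k) (hp : ∀ t, p.eval t ≠ 0) : ∃ c, ∀ t, p.eval t = c := by
    have : p.degree = 0 := by
      by_contra h0
      obtain ⟨t, ht⟩ := IsAlgClosed.exists_root p h0
      exact hp t ht
    rw [Polynomial.eq_C_of_degree_eq_zero this]
    exact ⟨_, fun t ↦ Polynomial.eval_C⟩
  have hpoly (w : Fin (n + 1 + 1) → Polynomial k) (a : MvPolynomial (Fin (n + 1 + 1)) k) (t : k) :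
      (eval₂ Polynomial.C w a).eval t = MvPolynomial.eval (fun i ↦ (w i).eval t) a := by
    have := hom_eval₂ a Polynomial.C (Polynomial.evalRingHom t) w
    rw [Polynomial.coe_evalRingHom] at this
    rw [this, MvPolynomial.eval, coe_eval₂Hom]
    congr 1
    ext x
    simp
  -- The polynomials are compared along `[1 : t : 0 : ⋯]` and `[t : 1 : 0 : ⋯]`, where the factors
  -- have no zeros and hence are constants `c₀` and `c₁`. Homogeneity gives `t ^ D * c₁ = c₀ * t`,
  -- and the values `t = 1` and `t = 2` determine `D`.
  let v₀ (t : k) : Fin (n + 1 + 1) → k := fun i ↦ if i = 0 then 1 else if i = 1 then t else 0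
  let v₁ (t : k) : Fin (n + 1 + 1) → k := fun i ↦ if i = 0 then t else if i = 1 then 1 else 0
  have hv₀ (t) : v₀ t ≠ 0 := fun h0 ↦ one_ne_zero (α := k) (by
    simpa [v₀] using congrFun h0 (0 : Fin (n + 1 + 1)))
  have hv₁ (t) : v₁ t ≠ 0 := fun h0 ↦ one_ne_zero (α := k) (by
    simpa [v₁] using congrFun h0 (1 : Fin (n + 1 + 1)))
  let w₀ : Fin (n + 1 + 1) → Polynomial k :=
    fun i ↦ if i = 0 then 1 else if i = 1 then Polynomial.X else 0
  let w₁ : Fin (n + 1 + 1) → Polynomial k :=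
    fun i ↦ if i = 0 then Polynomial.X else if i = 1 then 1 else 0
  have hw₀ (t) : (fun i ↦ (w₀ i).eval t) = v₀ t := by
    ext i
    simp only [v₀, w₀]
    split_ifs <;> simp
  have hw₁ (t) : (fun i ↦ (w₁ i).eval t) = v₁ t := by
    ext i
    simp only [v₁, w₁]
    split_ifs <;> simp
  obtain ⟨c₀, hc₀⟩ := key (eval₂ Polynomial.C w₀ (H 0)) fun t ↦ by
    obtain ⟨c, hc, hcv⟩ := h (v₀ t) (hv₀ t)
    rw [hpoly, hw₀, hcv 0]
    simpa [v₀] using hc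
  obtain ⟨c₁, hc₁⟩ := key (eval₂ Polynomial.C w₁ (H 1)) fun t ↦ by
    obtain ⟨c, hc, hcv⟩ := h (v₁ t) (hv₁ t)
    rw [hpoly, hw₁, hcv 1]
    simpa [v₁] using hc
  have e₀ (t) : MvPolynomial.eval (v₀ t) (H 0) = c₀ := by
    rw [← hc₀ t, hpoly, hw₀]
  have e₁ (t) : MvPolynomial.eval (v₁ t) (H 1) = c₁ := by
    rw [← hc₁ t, hpoly, hw₁]
  have e₂ (t : k) (ht : t ≠ 0) : t ^ D * c₁ = c₀ * t := by
    obtain ⟨c, hc, hcv⟩ := h (v₀ t) (hv₀ t)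
    have h0 := hcv 0
    have h1 := hcv 1
    have hsm : v₀ t = t • v₁ t⁻¹ := by
      ext i
      simp only [v₀, v₁, Pi.smul_apply, smul_eq_mul]
      split_ifs <;> simp [ht]
    rw [e₀] at h0
    rw [hsm, eval_smul_of_isHomogeneous (hH 1), e₁, ← hsm] at h1
    rw [h1, h0]
    simp [v₀]
  obtain ⟨c, hc, hcv⟩ := h (v₀ 1) (hv₀ 1)
  have h0 := hcv 0
  rw [e₀] at h0
  have hc0 : c₀ ≠ 0 := by rw [h0]; simpa [v₀] using hc
  have h1 := e₂ 1 one_ne_zero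
  have h2 := e₂ 2 two_ne_zero
  rw [one_pow, one_mul, mul_one] at h1
  rw [h1, mul_comm c₀ 2] at h2
  have h3 : ((2 ^ D : ℕ) : k) = (2 ^ 1 : ℕ) := by
    push_cast
    simpa using mul_right_cancel₀ hc0 h2
  exact Nat.pow_right_injective le_rfl (Nat.cast_injective h3)

/-- A surjective endomorphism of projective space is dominant. -/
lemma generic_mem_of_surjective {ψ : Proj (grading k n) ⟶ Proj (grading k n)}
    (hψ : Function.Surjective ψ) (f : MvPolynomial (Fin (n + 1)) k) (hf : f ≠ 0) :
    (show Proj (grading k n) from genericPt k n) ∈ ψ ⁻¹ᵁ Proj.basicOpen (grading k n) f := by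
  obtain ⟨p, hp⟩ := hψ (genericPt k n)
  refine genericPt_mem (p := p) ?_
  change ψ p ∈ Proj.basicOpen (grading k n) f
  rw [hp]
  change f ∉ (⊥ : HomogeneousIdeal (grading k n)).toIdeal
  simpa using hf

/-- Every semilinear automorphism of `ℙⁿ` is induced by a semilinear automorphism of `kⁿ⁺¹`. It and
its inverse are given by polynomials of degrees `d` and `d'`, and `d * d' = 1` because their
composition is the identity up to a factor. As morphisms of schemes go in the opposite direction to
functions, a morphism over `Spec σ` acts on coordinates `σ⁻¹`-semilinearly. -/
theorem exists_semilinear [IsAlgClosed k] [CharZero k]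
    {ψ ψ' : Proj (grading k (n + 1)) ⟶ Proj (grading k (n + 1))}
    (h₁ : ψ ≫ ψ' = 𝟙 _) (h₂ : ψ' ≫ ψ = 𝟙 _) (σ : k ≃+* k)
    (hψ : ψ ≫ projStr k (n + 1) = projStr k (n + 1) ≫ Spec.map (CommRingCat.ofHom σ.toRingHom)) :
    ∃ R : (Fin (n + 1 + 1) → k) →+ (Fin (n + 1 + 1) → k),
      (∀ (c : k) (v), R (c • v) = σ.symm c • R v) ∧
      ∀ v hv, ∃ hR : R v ≠ 0, ψ (pt v hv) = pt (R v) hR := by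
  have hψ' : ψ' ≫ projStr k (n + 1) =
      projStr k (n + 1) ≫ Spec.map (CommRingCat.ofHom σ.symm.toRingHom) := by
    have h3 : Spec.map (CommRingCat.ofHom σ.toRingHom) ≫
        Spec.map (CommRingCat.ofHom σ.symm.toRingHom) = 𝟙 _ := by
      rw [← Spec.map_comp, ← CommRingCat.ofHom_comp, ← Spec.map_id]
      congr 2
      ext x
      simp
    have h4 : ψ' ≫ (ψ ≫ projStr k (n + 1)) = projStr k (n + 1) := by
      rw [← Category.assoc, h₂, Category.id_comp]
    rw [hψ] at h4
    conv_rhs => rw [← h4]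
    simp only [Category.assoc, h3, Category.comp_id]
  have hsurj (ψ ψ' : Proj (grading k (n + 1)) ⟶ Proj (grading k (n + 1)))
      (h : ψ ≫ ψ' = 𝟙 _) : Function.Surjective ψ' := fun x ↦
    ⟨ψ x, by rw [← Scheme.Hom.comp_apply, h]; rfl⟩
  obtain ⟨d, g, hg, hgv⟩ := exists_polynomials ψ (generic_mem_of_surjective (hsurj _ _ h₂)) hψ
  obtain ⟨d', g', hg', hgv'⟩ :=
    exists_polynomials ψ' (generic_mem_of_surjective (hsurj _ _ h₁)) hψ'
  have hne (v) (hv : v ≠ 0) : (fun i ↦ σ.symm (MvPolynomial.eval v (g i))) ≠ 0 := fun h0 ↦ by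
    obtain ⟨j, hj⟩ := (hgv v hv).1
    exact hj (by simpa using congrFun h0 j)
  have hne' (v) (hv : v ≠ 0) : (fun i ↦ σ (MvPolynomial.eval v (g' i))) ≠ 0 := fun h0 ↦ by
    obtain ⟨j, hj⟩ := (hgv' v hv).1
    exact hj (by simpa using congrFun h0 j)
  have hψv (v) (hv : v ≠ 0) : ψ (pt v hv) = pt _ (hne v hv) :=
    (hgv v hv).2 _ _ fun i ↦ by simp
  have hψv' (v) (hv : v ≠ 0) : ψ' (pt v hv) = pt _ (hne' v hv) :=
    (hgv' v hv).2 _ _ fun i ↦ by simp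
  -- The composition has degree `d * d'` and is the identity on points.
  have hD : d * d' = 1 := by
    refine eq_one_of_eval_eq_smul (fun i ↦ eval₂ (C.comp σ.toRingHom) g (g' i))
      (fun i ↦ (hg' i).eval₂ _ _ (fun r ↦ isHomogeneous_C _ _) hg) ?_
    · intro v hv
      have h5 : ψ' (ψ (pt v hv)) = pt v hv := (Scheme.Hom.comp_apply ψ ψ' _).symm.trans
        (congrArg (fun φ : Proj (grading k (n + 1)) ⟶ Proj (grading k (n + 1)) ↦
          φ (show Proj (grading k (n + 1)) from pt v hv)) h₁)
      have h6 : pt v hv = pt _ (hne' _ (hne v hv)) :=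
        h5.symm.trans ((congrArg ψ' (hψv v hv)).trans (hψv' _ _))
      obtain ⟨c, hc⟩ := (pt_eq_pt_iff _ _).mp h6
      refine ⟨c, ?_, fun i ↦ ?_⟩
      · rintro rfl
        exact hne' _ (hne v hv) (by rw [hc, zero_smul])
      · rw [← smul_eq_mul, ← Pi.smul_apply, ← hc]
        exact eval_eval₂_C (fun i ↦ by simp) _
  obtain rfl : d = 1 := Nat.eq_one_of_mul_eq_one_right hD
  refine ⟨⟨⟨fun v i ↦ σ.symm (MvPolynomial.eval v (g i)), ?_⟩, ?_⟩, ?_, ?_⟩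
  · ext i
    simpa using eval_smul_of_isHomogeneous (hg i) 0 0
  · intro v w
    ext i
    simp [eval_add_of_isHomogeneous_one (hg i)]
  · intro c v
    ext i
    simp [eval_smul_of_isHomogeneous (hg i)]
  · exact fun v hv ↦ ⟨hne v hv, hψv v hv⟩

end Automorphisms

/-! ### Charts and closed points of projective space -/

section ProjectiveSpace

open MvPolynomial HomogeneousLocalization

variable {k : Type u} [Field k] {n : ℕ}

/-- The morphism `Spec k[x₀, …, xₙ]_{(x j)} ⟶ ℙⁿ`. -/
noncomputable abbrev chart (k : Type u) [Field k] {n : ℕ} (j : Fin (n + 1)) :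
    Spec (.of (Away (grading k n) (X j : MvPolynomial (Fin (n + 1)) k))) ⟶ Proj (grading k n) :=
  Proj.awayι (grading k n) (X j) (X_mem_grading j) one_pos

/-- A form vanishes at a point of the chart exactly when its dehomogenization lies in the
corresponding prime ideal. -/
lemma chart_mem_iff (j : Fin (n + 1))
    (y : PrimeSpectrum (Away (grading k n) (X j : MvPolynomial (Fin (n + 1)) k)))
    {p : ProjectiveSpectrum (grading k n)} (hp : chart k j y = p) {m : ℕ} (hm : 0 < m)
    {a : MvPolynomial (Fin (n + 1)) k} (ha : a.IsHomogeneous m) :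
    a ∈ p.asHomogeneousIdeal ↔ divX j ha ∈ y.asIdeal := by
  have h1 := Proj.awayι_preimage_basicOpen (grading k n) (X_mem_grading j) one_pos (g := a)
    ha hm
  have h2 : y ∈ chart k j ⁻¹ᵁ Proj.basicOpen (grading k n) a ↔
    y ∈ PrimeSpectrum.basicOpen (Away.isLocalizationElem (X_mem_grading j) ha) := by rw [← h1]; rfl
  have h3 : Away.isLocalizationElem (X_mem_grading j) ha = divX j ha := by
    apply val_injective
    simp [divX]
  rw [h3] at h2
  have h4 : y ∈ chart k j ⁻¹ᵁ Proj.basicOpen (grading k n) a ↔ a ∉ p.asHomogeneousIdeal := by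
    rw [← hp]
    rfl
  rw [← not_iff_not, ← h4, h2]
  rfl

lemma exists_chart_eq (p : ProjectiveSpectrum (grading k n)) : ∃ j y, chart k j y = p := by
  obtain ⟨j, hj⟩ := exists_X_notMem p
  have h1 := Proj.opensRange_awayι (grading k n) (X j) (X_mem_grading j) one_pos
  have h2 : (show Proj (grading k n) from p) ∈ Proj.basicOpen (grading k n) (X j) := hj
  rw [← h1] at h2
  exact ⟨j, h2⟩

/-- The ring `k[x₀, …, xₙ]_{(x j)}` is generated by the fractions `x i / x j`. -/
lemma eval₂_divX_surjective (j : Fin (n + 1)) : Function.Surjective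
    (eval₂Hom (constAway (k := k) (X j)) fun i ↦ divX j (isHomogeneous_X k i)) := by
  intro x
  obtain ⟨m, a, ha, rfl⟩ := Away.mk_surjective (grading k n) (X_mem_grading j) x
  have ha' : a.IsHomogeneous m := by simpa using ha
  exact ⟨a, (divX_eq_eval₂ j ha').symm⟩

/-- Over an algebraically closed field, every closed point of `ℙⁿ` is of the form `[v]`. -/
lemma exists_eq_pt [IsAlgClosed k] (p : ProjectiveSpectrum (grading k n))
    (hp : IsClosed {(show Proj (grading k n) from p)}) : ∃ v hv, p = pt v hv := by
  obtain ⟨j, y, hy⟩ := exists_chart_eq p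
  have hyc : IsClosed {y} := by
    have h1 := hp.preimage (chart k j).continuous
    convert h1
    ext z
    exact ⟨fun h ↦ by rw [h]; exact hy, fun h ↦
      (chart k j).isOpenEmbedding.injective (Eq.trans h hy.symm)⟩
  have hymax : y.asIdeal.IsMaximal := (PrimeSpectrum.isClosed_singleton_iff_isMaximal y).mp hyc
  have hmax := Ideal.comap_isMaximal_of_surjective _ (eval₂_divX_surjective (k := k) j)
    (K := y.asIdeal)
  obtain ⟨v, hv⟩ := isMaximal_iff_eq_vanishingIdeal_singleton.mp hmax
  have hXj : divX j (isHomogeneous_X k j) = 1 := by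
    apply val_injective
    simp only [divX, Away.mk, val_mk, val_one]
    simp only [pow_one]
    exact Localization.mk_self ⟨X j, _⟩
  have hmem (a : MvPolynomial (Fin (n + 1)) k) : eval₂ (constAway (X j))
      (fun i ↦ divX j (isHomogeneous_X k i)) a ∈ y.asIdeal ↔ eval v a = 0 := by
    have := congrArg (a ∈ ·) hv
    simpa using this
  have hvj : v j = 1 := by
    have := (hmem (X j - C 1)).mp (by simp [hXj])
    simpa [sub_eq_zero] using this
  have hv0 : v ≠ 0 := fun h ↦ one_ne_zero (α := k) (by rw [← hvj, h]; rfl)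
  refine ⟨v, hv0, eq_pt_of_mem p v hv0 j (by simp [hvj]) fun i ↦ ?_⟩
  rw [chart_mem_iff j y hy one_pos (isHomogeneous_minor _ _ _ _), divX_eq_eval₂, hmem]
  simp [hvj]

lemma isClosed_pt (v : Fin (n + 1) → k) (hv : v ≠ 0) :
    IsClosed {(show Proj (grading k n) from pt v hv)} := by
  obtain ⟨j, hj⟩ := Function.ne_iff.mp hv
  have : ∀ p : ProjectiveSpectrum (grading k n), p ∈ closure {pt v hv} → p = pt v hv := by
    intro p hp
    rw [← ProjectiveSpectrum.le_iff_mem_closure] at hp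
    refine eq_pt_of_mem p v hv j hj fun i ↦ ?_
    refine hp (?_ : C (v j) * X i - C (v i) * X j ∈ (pt v hv).asHomogeneousIdeal)
    rw [mem_pt hv (isHomogeneous_minor _ _ _ _)]
    simp [mul_comm]
  exact closure_subset_iff_isClosed.mp fun p hp ↦ this p hp

instance : IsReduced (Proj (grading k n)) := by
  have (i : (Proj.affineOpenCover (grading k n)).openCover.I₀) :
      IsReduced ((Proj.affineOpenCover (grading k n)).openCover.X i) := by
    change IsReduced (Spec (.of (Away (grading k n) _)))
    have : _root_.IsReduced (Away (grading k n) (i.2 : MvPolynomial (Fin (n + 1)) k)) := by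
      have : _root_.IsReduced (Localization (.powers (i.2 : MvPolynomial (Fin (n + 1)) k))) :=
        isReduced_localizationPreserves (.powers (i.2 : MvPolynomial (Fin (n + 1)) k)) _
          (inferInstanceAs (_root_.IsReduced (MvPolynomial (Fin (n + 1)) k)))
      exact isReduced_of_injective (algebraMap _ (Localization (.powers i.2.1)))
        (val_injective _)
    infer_instance
  exact IsReduced.of_openCover _ (Proj.affineOpenCover (grading k n)).openCover

lemma algebraMap_zero_surjective :
    Function.Surjective (algebraMap k (homogeneousSubmodule (Fin (n + 1)) k 0)) := by
  rintro ⟨a, ha⟩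
  obtain ⟨c, rfl⟩ := Submodule.mem_one.mp
    (homogeneousSubmodule_zero (σ := Fin (n + 1)) (R := k) ▸ ha)
  exact ⟨c, rfl⟩

instance : IsSeparated (projStr k n) := by
  dsimp [projStr, projectiveSpace]
  infer_instance

instance : LocallyOfFiniteType (projStr k n) := by
  have : Algebra.FiniteType (homogeneousSubmodule (Fin (n + 1)) k 0)
      (MvPolynomial (Fin (n + 1)) k) := by
    have : IsScalarTower k (homogeneousSubmodule (Fin (n + 1)) k 0)
      (MvPolynomial (Fin (n + 1)) k) := .of_algebraMap_eq
        (R := k) (S := homogeneousSubmodule (Fin (n + 1)) k 0) fun _ ↦ rfl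
    exact Algebra.FiniteType.of_restrictScalars_finiteType k _ _
  have : LocallyOfFiniteType (Spec.map (CommRingCat.ofHom
      (algebraMap k (homogeneousSubmodule (Fin (n + 1)) k 0)))) := by
    rw [HasRingHomProperty.Spec_iff (P := @LocallyOfFiniteType)]
    exact RingHom.FiniteType.of_surjective _ algebraMap_zero_surjective
  dsimp [projStr, projectiveSpace]
  infer_instance

end ProjectiveSpace

/-! ### The Galois action on a scalar extension and its geometric points -/

section GaloisAction

variable {K k : Type u} [Field K] [Field k] [Algebra K k]

/-- Embeddings of an extension of `K` into an algebraic closure are conjugate. -/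
lemma exists_algEquiv_comp_eq {E : Type*} [Field E] [Algebra K E] [Algebra.IsAlgebraic K k]
    [IsAlgClosed k] (ι₁ ι₂ : E →ₐ[K] k) : ∃ σ : k ≃ₐ[K] k, ∀ x, σ (ι₁ x) = ι₂ x := by
  have : IsAlgClosure K k := ⟨inferInstance, inferInstance⟩
  have : Normal K k := IsAlgClosure.normal K k
  let e : E ≃ₐ[K] ι₁.fieldRange := AlgEquiv.ofInjectiveField ι₁
  let φ : ι₁.fieldRange →ₐ[K] k := ι₂.comp e.symm.toAlgHom
  refine ⟨AlgEquiv.ofBijective (φ.liftNormal k) (Algebra.IsAlgebraic.algHom_bijective _),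
    fun x ↦ ?_⟩
  have h := φ.liftNormal_commutes k (e x)
  have he : e.symm (e x) = x := e.symm_apply_apply x
  have h' : (φ.liftNormal k) (ι₁ x) = ι₂ (e.symm (e x)) := h
  rwa [he] at h'

variable {S P : Scheme.{u}} {q : P ⟶ S} {f : S ⟶ Spec (.of K)} {π : P ⟶ Spec (.of k)}

/-- The automorphism of the scalar extension `P` of `S` given by an automorphism `σ` of `k`; it lies
over `Spec σ`. On points, `σ ↦ galAut h σ` is an action from the right, so that the usual action of
`σ` on geometric points is `galAut h σ⁻¹`, see `galAut_inv_embeddingPoint`. -/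
noncomputable def galAut (h : IsPullback q π f (Spec.map (CommRingCat.ofHom (algebraMap K k))))
    (σ : k ≃ₐ[K] k) : P ⟶ P :=
  h.lift q (π ≫ Spec.map (CommRingCat.ofHom (σ : k ≃+* k).toRingHom)) (by
    rw [Category.assoc, ← Spec.map_comp, ← CommRingCat.ofHom_comp, h.w]
    congr 3
    ext x
    simp)

variable (h : IsPullback q π f (Spec.map (CommRingCat.ofHom (algebraMap K k))))

@[simp]
lemma galAut_fst (σ : k ≃ₐ[K] k) : galAut h σ ≫ q = q := h.lift_fst _ _ _

@[simp]
lemma galAut_fst_assoc (σ : k ≃ₐ[K] k) {T : Scheme.{u}} (g : S ⟶ T) :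
    galAut h σ ≫ q ≫ g = q ≫ g := by rw [← Category.assoc, galAut_fst]

lemma galAut_snd (σ : k ≃ₐ[K] k) :
    galAut h σ ≫ π = π ≫ Spec.map (CommRingCat.ofHom (σ : k ≃+* k).toRingHom) := h.lift_snd _ _ _

lemma galAut_one : galAut h 1 = 𝟙 P := by
  apply h.hom_ext
  · simp
  · rw [galAut_snd, Category.id_comp]
    exact (congrArg (π ≫ ·) (Spec.map_id _)).trans (Category.comp_id _)

lemma galAut_mul (σ τ : k ≃ₐ[K] k) : galAut h (σ * τ) = galAut h σ ≫ galAut h τ := by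
  apply h.hom_ext
  · simp
  · rw [galAut_snd, Category.assoc, galAut_snd, ← Category.assoc, galAut_snd, Category.assoc,
      ← Spec.map_comp, ← CommRingCat.ofHom_comp]
    rfl

/-- The automorphism of `P` over `k` given by an endomorphism `g` of `S` over `K`. -/
noncomputable def baseAut (g : S ⟶ S) (hg : g ≫ f = f) : P ⟶ P :=
  h.lift (q ≫ g) π (by rw [Category.assoc, hg, h.w])

lemma baseAut_fst (g : S ⟶ S) (hg : g ≫ f = f) : baseAut h g hg ≫ q = q ≫ g :=
  h.lift_fst _ _ _

lemma baseAut_snd (g : S ⟶ S) (hg : g ≫ f = f) : baseAut h g hg ≫ π = π :=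
  h.lift_snd _ _ _

lemma baseAut_comp_galAut (g : S ⟶ S) (hg : g ≫ f = f) (σ : k ≃ₐ[K] k) :
    baseAut h g hg ≫ galAut h σ = galAut h σ ≫ baseAut h g hg := by
  apply h.hom_ext
  · rw [Category.assoc, galAut_fst, baseAut_fst, Category.assoc, baseAut_fst, galAut_fst_assoc]
  · rw [Category.assoc, galAut_snd, ← Category.assoc, baseAut_snd, Category.assoc, baseAut_snd,
      galAut_snd]

lemma baseAut_id : baseAut h (𝟙 S) (Category.id_comp _) = 𝟙 P := by
  apply h.hom_ext
  · rw [baseAut_fst]; simp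
  · rw [baseAut_snd]; simp

lemma baseAut_comp (g g' : S ⟶ S) (hg : g ≫ f = f) (hg' : g' ≫ f = f) :
    baseAut h (g ≫ g') (by rw [Category.assoc, hg', hg]) = baseAut h g hg ≫ baseAut h g' hg' := by
  apply h.hom_ext
  · rw [baseAut_fst, Category.assoc, baseAut_fst, ← Category.assoc (baseAut h g hg), baseAut_fst,
      Category.assoc]
  · rw [baseAut_snd, Category.assoc, baseAut_snd, baseAut_snd]

/-- The point of the spectrum of a field. -/
noncomputable def specPt (k : Type u) [Field k] : Spec (.of k) := IsLocalRing.closedPoint k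

lemma eq_specPt (x : Spec (.of k)) : x = specPt k :=
  Subsingleton.elim (α := PrimeSpectrum k) _ _

lemma exists_specMap_fromSpecResidueField {S : Scheme.{u}} (g : Spec (.of k) ⟶ S) :
    ∃ ι : S.residueField (g (specPt k)) ⟶ .of k,
      Spec.map ι ≫ S.fromSpecResidueField (g (specPt k)) = g :=
  ⟨_, Scheme.descResidueField_stalkClosedPointTo_fromSpecResidueField k S g⟩

/-- The homomorphism from the base field to the residue field at a point of a `K`-scheme. -/
noncomputable def baseToResidueField (f : S ⟶ Spec (.of K)) (s : S) : K →+* S.residueField s :=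
  (Spec.preimage (S.fromSpecResidueField s ≫ f)).hom

lemma specMap_baseToResidueField (f : S ⟶ Spec (.of K)) (s : S) :
    Spec.map (CommRingCat.ofHom (baseToResidueField f s)) = S.fromSpecResidueField s ≫ f := by
  rw [baseToResidueField, CommRingCat.ofHom_hom, Spec.map_preimage]

/-- The section of `P ⟶ Spec k` given by an embedding of the residue field at a point of `S`
into `k`. -/
noncomputable def sectionOfEmbedding {s : S} (ι : S.residueField s →+* k)
    (hι : ι.comp (baseToResidueField f s) = algebraMap K k) : Spec (.of k) ⟶ P :=
  h.lift (Spec.map (CommRingCat.ofHom ι) ≫ S.fromSpecResidueField s) (𝟙 _) (by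
    rw [Category.assoc, ← specMap_baseToResidueField, ← Spec.map_comp, ← CommRingCat.ofHom_comp,
      hι, Category.id_comp])

lemma sectionOfEmbedding_fst {s : S} (ι : S.residueField s →+* k)
    (hι : ι.comp (baseToResidueField f s) = algebraMap K k) :
    sectionOfEmbedding h ι hι ≫ q =
      Spec.map (CommRingCat.ofHom ι) ≫ S.fromSpecResidueField s := h.lift_fst _ _ _

lemma sectionOfEmbedding_snd {s : S} (ι : S.residueField s →+* k)
    (hι : ι.comp (baseToResidueField f s) = algebraMap K k) :
    sectionOfEmbedding h ι hι ≫ π = 𝟙 _ := h.lift_snd _ _ _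

/-- The point of `P` given by an embedding of the residue field at a point of `S` into `k`. -/
noncomputable def embeddingPoint {s : S} (ι : S.residueField s →+* k)
    (hι : ι.comp (baseToResidueField f s) = algebraMap K k) : P :=
  sectionOfEmbedding h ι hι (specPt k)

lemma apply_embeddingPoint {s : S} (ι : S.residueField s →+* k)
    (hι : ι.comp (baseToResidueField f s) = algebraMap K k) : q (embeddingPoint h ι hι) = s := by
  rw [embeddingPoint, ← Scheme.Hom.comp_apply, sectionOfEmbedding_fst, Scheme.Hom.comp_apply,
    Scheme.fromSpecResidueField_apply]

lemma comp_baseToResidueField {s : S} {ι : S.residueField s →+* k}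
    (hι : ι.comp (baseToResidueField f s) = algebraMap K k) (σ : k ≃ₐ[K] k) :
    ((σ : k ≃+* k).toRingHom.comp ι).comp (baseToResidueField f s) = algebraMap K k := by
  rw [RingHom.comp_assoc, hι]
  ext x
  simp

/-- The Galois group acts on the points of `P` given by embeddings by composition. -/
lemma galAut_inv_embeddingPoint {s : S} (ι : S.residueField s →+* k)
    (hι : ι.comp (baseToResidueField f s) = algebraMap K k) (σ : k ≃ₐ[K] k) :
    galAut h σ⁻¹ (embeddingPoint h ι hι) = embeddingPoint h ((σ : k ≃+* k).toRingHom.comp ι)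
      (comp_baseToResidueField hι σ) := by
  have h1 : sectionOfEmbedding h ((σ : k ≃+* k).toRingHom.comp ι) (comp_baseToResidueField hι σ) =
      Spec.map (CommRingCat.ofHom (σ : k ≃+* k).toRingHom) ≫ sectionOfEmbedding h ι hι ≫
        galAut h σ⁻¹ := by
    apply h.hom_ext
    · rw [sectionOfEmbedding_fst, Category.assoc, Category.assoc, galAut_fst,
        sectionOfEmbedding_fst, CommRingCat.ofHom_comp, Spec.map_comp, Category.assoc]
    · rw [sectionOfEmbedding_snd, Category.assoc, Category.assoc, galAut_snd, ← Category.assoc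
        (sectionOfEmbedding h ι hι), sectionOfEmbedding_snd, Category.id_comp, ← Spec.map_comp,
        ← CommRingCat.ofHom_comp, ← Spec.map_id]
      congr 2
      ext x
      change x = σ (σ⁻¹ x)
      simp
  rw [embeddingPoint, embeddingPoint, h1, Scheme.Hom.comp_apply, Scheme.Hom.comp_apply]
  rw [eq_specPt (Spec.map _ _)]

variable [IsAlgClosed k] [LocallyOfFiniteType π]

lemma isClosed_embeddingPoint {s : S} (ι : S.residueField s →+* k)
    (hι : ι.comp (baseToResidueField f s) = algebraMap K k) : IsClosed {embeddingPoint h ι hι} :=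
  (pointEquivClosedPoint π ⟨_, sectionOfEmbedding_snd h ι hι⟩).2

lemma embeddingPoint_injective {s : S} {ι ι' : S.residueField s →+* k}
    (hι : ι.comp (baseToResidueField f s) = algebraMap K k)
    (hι' : ι'.comp (baseToResidueField f s) = algebraMap K k)
    (H : embeddingPoint h ι hι = embeddingPoint h ι' hι') : ι = ι' := by
  have h1 := ext_of_apply_closedPoint_eq π (sectionOfEmbedding_snd h ι hι)
    (sectionOfEmbedding_snd h ι' hι') H
  have h2 := congrArg (· ≫ q) h1
  simp only [sectionOfEmbedding_fst, cancel_mono] at h2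
  have h3 := Spec.map_injective h2
  exact congrArg CommRingCat.Hom.hom h3

/-- Every closed point of `P` over `s` comes from an embedding of the residue field at `s`. -/
lemma exists_embeddingPoint_eq {x : P} (hx : IsClosed {x}) {s : S} (hs : q x = s) :
    ∃ (ι : S.residueField s →+* k) (hι : ι.comp (baseToResidueField f s) = algebraMap K k),
      embeddingPoint h ι hι = x := by
  set g := pointOfClosedPoint π x hx ≫ q with hg
  obtain ⟨ι, h1⟩ := exists_specMap_fromSpecResidueField g
  have h2 : g (specPt k) = s := by
    rw [hg, Scheme.Hom.comp_apply, pointOfClosedPoint_apply, hs]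
  generalize g (specPt k) = s' at ι h1 h2
  subst h2
  have hι : ι.hom.comp (baseToResidueField f s') = algebraMap K k := by
    have : Spec.map (CommRingCat.ofHom (ι.hom.comp (baseToResidueField f s'))) =
        Spec.map (CommRingCat.ofHom (algebraMap K k)) := by
      rw [CommRingCat.ofHom_comp, Spec.map_comp, specMap_baseToResidueField, CommRingCat.ofHom_hom,
        ← Category.assoc, h1, hg, Category.assoc, h.w, pointOfClosedPoint_comp_assoc]
    exact congrArg CommRingCat.Hom.hom (Spec.map_injective this)
  refine ⟨ι.hom, hι, ?_⟩
  have h3 : sectionOfEmbedding h ι.hom hι = pointOfClosedPoint π x hx := by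
    apply h.hom_ext
    · rw [sectionOfEmbedding_fst, CommRingCat.ofHom_hom, h1]
    · rw [sectionOfEmbedding_snd, pointOfClosedPoint_comp]
  rw [embeddingPoint, h3, pointOfClosedPoint_apply]

end GaloisAction

/-! ### Geometric points over a closed point -/

section Orbits

variable {K k : Type u} [Field K] [Field k] [Algebra K k]
variable {S P : Scheme.{u}} {q : P ⟶ S} {f : S ⟶ Spec (.of K)} {π : P ⟶ Spec (.of k)}

/-- Geometric points lie over closed points, as `P ⟶ S` is integral. -/
lemma isClosed_apply (h : IsPullback q π f (Spec.map (CommRingCat.ofHom (algebraMap K k))))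
    [Algebra.IsAlgebraic K k] {x : P} (hx : IsClosed {x}) : IsClosed {q x} := by
  have h1 : IsIntegralHom (Spec.map (CommRingCat.ofHom (algebraMap K k))) := by
    rw [IsIntegralHom.SpecMap_iff]
    exact algebraMap_isIntegral_iff.mpr inferInstance
  have h2 : IsIntegralHom q := MorphismProperty.of_isPullback h.flip h1
  have h3 := q.isClosedMap _ hx
  rwa [Set.image_singleton] at h3

/-- The residue field at a closed point is a finite extension of `K`. -/
lemma finite_baseToResidueField [LocallyOfFiniteType f] {s : S} (hs : IsClosed {s}) :
    (baseToResidueField f s).Finite := by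
  have : IsFinite (S.fromSpecResidueField s ≫ f) := by
    rw [isClosed_singleton_iff_isClosedImmersion] at hs
    rw [isFinite_iff_locallyOfFiniteType_of_jacobsonSpace]
    infer_instance
  rw [← specMap_baseToResidueField, IsFinite.SpecMap_iff] at this
  exact this

variable (h : IsPullback q π f (Spec.map (CommRingCat.ofHom (algebraMap K k))))
  [IsAlgClosed k] [LocallyOfFiniteType π]

/-- Two closed points of `P` with the same image in `S` are conjugate. -/
lemma exists_galAut_inv_eq [Algebra.IsAlgebraic K k] {x y : P} (hx : IsClosed {x})
    (hy : IsClosed {y}) (hxy : q x = q y) : ∃ σ : k ≃ₐ[K] k, galAut h σ⁻¹ x = y := by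
  obtain ⟨ι, hι, hιx⟩ := exists_embeddingPoint_eq h hx hxy
  obtain ⟨ι', hι', hιy⟩ := exists_embeddingPoint_eq h hy rfl
  let := (baseToResidueField f (q y)).toAlgebra
  obtain ⟨σ, hσ⟩ := exists_algEquiv_comp_eq (K := K)
    ({ toRingHom := ι, commutes' := fun a ↦ DFunLike.congr_fun hι a } :
      S.residueField (q y) →ₐ[K] k)
    { toRingHom := ι', commutes' := fun a ↦ DFunLike.congr_fun hι' a }
  refine ⟨σ, ?_⟩
  subst hιx
  rw [galAut_inv_embeddingPoint]
  conv_rhs => rw [← hιy]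
  congr 1
  ext a
  exact hσ a

/-- The number of geometric points over a closed point is its degree. -/
lemma natCard_fiber (h : IsPullback q π f (Spec.map (CommRingCat.ofHom (algebraMap K k))))
    [CharZero K] [LocallyOfFiniteType f] {s : S} (hs : IsClosed {s}) :
    letI := (baseToResidueField f s).toAlgebra
    Nat.card {x : P // IsClosed {x} ∧ q x = s} = Module.finrank K (S.residueField s) := by
  let := (baseToResidueField f s).toAlgebra
  have : FiniteDimensional K (S.residueField s) := finite_baseToResidueField hs
  have hcomp (φ : S.residueField s →ₐ[K] k) :
      φ.toRingHom.comp (baseToResidueField f s) = algebraMap K k :=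
    RingHom.ext fun a ↦ φ.commutes a
  let F (φ : S.residueField s →ₐ[K] k) : {x : P // IsClosed {x} ∧ q x = s} :=
    ⟨embeddingPoint h φ.toRingHom (hcomp φ), isClosed_embeddingPoint h _ _,
      apply_embeddingPoint h _ _⟩
  have hF : Function.Bijective F := by
    constructor
    · intro φ φ' H
      have := embeddingPoint_injective h (hcomp φ) (hcomp φ') (congrArg Subtype.val H)
      ext a
      exact DFunLike.congr_fun this a
    · rintro ⟨x, hx, hxs⟩
      obtain ⟨ι, hι, hιx⟩ := exists_embeddingPoint_eq h hx hxs
      exact ⟨{ toRingHom := ι, commutes' := fun a ↦ DFunLike.congr_fun hι a }, Subtype.ext hιx⟩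
  rw [← Nat.card_congr (Equiv.ofBijective F hF), Nat.card_eq_fintype_card]
  exact AlgHom.card K _ k

/-- The stabilizer of a closed point is open in the Galois group. -/
lemma exists_fixing_galAut [Algebra.IsAlgebraic K k] [LocallyOfFiniteType f] {x : P}
    (hx : IsClosed {x}) : ∃ L : IntermediateField K k, FiniteDimensional K L ∧
      ∀ σ : k ≃ₐ[K] k, (∀ a ∈ L, σ a = a) → galAut h σ⁻¹ x = x := by
  obtain ⟨ι, hι, hιx⟩ := exists_embeddingPoint_eq h hx rfl
  let := (baseToResidueField f (q x)).toAlgebra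
  have : FiniteDimensional K (S.residueField (q x)) :=
    finite_baseToResidueField (isClosed_apply h hx)
  let φ : S.residueField (q x) →ₐ[K] k :=
    { toRingHom := ι, commutes' := fun a ↦ DFunLike.congr_fun hι a }
  refine ⟨φ.fieldRange, Module.Finite.range φ.toLinearMap, fun σ hσ ↦ ?_⟩
  conv_lhs => rw [← hιx]
  rw [galAut_inv_embeddingPoint]
  conv_rhs => rw [← hιx]
  congr 1
  ext a
  exact hσ _ ⟨a, rfl⟩

end Orbits

/-! ### Descent of isomorphisms along an algebraic closure -/

section Descent

variable {K k : Type u} [Field K] [Field k] [Algebra K k]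

open TensorProduct in
/-- An algebraic extension in characteristic zero is separable, so that its tensor products with
fields are reduced. -/
lemma isReduced_tensorProduct (L : Type*) [Field L] [Algebra K L] [CharZero K]
    [Algebra.IsAlgebraic K k] : _root_.IsReduced (L ⊗[K] k) := by
  refine IsReduced.tensorProduct_of_flat_of_forall_fg fun B hB ↦ ?_
  have : Algebra.FiniteType K B := B.fg_iff_finiteType.mp hB
  have : Algebra.IsAlgebraic K B := .of_injective B.val Subtype.val_injective
  have : Algebra.IsIntegral K B := Algebra.IsAlgebraic.isIntegral
  have : Module.Finite K B := Algebra.IsIntegral.finite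
  let : Field B := (isField_of_isIntegral_of_isField' (Field.toIsField K)).toField
  have : Algebra.FormallyUnramified K B :=
    (Algebra.FormallyUnramified.iff_isSeparable K B).mpr inferInstance
  exact Algebra.FormallyUnramified.isReduced_of_field L (L ⊗[K] B)

lemma geometricallyReduced_specMap [CharZero K] [Algebra.IsAlgebraic K k] :
    GeometricallyReduced (Spec.map (CommRingCat.ofHom (algebraMap K k))) := by
  rw [GeometricallyReduced.eq_geometrically, geometrically_iff_of_commRing]
  intro L _ _ Y fst snd hY
  have h1 := isReduced_tensorProduct (K := K) (k := k) L
  have h2 : IsReduced (Spec (.of (TensorProduct K L k))) := inferInstance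
  have e := hY.flip.isoPullback ≪≫ pullbackSpecIso K L k
  exact isReduced_of_isOpenImmersion e.hom

/-- Two `K`-embeddings of an algebraic closure `k` of `K` into a field differ by an element of the
Galois group. -/
lemma exists_comp_algEquiv_eq [Algebra.IsAlgebraic K k] [IsAlgClosed k] {Ω : Type*} [Field Ω]
    (j₁ j₂ : k →+* Ω) (h : j₁.comp (algebraMap K k) = j₂.comp (algebraMap K k)) :
    ∃ σ : k ≃ₐ[K] k, j₁.comp (σ : k ≃+* k).toRingHom = j₂ := by
  have : IsAlgClosure K k := ⟨inferInstance, inferInstance⟩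
  have : Normal K k := IsAlgClosure.normal K k
  let := j₁.toAlgebra
  let := (j₁.comp (algebraMap K k)).toAlgebra
  have : IsScalarTower K k Ω := .of_algebraMap_eq fun _ ↦ rfl
  let φ : k →ₐ[K] Ω := { toRingHom := j₂, commutes' := fun a ↦ (DFunLike.congr_fun h a).symm }
  refine ⟨AlgHom.restrictNormal' φ k, RingHom.ext fun x ↦ ?_⟩
  exact AlgHom.restrictNormal_commutes φ k x

variable {S P : Scheme.{u}} {q : P ⟶ S} {f : S ⟶ Spec (.of K)} {π : P ⟶ Spec (.of k)}

lemma flat_specMap {κ : Type u} [Field κ] {Ω : Type u} [Field Ω] [Algebra κ Ω] :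
    Flat (Spec.map (CommRingCat.ofHom (algebraMap κ Ω))) := by
  rw [Flat.SpecMap_iff]
  exact RingHom.flat_algebraMap_iff.mpr inferInstance

lemma flat_fst (h : IsPullback q π f (Spec.map (CommRingCat.ofHom (algebraMap K k)))) :
    Flat q :=
  MorphismProperty.of_isPullback h.flip flat_specMap

lemma surjective_fst (h : IsPullback q π f (Spec.map (CommRingCat.ofHom (algebraMap K k)))) :
    Surjective q := by
  refine MorphismProperty.of_isPullback (P := @Surjective) h.flip ⟨fun x ↦ ⟨specPt k, ?_⟩⟩
  exact Subsingleton.elim (α := PrimeSpectrum K) _ _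

lemma quasiCompact_fst (h : IsPullback q π f (Spec.map (CommRingCat.ofHom (algebraMap K k)))) :
    QuasiCompact q :=
  MorphismProperty.of_isPullback (P := @QuasiCompact) h.flip inferInstance

/-- The fibre product `P ×_S P` is the scalar extension of `P` along `K → k`, hence reduced in
characteristic zero. -/
lemma isReduced_pullback_fst
    (h : IsPullback q π f (Spec.map (CommRingCat.ofHom (algebraMap K k)))) [CharZero K]
    [Algebra.IsAlgebraic K k] [IsReduced P] [LocallyOfFiniteType π] :
    IsReduced (Limits.pullback q q) := by
  have := geometricallyReduced_specMap (K := K) (k := k)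
  have : Flat (Spec.map (CommRingCat.ofHom (algebraMap K k))) := flat_specMap
  have : IsLocallyNoetherian P := LocallyOfFiniteType.isLocallyNoetherian π
  have h1 := (IsPullback.of_hasPullback q q).paste_horiz h.flip
  exact isReduced_of_isOpenImmersion h1.isoPullback.hom

/-- A morphism from `P` that is invariant under the Galois group is compatible with the descent
datum of `P ⟶ S`. As `P ×_S P` is reduced, this can be tested at its points, where the two
projections to `P` differ by an element of the Galois group. -/
lemma comp_eq_of_galAut_comp_eq
    (h : IsPullback q π f (Spec.map (CommRingCat.ofHom (algebraMap K k)))) [CharZero K]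
    [IsAlgClosed k] [Algebra.IsAlgebraic K k] [IsReduced P] [LocallyOfFiniteType π]
    {T : Scheme.{u}} {t : T ⟶ Spec (.of K)} [IsSeparated t] {r : P ⟶ T} (hr : r ≫ t = q ≫ f)
    (hinv : ∀ σ, galAut h σ ≫ r = r) :
    Limits.pullback.fst q q ≫ r = Limits.pullback.snd q q ≫ r := by
  have := isReduced_pullback_fst h
  refine ext_of_fromSpecResidueField_eq _ _ t Set.univ dense_univ (fun z _ ↦ ?_) ?_
  · set i := (Limits.pullback q q).fromSpecResidueField z
    obtain ⟨j₁, hj₁⟩ := Spec.map_surjective (i ≫ Limits.pullback.fst q q ≫ π)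
    obtain ⟨j₂, hj₂⟩ := Spec.map_surjective (i ≫ Limits.pullback.snd q q ≫ π)
    obtain ⟨σ, hσ⟩ := exists_comp_algEquiv_eq (K := K) j₁.hom j₂.hom (by
      have : CommRingCat.ofHom (algebraMap K k) ≫ j₁ = CommRingCat.ofHom (algebraMap K k) ≫ j₂ := by
        apply Spec.map_injective
        rw [Spec.map_comp, Spec.map_comp, hj₁, hj₂]
        simp only [Category.assoc, ← h.w]
        rw [Limits.pullback.condition_assoc]
      exact congrArg CommRingCat.Hom.hom this)
    -- At the point `z`, the projections to `P` agree in `S`, and their maps to `Spec k` differ by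
    -- `σ`.
    have h2 : i ≫ Limits.pullback.snd q q = i ≫ Limits.pullback.fst q q ≫ galAut h σ := by
      apply h.hom_ext
      · simp only [Category.assoc, galAut_fst]
        rw [Limits.pullback.condition]
      · simp only [Category.assoc, galAut_snd]
        rw [← hj₂, ← Category.assoc, ← Category.assoc, Category.assoc i, ← hj₁, ← Spec.map_comp]
        congr 1
        ext x
        exact (DFunLike.congr_fun hσ x).symm
    have h3 := congrArg (· ≫ r) h2
    simp only [Category.assoc, hinv] at h3
    exact h3.symm
  · simp only [Category.assoc, hr]
    rw [Limits.pullback.condition_assoc]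

/-- Two `K`-schemes with the same scalar extension to `k` and the same Galois action on it are
isomorphic: as `P ⟶ S` is faithfully flat and quasi-compact, it is an effective epimorphism, and the
Galois-invariant morphism `P ⟶ S'` descends to `S`. -/
lemma exists_iso_of_galAut_eq {S' : Scheme.{u}} {q' : P ⟶ S'} {f' : S' ⟶ Spec (.of K)}
    (h : IsPullback q π f (Spec.map (CommRingCat.ofHom (algebraMap K k))))
    (h' : IsPullback q' π f' (Spec.map (CommRingCat.ofHom (algebraMap K k))))
    [CharZero K] [IsAlgClosed k] [Algebra.IsAlgebraic K k] [IsReduced P] [LocallyOfFiniteType π]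
    [IsSeparated f] [IsSeparated f'] (hσ : ∀ σ, galAut h σ = galAut h' σ) :
    ∃ φ : S ≅ S', φ.hom ≫ f' = f := by
  have := flat_fst h
  have := surjective_fst h
  have := quasiCompact_fst h
  have := flat_fst h'
  have := surjective_fst h'
  have := quasiCompact_fst h'
  have key {S S' : Scheme.{u}} {q : P ⟶ S} {f : S ⟶ Spec (.of K)} {q' : P ⟶ S'}
      {f' : S' ⟶ Spec (.of K)}
      (h : IsPullback q π f (Spec.map (CommRingCat.ofHom (algebraMap K k))))
      (h' : IsPullback q' π f' (Spec.map (CommRingCat.ofHom (algebraMap K k))))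
      [IsSeparated f'] [EffectiveEpi q] (hσ : ∀ σ, galAut h σ = galAut h' σ) :
      ∃ φ : S ⟶ S', q ≫ φ = q' := by
    refine ⟨EffectiveEpi.desc q q' fun {Z} g₁ g₂ hg ↦ ?_, EffectiveEpi.fac _ _ _⟩
    have h1 := comp_eq_of_galAut_comp_eq h (r := q') (t := f') (by rw [h.w, h'.w]) fun σ ↦ by
      rw [hσ, galAut_fst]
    have h2 : Limits.pullback.lift g₁ g₂ hg ≫ Limits.pullback.fst q q ≫ q' =
      Limits.pullback.lift g₁ g₂ hg ≫ Limits.pullback.snd q q ≫ q' := by rw [h1]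
    rwa [Limits.pullback.lift_fst_assoc, Limits.pullback.lift_snd_assoc] at h2
  obtain ⟨φ, hφ⟩ := key h h' hσ
  obtain ⟨φ', hφ'⟩ := key h' h fun σ ↦ (hσ σ).symm
  refine ⟨⟨φ, φ', ?_, ?_⟩, ?_⟩
  · rw [← cancel_epi q, reassoc_of% hφ, hφ', Category.comp_id]
  · rw [← cancel_epi q', reassoc_of% hφ', hφ, Category.comp_id]
  · rw [← cancel_epi q, reassoc_of% hφ, h.w, h'.w]

end Descent

/-! ### Functoriality of projective space -/

section Functoriality

open MvPolynomial HomogeneousLocalization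

variable {K k : Type u} [Field K] [Field k] {n : ℕ}

lemma irrelevant_le_map (F : grading K n →+*ᵍ grading k n)
    (h : ∀ i, X i ∈ Ideal.span (Set.range fun i ↦ F (X i))) :
    HomogeneousIdeal.irrelevant (grading k n) ≤
      (HomogeneousIdeal.irrelevant (grading K n)).map F := by
  refine irrelevant_le_of_X_mem _ fun i ↦ ?_
  have : Ideal.span (Set.range fun i ↦ F (X i)) ≤
      Ideal.map F (HomogeneousIdeal.irrelevant (grading K n)).toIdeal := by
    rw [Ideal.span_le]
    rintro _ ⟨j, rfl⟩
    refine Ideal.mem_map_of_mem F ?_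
    change (X j : MvPolynomial (Fin (n + 1)) K) ∈ HomogeneousIdeal.irrelevant (grading K n)
    rw [HomogeneousIdeal.mem_irrelevant_iff]
    exact DirectSum.decompose_of_mem_ne (grading K n) (X_mem_grading j) one_ne_zero
  exact this (h i)

lemma constAway_eq_mk (s : MvPolynomial (Fin (n + 1)) k) {m : ℕ} (hs : s ∈ grading k n m) (c : k) :
    constAway s c = Away.mk (grading k n) hs 0 (C c) (by simp) := by
  apply val_injective
  rw [Away.val_mk]
  change Localization.mk (C c) 1 = _
  congr 1

lemma awayι_projMap_projStr (F : grading K n →+*ᵍ grading k n)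
    (hF : HomogeneousIdeal.irrelevant (grading k n) ≤
      (HomogeneousIdeal.irrelevant (grading K n)).map F) (φ : K →+* k)
    (hC : ∀ c, F (C c) = C (φ c)) {s : MvPolynomial (Fin (n + 1)) K} {m : ℕ}
    (hs : s ∈ grading K n m) (hm : 0 < m) :
    Proj.awayι (grading k n) (F s) (F.2 hs) hm ≫ Proj.map F hF ≫ projStr K n =
      Proj.awayι (grading k n) (F s) (F.2 hs) hm ≫ projStr k n ≫
        Spec.map (CommRingCat.ofHom φ) := by
  rw [Proj.awayι_comp_map_assoc F hF hm _ hs, awayι_projStr,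
    reassoc_of% (awayι_projStr (k := k) (F s) (F.2 hs) hm), ← Spec.map_comp,
    ← Spec.map_comp, ← CommRingCat.ofHom_comp, ← CommRingCat.ofHom_comp]
  congr 2
  refine RingHom.ext fun c ↦ ?_
  change Away.map F s (constAway s c) = constAway (F s) (φ c)
  rw [constAway_eq_mk s hs, constAway_eq_mk (F s) (F.2 hs), Away.map_mk]
  simp only [hC]

lemma projMap_projStr (F : grading K n →+*ᵍ grading k n)
    (hF : HomogeneousIdeal.irrelevant (grading k n) ≤
      (HomogeneousIdeal.irrelevant (grading K n)).map F) (φ : K →+* k)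
    (hC : ∀ c, F (C c) = C (φ c)) :
    Proj.map F hF ≫ projStr K n = projStr k n ≫ Spec.map (CommRingCat.ofHom φ) :=
  (Proj.mapAffineOpenCover F hF).openCover.hom_ext _ _ fun s ↦
    awayι_projMap_projStr F hF φ hC s.2.2 s.1.2

lemma projMap_congr {F F' : grading K n →+*ᵍ grading k n}
    {hF : HomogeneousIdeal.irrelevant (grading k n) ≤
      (HomogeneousIdeal.irrelevant (grading K n)).map F}
    {hF' : HomogeneousIdeal.irrelevant (grading k n) ≤
      (HomogeneousIdeal.irrelevant (grading K n)).map F'}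
    (h : ∀ a, F a = F' a) : Proj.map F hF = Proj.map F' hF' := by
  obtain rfl : F = F' := DFunLike.ext _ _ h
  rfl

/-- The effect on points of the morphism given by a homogeneous substitution. -/
lemma projMap_pt (F : grading K n →+*ᵍ grading k n)
    (hF : HomogeneousIdeal.irrelevant (grading k n) ≤
      (HomogeneousIdeal.irrelevant (grading K n)).map F) (τ : K →+* k)
    {v : Fin (n + 1) → k} {u : Fin (n + 1) → K} (hv : v ≠ 0) (hu : u ≠ 0)
    (h : ∀ a, eval v (F a) = τ (eval u a)) :
    Proj.map F hF (pt v hv) = pt u hu := by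
  apply ProjectiveSpectrum.ext
  refine homogeneousIdeal_ext fun m a ha ↦ ?_
  rw [mem_pt hu ha]
  change F a ∈ (pt v hv).asHomogeneousIdeal ↔ _
  rw [mem_pt hv (m := m) (show F a ∈ grading k n m from F.2 ha), h, map_eq_zero]

/-- The extension of a ring homomorphism to the coefficients of homogeneous polynomials. -/
noncomputable def coeffHom (n : ℕ) (φ : K →+* k) : grading K n →+*ᵍ grading k n where
  __ := MvPolynomial.map φ
  map_mem ha := IsHomogeneous.map ha φ

lemma coeffHom_apply (φ : K →+* k) (a : MvPolynomial (Fin (n + 1)) K) :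
    coeffHom n φ a = MvPolynomial.map φ a := rfl

lemma irrelevant_le_map_coeffHom (φ : K →+* k) :
    HomogeneousIdeal.irrelevant (grading k n) ≤
      (HomogeneousIdeal.irrelevant (grading K n)).map (coeffHom n φ) :=
  irrelevant_le_map _ fun i ↦ Ideal.subset_span ⟨i, map_X φ i⟩

/-- The morphism from `ℙⁿ` over `k` to `ℙⁿ` over `K` given by a homomorphism `K → k`. -/
noncomputable def coeffMap (n : ℕ) (φ : K →+* k) : Proj (grading k n) ⟶ Proj (grading K n) :=
  Proj.map (coeffHom n φ) (irrelevant_le_map_coeffHom φ)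

lemma coeffMap_projStr (φ : K →+* k) :
    coeffMap n φ ≫ projStr K n = projStr k n ≫ Spec.map (CommRingCat.ofHom φ) :=
  projMap_projStr _ _ _ fun c ↦ by rw [coeffHom_apply, map_C]

lemma coeffMap_comp {L : Type u} [Field L] (φ : K →+* k) (ψ : k →+* L) :
    coeffMap n (ψ.comp φ) = coeffMap n ψ ≫ coeffMap n φ := by
  refine Eq.trans ?_ (Proj.map_comp (coeffHom n φ) (coeffHom n ψ) (irrelevant_le_map_coeffHom φ)
    (irrelevant_le_map_coeffHom ψ))
  exact projMap_congr fun a ↦ (map_map φ ψ a).symm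

/-- The morphism given by an automorphism `σ` of the field applies `σ⁻¹` to homogeneous
coordinates. -/
lemma coeffMap_pt (σ : k ≃+* k) {v : Fin (n + 1) → k} (hv : v ≠ 0)
    (hv' : (fun i ↦ σ.symm (v i)) ≠ 0) :
    coeffMap n σ.toRingHom (pt v hv) = pt (fun i ↦ σ.symm (v i)) hv' := by
  refine projMap_pt _ _ σ.toRingHom hv hv' fun a ↦ ?_
  have h1 : MvPolynomial.eval (fun i ↦ σ.symm (v i)) a =
      eval₂ (RingHom.id k) (fun i ↦ σ.symm (v i)) a := rfl
  rw [coeffHom_apply, MvPolynomial.eval_map, h1, hom_eval₂]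
  congr 1
  ext i
  simp

/-- The linear form whose coefficients are the `i`-th row of a matrix. -/
noncomputable def linForm (A : Matrix (Fin (n + 1)) (Fin (n + 1)) k) (i : Fin (n + 1)) :
    MvPolynomial (Fin (n + 1)) k := ∑ j, C (A i j) * X j

lemma isHomogeneous_linForm (A : Matrix (Fin (n + 1)) (Fin (n + 1)) k) (i : Fin (n + 1)) :
    (linForm A i).IsHomogeneous 1 :=
  IsHomogeneous.sum _ _ _ fun j _ ↦ (isHomogeneous_X k j).C_mul _

/-- The linear substitution in homogeneous polynomials given by a matrix. -/
noncomputable def substHom (A : Matrix (Fin (n + 1)) (Fin (n + 1)) k) :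
    grading k n →+*ᵍ grading k n where
  __ := (aeval (linForm A) : MvPolynomial (Fin (n + 1)) k →ₐ[k] MvPolynomial (Fin (n + 1)) k)
  map_mem {m a} ha := by
    have := IsHomogeneous.aeval (show a.IsHomogeneous m from ha) (linForm A)
      (isHomogeneous_linForm A)
    rwa [one_mul] at this

lemma substHom_apply (A : Matrix (Fin (n + 1)) (Fin (n + 1)) k) (a) :
    substHom A a = aeval (linForm A) a := rfl

lemma substHom_linForm (A B : Matrix (Fin (n + 1)) (Fin (n + 1)) k) (i) :
    substHom A (linForm B i) = linForm (B * A) i := by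
  rw [substHom_apply, linForm, map_sum]
  simp only [map_mul, aeval_C, aeval_X, algebraMap_eq, linForm, Finset.mul_sum, Matrix.mul_apply,
    map_sum, Finset.sum_mul]
  rw [Finset.sum_comm]
  simp only [mul_assoc]

lemma linForm_one (i) : linForm (1 : Matrix (Fin (n + 1)) (Fin (n + 1)) k) i = X i := by
  simp [linForm, Matrix.one_apply, apply_ite]

lemma substHom_substHom {A B : Matrix (Fin (n + 1)) (Fin (n + 1)) k} (h : B * A = 1) (a) :
    ((substHom A).comp (substHom B)) a = GradedRingHom.id (grading k n) a := by
  have h1 : (aeval (linForm A)).comp (aeval (linForm B)) =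
      AlgHom.id k (MvPolynomial (Fin (n + 1)) k) := by
    ext1 i
    rw [AlgHom.comp_apply, aeval_X, ← substHom_apply, substHom_linForm, h, linForm_one,
      AlgHom.id_apply]
  exact DFunLike.congr_fun h1 a

lemma irrelevant_le_map_substHom {A B : Matrix (Fin (n + 1)) (Fin (n + 1)) k} (h : B * A = 1) :
    HomogeneousIdeal.irrelevant (grading k n) ≤
      (HomogeneousIdeal.irrelevant (grading k n)).map (substHom A) :=
  irrelevant_le_map _ fun i ↦ by
    rw [← linForm_one, ← h, ← substHom_linForm, linForm, map_sum]
    refine Ideal.sum_mem _ fun j _ ↦ ?_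
    rw [map_mul]
    exact Ideal.mul_mem_left _ _ (Ideal.subset_span ⟨j, rfl⟩)

/-- A linear change of coordinates of projective space. -/
lemma exists_coordinateChange {A B : Matrix (Fin (n + 1)) (Fin (n + 1)) k} (hAB : A * B = 1)
    (hBA : B * A = 1) : ∃ l l' : Proj (grading k n) ⟶ Proj (grading k n), l ≫ l' = 𝟙 _ ∧
      l' ≫ l = 𝟙 _ ∧ l ≫ projStr k n = projStr k n ∧
      ∀ v hv hv', l (pt v hv) = pt (A.mulVec v) hv' := by
  refine ⟨Proj.map (substHom A) (irrelevant_le_map_substHom hBA),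
    Proj.map (substHom B) (irrelevant_le_map_substHom hAB), ?_, ?_, ?_, ?_⟩
  · exact (Proj.map_comp (substHom B) (substHom A) (irrelevant_le_map_substHom hAB)
      (irrelevant_le_map_substHom hBA)).symm.trans
      ((projMap_congr (substHom_substHom hBA)).trans Proj.map_id)
  · exact (Proj.map_comp (substHom A) (substHom B) (irrelevant_le_map_substHom hBA)
      (irrelevant_le_map_substHom hAB)).symm.trans
      ((projMap_congr (substHom_substHom hAB)).trans Proj.map_id)
  · rw [projMap_projStr _ _ (RingHom.id k) fun c ↦ by
      rw [substHom_apply, aeval_C]; rfl]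
    exact (congrArg (projStr k n ≫ ·) (Spec.map_id _)).trans (Category.comp_id _)
  · intro v hv hv'
    refine projMap_pt _ _ (RingHom.id k) hv hv' fun a ↦ ?_
    have h1 : MvPolynomial.eval (A.mulVec v) a =
        eval₂ (RingHom.id k) (A.mulVec v) a := rfl
    rw [substHom_apply, aeval_def, hom_eval₂, h1, RingHom.id_apply]
    congr 1
    · ext c
      simp
    · ext i
      simp [linForm, Matrix.mulVec, dotProduct]

end Functoriality

/-! ### Scalar extension of projective space -/

section BaseChange

open MvPolynomial HomogeneousLocalization TensorProduct

/-- A criterion for a ring `B` to be the tensor product `k ⊗[K] A`, in terms of a basis of `k`. -/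
lemma isPushout_of_basis {K k A B : Type u} [Field K] [Field k] [CommRing A] [CommRing B]
    [Algebra K k] (α : K →+* A) (β : k →+* B) (γ : A →+* B)
    (hcomm : γ.comp α = β.comp (algebraMap K k)) {ι : Type*} (b : Module.Basis ι K k)
    (hsurj : ∀ y : B, y ∈ AddSubmonoid.closure {y | ∃ c x, y = β c * γ x})
    (hinj : ∀ x : ι →₀ A, (x.sum fun i a ↦ β (b i) * γ a) = 0 → x = 0) :
    IsPushout (CommRingCat.ofHom (algebraMap K k)) (CommRingCat.ofHom α) (CommRingCat.ofHom β)
      (CommRingCat.ofHom γ) := by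
  classical
  let := α.toAlgebra
  let := (γ.comp α).toAlgebra
  let β' : k →ₐ[K] B := { β with commutes' := fun c ↦ (DFunLike.congr_fun hcomm c).symm }
  let γ' : A →ₐ[K] B := { γ with commutes' := fun c ↦ rfl }
  let μ := Algebra.TensorProduct.productMap β' γ'
  have hμ (c : k) (x : A) : μ (c ⊗ₜ x) = β c * γ x :=
    Algebra.TensorProduct.productMap_apply_tmul _ _ _ _
  have hbij : Function.Bijective μ := by
    constructor
    · rw [injective_iff_map_eq_zero]
      intro x hx
      set x' := TensorProduct.equivFinsuppOfBasisLeft b x with hx'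
      have h1 : x = x'.sum fun i n ↦ b i ⊗ₜ n := by
        rw [← TensorProduct.equivFinsuppOfBasisLeft_symm_apply, hx', LinearEquiv.symm_apply_apply]
      rw [h1, Finsupp.sum, map_sum] at hx
      simp only [hμ] at hx
      have := hinj x' hx
      rwa [hx', LinearEquiv.map_eq_zero_iff] at this
    · intro y
      change y ∈ AddMonoidHom.mrange (μ : k ⊗[K] A →+ B)
      refine AddSubmonoid.closure_le.mpr ?_ (hsurj y)
      rintro _ ⟨c, x, rfl⟩
      exact ⟨c ⊗ₜ x, hμ c x⟩
  let e : k ⊗[K] A ≃+* B := RingEquiv.ofBijective μ hbij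
  refine (CommRingCat.isPushout_tensorProduct K k A).of_iso (Iso.refl _) (Iso.refl _) (Iso.refl _)
    e.toCommRingCatIso (by simp) (by simp) ?_ ?_
  · ext c
    have := hμ c 1
    rw [map_one, mul_one] at this
    exact this
  · ext x
    have := hμ 1 x
    rw [map_one, one_mul] at this
    exact this

variable {K k : Type u} [Field K] [Field k] [Algebra K k] {n : ℕ}

/-- The denominator `s ^ N` of a fraction can be replaced by a higher power of `s`. -/
lemma awayMk_eq_mk_add {s : MvPolynomial (Fin (n + 1)) K} {m : ℕ} (hs : s ∈ grading K n m) (N l : ℕ)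
    {a : MvPolynomial (Fin (n + 1)) K} (ha : a ∈ grading K n (N • m)) :
    ∃ a', ∃ ha' : a' ∈ grading K n ((N + l) • m),
      Away.mk (grading K n) hs N a ha = Away.mk (grading K n) hs (N + l) a' ha' := by
  refine ⟨a * s ^ l, ?_, ?_⟩
  · rw [add_smul]
    exact SetLike.mul_mem_graded ha (SetLike.pow_mem_graded l hs)
  · apply HomogeneousLocalization.val_injective
    rw [Away.val_mk, Away.val_mk, Localization.mk_eq_mk_iff, Localization.r_iff_exists]
    exact ⟨1, by simp; ring⟩

/-- Extending scalars commutes with passing to `k[x₀, …, xₙ]_{(s)}`. -/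
lemma isPushout_away {s : MvPolynomial (Fin (n + 1)) K} {m : ℕ} (hs : s ∈ grading K n m)
    (F : grading K n →+*ᵍ grading k n) (hF : ∀ a, F a = MvPolynomial.map (algebraMap K k) a) :
    IsPushout (CommRingCat.ofHom (algebraMap K k)) (CommRingCat.ofHom (constAway s))
      (CommRingCat.ofHom (constAway (F s))) (CommRingCat.ofHom (Away.map F s)) := by
  classical
  let b := Module.Basis.ofVectorSpace K k
  have hval (y : Away (grading k n) (F s)) : y.val = algebraMap _ (Localization.Away (F s)) y := rfl
  have hterm (c : k) (N : ℕ) (a : MvPolynomial (Fin (n + 1)) K) (ha : a ∈ grading K n (N • m)) :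
      (constAway (F s) c * Away.map F s (Away.mk _ hs N a ha)).val =
        Localization.mk (C c * MvPolynomial.map (algebraMap K k) a)
          (⟨F s ^ N, N, rfl⟩ : Submonoid.powers (F s)) := by
    rw [val_mul, constAway_eq_mk (F s) (F.2 hs), Away.map_mk, Away.val_mk, Away.val_mk,
      Localization.mk_mul]
    congr 1
    · rw [hF]
    · ext; simp
  refine isPushout_of_basis _ _ _ ?_ b (fun y ↦ ?_) fun x hx ↦ ?_
  · refine RingHom.ext fun c ↦ ?_
    change Away.map F s (constAway s c) = constAway (F s) (algebraMap K k c)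
    rw [constAway_eq_mk s hs, constAway_eq_mk (F s) (F.2 hs), Away.map_mk]
    simp only [hF, map_C]
  · obtain ⟨N, a, ha, rfl⟩ := Away.mk_surjective (grading k n) (F.2 hs) y
    have ha' : a.IsHomogeneous (N • m) := ha
    have hmem (d : Fin (n + 1) →₀ ℕ) (hd : d ∈ a.support) :
        (monomial d (1 : K)) ∈ grading K n (N • m) :=
      isHomogeneous_monomial _ (by
        have := ha' (mem_support_iff.mp hd)
        rw [Finsupp.degree_eq_weight_one]
        exact this)
    have hsum : Away.mk (grading k n) (F.2 hs) N a ha = ∑ d ∈ a.support.attach,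
        constAway (F s) (coeff d.1 a) * Away.map F s (Away.mk _ hs N (monomial d.1 1)
          (hmem d.1 d.2)) := by
      apply HomogeneousLocalization.val_injective
      rw [hval (∑ d ∈ _, _), map_sum]
      simp only [← hval, hterm, Away.val_mk]
      rw [← Localization.mk_sum]
      congr 1
      simp only [map_monomial, map_one, C_mul_monomial, mul_one]
      rw [Finset.sum_attach a.support (fun d ↦ monomial d (coeff d a))]
      exact a.as_sum
    rw [hsum]
    exact sum_mem fun d _ ↦ AddSubmonoid.subset_closure ⟨_, _, rfl⟩
  · by_cases hs0 : s = 0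
    · have : Subsingleton (Away (grading K n) s) :=
        HomogeneousLocalization.subsingleton _ ⟨1, by simp [hs0]⟩
      exact Subsingleton.elim _ _
    have hFs : F s ≠ 0 := by
      rw [hF]
      exact fun h ↦ hs0 (map_injective _ (algebraMap K k).injective (h.trans (map_zero _).symm))
    choose N a ha hmk using fun i ↦ Away.mk_surjective (grading K n) hs (x i)
    have h1 (i) : ∃ a', ∃ ha' : a' ∈ grading K n ((N i + (x.support.sup N - N i)) • m), x i = _ :=
      hmk i ▸ awayMk_eq_mk_add hs (N i) (x.support.sup N - N i) (ha i)
    have h2 (i) (hi : i ∈ x.support) : ∃ a', ∃ ha' : a' ∈ grading K n ((x.support.sup N) • m),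
        x i = Away.mk (grading K n) hs (x.support.sup N) a' ha' := by
      have := h1 i
      rwa [Nat.add_sub_cancel' (Finset.le_sup hi)] at this
    generalize x.support.sup N = M at h2
    choose a ha hmk using h2
    have h3 : (∑ i ∈ x.support.attach, C (b i) * MvPolynomial.map (algebraMap K k) (a i.1 i.2)) =
        0 := by
      have h4 : (x.sum fun i a ↦ constAway (F s) (b i) * Away.map F s a).val = 0 := by
        rw [show (x.sum fun i a ↦ constAway (F s) (b i) * Away.map F s a) = 0 from hx, val_zero]
      rw [Finsupp.sum, ← Finset.sum_attach, hval, map_sum] at h4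
      simp only [← hval] at h4
      rw [Finset.sum_congr rfl fun i _ ↦ by rw [hmk i.1 i.2, hterm], ← Localization.mk_sum,
        ← Localization.mk_zero 1, Localization.mk_eq_mk_iff, Localization.r_iff_exists] at h4
      obtain ⟨⟨_, l, rfl⟩, hc⟩ := h4
      simpa [hFs] using hc
    ext1 i
    by_contra hi
    have hi' : i ∈ x.support := Finsupp.mem_support_iff.mpr hi
    have h5 : a i hi' = 0 := by
      ext d
      have h6 := congrArg (coeff d) h3
      simp only [coeff_sum, coeff_C_mul, coeff_map, coeff_zero] at h6
      have h7 := linearIndependent_iff'.mp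
        (b.linearIndependent.comp (fun i : x.support ↦ i.1) Subtype.val_injective) x.support.attach
        (fun i ↦ coeff d (a i.1 i.2)) (by
          rw [← h6]
          exact Finset.sum_congr rfl fun j _ ↦ by
            rw [Algebra.smul_def, mul_comm]; rfl) ⟨i, hi'⟩ (Finset.mem_attach _ _)
      exact h7
    apply hi
    rw [hmk i hi']
    apply HomogeneousLocalization.val_injective
    rw [Away.val_mk]
    simp [h5, Localization.mk_zero]

end BaseChange

/-- Pullback squares can be checked on an open cover, for arbitrary models of its preimage. -/
lemma isPullback_of_charts {W X Y Z : Scheme.{u}} {a : W ⟶ X} {b : W ⟶ Y} {c : X ⟶ Z} {d : Y ⟶ Z}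
    (𝒰 : X.OpenCover)
    (H : ∀ i, ∃ (V : Scheme.{u}) (r : V ⟶ 𝒰.X i) (s : V ⟶ W), IsPullback r s (𝒰.f i) a ∧
      IsPullback r (s ≫ b) (𝒰.f i ≫ c) d) : IsPullback a b c d := by
  refine Scheme.isPullback_of_openCover a b c d 𝒰 fun i ↦ ?_
  obtain ⟨V, r, s, h₁, h₂⟩ := H i
  refine h₂.of_iso h₁.flip.isoPullback (Iso.refl _) (Iso.refl _) (Iso.refl _) ?_ ?_ ?_ ?_
  · exact (Category.comp_id _).trans h₁.flip.isoPullback_hom_snd.symm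
  · exact (Category.comp_id _).trans
      ((congrArg (· ≫ b) h₁.flip.isoPullback_hom_fst.symm).trans (Category.assoc _ _ _))
  · exact (Category.comp_id _).trans (Category.id_comp _).symm
  · exact (Category.comp_id _).trans (Category.id_comp _).symm

/-- On the chart where `s` does not vanish, scalar extension of projective space is scalar extension
of the ring `K[x₀, …, xₙ]_{(s)}`. -/
lemma isPullback_coeffMap_chart {K k : Type u} [Field K] [Field k] [Algebra K k] {n : ℕ}
    {s : MvPolynomial (Fin (n + 1)) K} {m : ℕ} (hs : s ∈ grading K n m) (hm : 0 < m) :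
    ∃ (V : Scheme.{u}) (r : V ⟶ Spec (.of (HomogeneousLocalization.Away (grading K n) s)))
      (t : V ⟶ Proj (grading k n)),
      IsPullback r t (Proj.awayι (grading K n) s hs hm) (coeffMap n (algebraMap K k)) ∧
      IsPullback r (t ≫ projStr k n) (Proj.awayι (grading K n) s hs hm ≫ projStr K n)
        (Spec.map (CommRingCat.ofHom (algebraMap K k))) := by
  let F := coeffHom n (algebraMap K k)
  refine ⟨_, Spec.map (CommRingCat.ofHom (HomogeneousLocalization.Away.map F s)),
    Proj.awayι (grading k n) (F s) (F.2 hs) hm, ?_, ?_⟩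
  · refine (IsOpenImmersion.isPullback _ _ _ _ (Proj.awayι_comp_map F
      (irrelevant_le_map_coeffHom (algebraMap K k)) hm s hs) ?_)
    rw [Proj.opensRange_awayι, Proj.opensRange_awayι]
    rfl
  · rw [awayι_projStr, awayι_projStr]
    exact (isPullback_SpecMap_of_isPushout _ _ _ _ (isPushout_away hs F fun a ↦ rfl)).flip

/-- Projective space commutes with extension of scalars. -/
lemma isPullback_coeffMap (K k : Type u) [Field K] [Field k] [Algebra K k] (n : ℕ) :
    IsPullback (coeffMap n (algebraMap K k)) (projStr k n) (projStr K n)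
      (Spec.map (CommRingCat.ofHom (algebraMap K k))) :=
  isPullback_of_charts (Proj.affineOpenCover (grading K n)).openCover fun s ↦
    isPullback_coeffMap_chart s.2.2 s.1.2

/-! ### Semilinear and projective representations of the Galois group -/

section Descent

variable {K k : Type u} {V : Type*} [Field K] [Field k] [Algebra K k] [AddCommGroup V] [Module k V]

/-- A semilinear action of the Galois group of `k` over `K` on a vector space over `k`, for which
the stabilizers of vectors are open. -/
structure SemilinearAction (K k V : Type*) [Field K] [Field k] [Algebra K k] [AddCommGroup V]
    [Module k V] where
  act : (k ≃ₐ[K] k) → V →+ V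
  act_smul : ∀ σ (c : k) v, act σ (c • v) = σ c • act σ v
  act_mul : ∀ σ τ v, act (σ * τ) v = act σ (act τ v)
  exists_fixing : ∀ v, ∃ L : IntermediateField K k, FiniteDimensional K L ∧
    ∀ σ : k ≃ₐ[K] k, (∀ a ∈ L, σ a = a) → act σ v = v

namespace SemilinearAction

variable (ρ : SemilinearAction K k V)

/-- Galois descent: the invariant vectors span. For a vector `v` fixed by the automorphisms over
a finite extension `L`, the sums `∑ ε(a) • ρ(ε) v` over the embeddings `ε` of `L` are invariant, and
by independence of characters `v` is a combination of them. -/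
theorem span_invariants [Algebra.IsAlgebraic K k] [IsAlgClosed k] :
    Submodule.span k {v | ∀ σ, ρ.act σ v = v} = ⊤ := by
  classical
  rw [eq_top_iff]
  intro v _
  obtain ⟨L, hL, hfix⟩ := ρ.exists_fixing v
  by_contra hv
  -- Otherwise a linear form `f` vanishes on the invariant vectors, but not at `v`.
  obtain ⟨f, hfv, hf⟩ := Submodule.exists_le_ker_of_notMem hv
  choose ext hext using fun ε : L →ₐ[K] k ↦ exists_algEquiv_comp_eq (K := K) L.val ε
  -- The value of `ρ(σ) v` depends only on the restriction of `σ` to `L`.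
  have key (σ τ : k ≃ₐ[K] k) (hστ : ∀ a : L, σ a = τ a) : ρ.act σ v = ρ.act τ v := by
    have h1 : σ = τ * (τ⁻¹ * σ) := by group
    rw [h1, ρ.act_mul, hfix (τ⁻¹ * σ)]
    intro a ha
    have h2 := hστ ⟨a, ha⟩
    change τ⁻¹ (σ a) = a
    change σ a = τ a at h2
    rw [h2]
    exact τ.symm_apply_apply a
  have hinv (a : L) : ∑ ε : L →ₐ[K] k, ε a • ρ.act (ext ε) v ∈ {v | ∀ σ, ρ.act σ v = v} := by
    intro τ
    rw [map_sum]
    refine Fintype.sum_bijective (fun ε : L →ₐ[K] k ↦ (τ : k →ₐ[K] k).comp ε) ?_ _ _ fun ε ↦ ?_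
    · refine Function.bijective_iff_has_inverse.mpr
        ⟨fun ε ↦ (τ.symm : k →ₐ[K] k).comp ε, fun ε ↦ ?_, fun ε ↦ ?_⟩
      · ext a
        exact τ.symm_apply_apply _
      · ext a
        exact τ.apply_symm_apply _
    · rw [ρ.act_smul, ← ρ.act_mul]
      congr 1
      refine key _ _ fun a ↦ ?_
      rw [show ((a : L) : k) = L.val a from rfl, hext]
      exact congrArg τ (hext ε a)
  have hsum (a : L) : ∑ ε : L →ₐ[K] k, f (ρ.act (ext ε) v) * ε a = 0 := by
    have h1 : f _ = 0 := hf (Submodule.subset_span (hinv a))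
    rw [map_sum] at h1
    rw [← h1]
    exact Finset.sum_congr rfl fun ε _ ↦ by rw [map_smul, smul_eq_mul, mul_comm]
  have hli := (linearIndependent_monoidHom L k).comp
    (fun ε : L →ₐ[K] k ↦ ((ε : L →+* k) : L →* k)) fun ε ε' h ↦ AlgHom.ext fun a ↦
      DFunLike.congr_fun h a
  have h0 := Fintype.linearIndependent_iff.mp hli (fun ε ↦ f (ρ.act (ext ε) v)) (by
    funext a
    rw [Finset.sum_apply]
    exact hsum a) L.val
  refine hfv ?_
  have h2 : ρ.act (ext L.val) v = v := hfix _ fun a ha ↦ hext L.val ⟨a, ha⟩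
  rwa [h2] at h0

/-- A semilinear action has a basis of invariant vectors. -/
lemma exists_basis [Algebra.IsAlgebraic K k] [IsAlgClosed k] [FiniteDimensional k V] :
    ∃ b : Module.Basis (Fin (Module.finrank k V)) k V, ∀ σ i, ρ.act σ (b i) = b i := by
  obtain ⟨s, hs, hspan, hli⟩ := exists_linearIndependent k {v | ∀ σ, ρ.act σ v = v}
  let b := Module.Basis.mk hli (by
    rw [Subtype.range_coe, hspan, ρ.span_invariants])
  have : Fintype s := FiniteDimensional.fintypeBasisIndex b
  refine ⟨b.reindex (Fintype.equivFinOfCardEq (Module.finrank_eq_card_basis b).symm),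
    fun σ i ↦ ?_⟩
  rw [Module.Basis.reindex_apply, Module.Basis.mk_apply]
  exact hs (Subtype.property _) σ

end SemilinearAction

/-- Two semilinear maps which agree up to scalars at every vector agree up to a scalar: the factors
at `v`, `w` and `v + w` are compared. -/
lemma exists_eq_smul_of_forall {σ : k ≃+* k} {R R' : V →+ V}
    (hR : ∀ (c : k) v, R (c • v) = σ c • R v) (hR' : ∀ (c : k) v, R' (c • v) = σ c • R' v)
    (hR0 : ∀ v, v ≠ 0 → R v ≠ 0) (h : ∀ v, ∃ c : k, R' v = c • R v) :
    ∃ c : k, ∀ v, R' v = c • R v := by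
  rcases subsingleton_or_nontrivial V with _ | _
  · exact ⟨1, fun v ↦ Subsingleton.elim _ _⟩
  obtain ⟨w, hw⟩ := exists_ne (0 : V)
  obtain ⟨c, hc⟩ := h w
  refine ⟨c, fun v ↦ ?_⟩
  obtain ⟨a, ha⟩ := h v
  obtain ⟨b, hb⟩ := h (v + w)
  have h1 : R ((σ.symm (b - a)) • v + (σ.symm (b - c)) • w) = 0 := by
    rw [map_add, map_add, smul_add, ha, hc] at hb
    rw [map_add, hR, hR, σ.apply_symm_apply, σ.apply_symm_apply, sub_smul, sub_smul,
      sub_add_sub_comm, ← hb, sub_self]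
  have h2 : (σ.symm (b - a)) • v + (σ.symm (b - c)) • w = 0 := by
    by_contra hne
    exact hR0 _ hne h1
  by_cases hba : b = a
  · rw [hba, sub_self, map_zero, zero_smul, zero_add, smul_eq_zero_iff_left hw,
      EmbeddingLike.map_eq_zero_iff, sub_eq_zero] at h2
    rw [ha, h2]
  · have h3 : σ.symm (b - a) ≠ 0 := by
      rwa [Ne, EmbeddingLike.map_eq_zero_iff, sub_eq_zero]
    have h4 : v = (-(σ.symm (b - a))⁻¹ * σ.symm (b - c)) • w := by
      rw [neg_mul, neg_smul, mul_smul, eq_neg_iff_add_eq_zero, ← inv_smul_smul₀ h3 v, ← smul_add,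
        h2, smul_zero]
    rw [h4, hR', hR, hc, smul_comm]

/-- A projective semilinear representation of the Galois group of `k` over `K` on a vector space
over `k`, for which the stabilizers of lines are open. Each `act σ` is only meaningful up to a
scalar; the factors in `exists_act_mul` and `exists_fixing` are allowed to depend on the vector, but
for `exists_act_mul` they need not, by `exists_act_mul_eq`. -/
structure ProjectiveAction (K k V : Type*) [Field K] [Field k] [Algebra K k] [AddCommGroup V]
    [Module k V] where
  act : (k ≃ₐ[K] k) → V →+ V
  act_smul : ∀ σ (c : k) v, act σ (c • v) = σ c • act σ v
  act_ne_zero : ∀ σ v, v ≠ 0 → act σ v ≠ 0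
  exists_act_mul : ∀ σ τ v, ∃ c : k, act (σ * τ) v = c • act σ (act τ v)
  exists_fixing : ∀ v, ∃ L : IntermediateField K k, FiniteDimensional K L ∧
    ∀ σ : k ≃ₐ[K] k, (∀ a ∈ L, σ a = a) → ∃ c : k, act σ v = c • v

namespace ProjectiveAction

variable (ρ : ProjectiveAction K k V)

lemma act_injective (σ : k ≃ₐ[K] k) : Function.Injective (ρ.act σ) :=
  (injective_iff_map_eq_zero _).mpr fun v hv ↦ by
    by_contra h
    exact ρ.act_ne_zero σ v h hv

lemma exists_act_mul_eq (σ τ : k ≃ₐ[K] k) :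
    ∃ c : k, ∀ v, ρ.act (σ * τ) v = c • ρ.act σ (ρ.act τ v) :=
  exists_eq_smul_of_forall (σ := (σ * τ : k ≃ₐ[K] k).toRingEquiv)
    (R := (ρ.act σ).comp (ρ.act τ)) (R' := ρ.act (σ * τ))
    (fun c v ↦ by
      change ρ.act σ (ρ.act τ (c • v)) = σ (τ c) • ρ.act σ (ρ.act τ v)
      rw [ρ.act_smul, ρ.act_smul]) (fun c v ↦ ρ.act_smul _ c v)
    (fun v hv ↦ ρ.act_ne_zero _ _ (ρ.act_ne_zero _ _ hv)) fun v ↦ ρ.exists_act_mul σ τ v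

/-- A projective action fixing the line of `w` comes from a semilinear action, obtained by rescaling
so that `w` itself is fixed. -/
lemma exists_semilinearAction [Algebra.IsAlgebraic K k] {w : V} (hw : w ≠ 0)
    (hfix : ∀ σ, ∃ c : k, ρ.act σ w = c • w) :
    ∃ ρ' : SemilinearAction K k V, ∀ σ, ∃ c : k, c ≠ 0 ∧ ∀ v, ρ.act σ v = c • ρ'.act σ v := by
  choose c hc using hfix
  have hc0 (σ) : c σ ≠ 0 := fun h ↦ ρ.act_ne_zero σ w hw (by rw [hc, h, zero_smul])
  let R (σ : k ≃ₐ[K] k) : V →+ V := (DistribSMul.toAddMonoidHom V (c σ)⁻¹).comp (ρ.act σ)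
  have hR (σ v) : R σ v = (c σ)⁻¹ • ρ.act σ v := rfl
  have hRw (σ) : R σ w = w := by rw [hR, hc, inv_smul_smul₀ (hc0 σ)]
  have hsmul (σ) (a : k) (v) : R σ (a • v) = σ a • R σ v := by
    rw [hR, hR, ρ.act_smul, smul_comm]
  refine ⟨⟨R, hsmul, fun σ τ v ↦ ?_, fun v ↦ ?_⟩, fun σ ↦ ⟨c σ, hc0 σ, fun v ↦ ?_⟩⟩
  · obtain ⟨d, hd⟩ := ρ.exists_act_mul_eq σ τ
    have h1 (v) : R (σ * τ) v = ((c (σ * τ))⁻¹ * d * (c σ * σ (c τ))) • R σ (R τ v) := by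
      rw [hR, hd, hR τ, hsmul, hR, mul_smul, mul_smul, mul_smul, map_inv₀,
        smul_smul (σ (c τ)), mul_inv_cancel₀ ((map_ne_zero σ).mpr (hc0 τ)), one_smul,
        smul_smul (c σ), mul_inv_cancel₀ (hc0 σ), one_smul]
    have h2 := h1 w
    rw [hRw, hRw, hRw] at h2
    -- The factor is determined at `w`, which is fixed.
    have h3 : (c (σ * τ))⁻¹ * d * (c σ * σ (c τ)) = 1 := by
      have h4 : (1 - (c (σ * τ))⁻¹ * d * (c σ * σ (c τ))) • w = 0 := by
        rw [sub_smul, ← h2, one_smul, sub_self]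
      exact (sub_eq_zero.mp ((smul_eq_zero_iff_left hw).mp h4)).symm
    rw [h1, h3, one_smul]
  · by_cases hv : v ∈ Submodule.span k {w}
    · obtain ⟨a, rfl⟩ := Submodule.mem_span_singleton.mp hv
      refine ⟨IntermediateField.adjoin K {a}, IntermediateField.adjoin.finiteDimensional
        (Algebra.IsIntegral.isIntegral a), fun σ hσ ↦ ?_⟩
      change R σ (a • w) = a • w
      rw [hsmul, hRw, hσ a (IntermediateField.mem_adjoin_simple_self K a)]
    -- The lines of `v` and `v + w` are fixed by an open subgroup; as `w` is fixed, so is `v`.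
    · obtain ⟨L, hL, h1⟩ := ρ.exists_fixing v
      obtain ⟨L', hL', h2⟩ := ρ.exists_fixing (v + w)
      refine ⟨L ⊔ L', inferInstance, fun σ hσ ↦ ?_⟩
      obtain ⟨a, ha⟩ := h1 σ fun x hx ↦ hσ x (le_sup_left (a := L) (b := L') hx)
      obtain ⟨b, hb⟩ := h2 σ fun x hx ↦ hσ x (le_sup_right (a := L) (b := L') hx)
      rw [map_add, ha, hc, smul_add, ← sub_eq_zero, add_sub_add_comm, ← sub_smul, ← sub_smul] at hb
      have h5 : a - b = 0 := by
        by_contra hab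
        refine hv (Submodule.mem_span_singleton.mpr ⟨-(a - b)⁻¹ * (c σ - b), ?_⟩)
        rw [neg_mul, neg_smul, mul_smul, eq_comm, eq_neg_iff_add_eq_zero,
          ← inv_smul_smul₀ hab v, ← smul_add, hb, smul_zero]
      rw [h5, zero_smul, zero_add, smul_eq_zero_iff_left hw] at hb
      change R σ v = v
      rw [hR, ha, sub_eq_zero.mp h5, ← sub_eq_zero.mp hb, inv_smul_smul₀ (hc0 σ)]
  · change _ = c σ • R σ v
    rw [hR, smul_inv_smul₀ (hc0 σ)]

end ProjectiveAction
end Descent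

/-! ### Forms of projective space with a rational point -/

section Chatelet

variable {K k : Type u} [Field K] [Field k] [Algebra K k] {n : ℕ}

/-- An endomorphism of projective space over an algebraically closed field is determined by its
values at closed points. -/
lemma eq_id_of_apply_pt [IsAlgClosed k] {ψ : Proj (grading k n) ⟶ Proj (grading k n)}
    (hψ : ψ ≫ projStr k n = projStr k n) (h : ∀ v hv, ψ (pt v hv) = pt v hv) : ψ = 𝟙 _ := by
  have : LocallyOfFiniteType (ψ ≫ projStr k n) := by rw [hψ]; infer_instance
  refine ext_of_apply_eq (projStr k n) Set.univ isClosed_univ.isLocallyClosed dense_univ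
    (fun x _ hx ↦ ?_) (hψ.trans (Category.id_comp _).symm)
  obtain ⟨v, hv, h1⟩ := exists_eq_pt x hx
  have h2 : ψ x = x := by
    have h3 := h v hv
    rw [← h1] at h3
    exact h3
  simpa using h2

variable {S : Scheme.{u}} {f : S ⟶ Spec (.of K)} {q : Proj (grading k n) ⟶ S}

/-- A twisted form of projective space gives a projective semilinear representation of the Galois
group. -/
lemma exists_projectiveAction {q : Proj (grading k (n + 1)) ⟶ S} [CharZero K] [IsAlgClosed k]
    [Algebra.IsAlgebraic K k] [LocallyOfFiniteType f]
    (h : IsPullback q (projStr k (n + 1)) f (Spec.map (CommRingCat.ofHom (algebraMap K k)))) :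
    ∃ ρ : ProjectiveAction K k (Fin (n + 1 + 1) → k), ∀ σ v hv, ∃ hv',
      galAut h σ⁻¹ (pt v hv) = pt (ρ.act σ v) hv' := by
  have : CharZero k := charZero_of_injective_algebraMap (algebraMap K k).injective
  have h1 (σ : k ≃ₐ[K] k) := exists_semilinear (ψ := galAut h σ⁻¹) (ψ' := galAut h σ)
    (by rw [← galAut_mul, inv_mul_cancel, galAut_one])
    (by rw [← galAut_mul, mul_inv_cancel, galAut_one]) (σ⁻¹ : k ≃ₐ[K] k) (galAut_snd h σ⁻¹)
  choose R hR h2 using h1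
  have hne (σ v) (hv : v ≠ 0) : R σ v ≠ 0 := (h2 σ v hv).1
  have hpt (σ v) (hv : v ≠ 0) : galAut h σ⁻¹ (pt v hv) = pt (R σ v) (hne σ v hv) := (h2 σ v hv).2
  refine ⟨⟨R, fun σ c v ↦ hR σ c v, hne, fun σ τ v ↦ ?_, fun v ↦ ?_⟩, fun σ v hv ↦
    ⟨hne σ v hv, hpt σ v hv⟩⟩
  · by_cases hv : v = 0
    · exact ⟨0, by simp [hv]⟩
    rw [← pt_eq_pt_iff (hne _ _ (hne _ _ hv)) (hne _ _ hv)]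
    refine Eq.trans ?_ (hpt _ _ hv)
    refine (hpt _ _ (hne _ _ hv)).symm.trans ?_
    refine (congrArg (galAut h σ⁻¹) (hpt _ _ hv).symm).trans ?_
    rw [mul_inv_rev, galAut_mul]
    rfl
  · by_cases hv : v = 0
    · exact ⟨⊥, inferInstance, fun σ _ ↦ ⟨0, by simp [hv]⟩⟩
    obtain ⟨L, hL, h3⟩ := exists_fixing_galAut h (isClosed_pt v hv)
    refine ⟨L, hL, fun σ hσ ↦ ?_⟩
    rw [← pt_eq_pt_iff hv (hne _ _ hv)]
    exact (h3 σ hσ).symm.trans (hpt _ _ hv)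

/-- If the Galois group acts on projective space through the coefficients, the form is trivial. -/
lemma exists_iso_of_galAut_pt [CharZero K] [IsAlgClosed k] [Algebra.IsAlgebraic K k]
    [IsSeparated f]
    (h : IsPullback q (projStr k n) f (Spec.map (CommRingCat.ofHom (algebraMap K k))))
    (hfix : ∀ (σ : k ≃ₐ[K] k) v hv hv', galAut h σ⁻¹ (pt v hv) = pt (fun i ↦ σ (v i)) hv') :
    ∃ φ : S ≅ Proj (grading K n), φ.hom ≫ projStr K n = f := by
  refine exists_iso_of_galAut_eq h (isPullback_coeffMap K k n) fun σ ↦ ?_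
  have h1 : galAut (isPullback_coeffMap K k n) σ = coeffMap n (σ : k ≃+* k).toRingHom := by
    apply (isPullback_coeffMap K k n).hom_ext
    · rw [galAut_fst, ← coeffMap_comp]
      congr 1
      ext x
      exact (σ.commutes x).symm
    · rw [galAut_snd, coeffMap_projStr]
  rw [h1]
  -- The semilinear maps `galAut h σ` and `coeffMap n σ` differ by a linear endomorphism, which is
  -- the identity on closed points.
  have h2 : coeffMap n (σ : k ≃+* k).toRingHom ≫ galAut h σ⁻¹ = 𝟙 _ := by
    refine eq_id_of_apply_pt ?_ fun v hv ↦ ?_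
    · rw [Category.assoc, galAut_snd, ← Category.assoc, coeffMap_projStr, Category.assoc,
        ← Spec.map_comp, ← CommRingCat.ofHom_comp]
      have h3 : (σ : k ≃+* k).toRingHom.comp ((σ⁻¹ : k ≃ₐ[K] k) : k ≃+* k).toRingHom =
          RingHom.id k := RingHom.ext fun x ↦ σ.apply_symm_apply x
      rw [h3]
      exact (congrArg (projStr k n ≫ ·) (Spec.map_id _)).trans (Category.comp_id _)
    · have hv' : (fun i ↦ (σ : k ≃+* k).symm (v i)) ≠ 0 := fun h0 ↦ hv <| by
        ext i
        have := congrFun h0 i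
        simpa using this
      have h4 : (fun i ↦ σ ((σ : k ≃+* k).symm (v i))) = v := by
        ext i
        exact σ.apply_symm_apply _
      have h5 := hfix σ _ hv' (by rw [h4]; exact hv)
      have h6 := coeffMap_pt (σ : k ≃+* k) hv hv'
      refine (congrArg (galAut h σ⁻¹) h6).trans (h5.trans ?_)
      congr 1
  calc galAut h σ = (coeffMap n (σ : k ≃+* k).toRingHom ≫ galAut h σ⁻¹) ≫ galAut h σ := by
        rw [h2, Category.id_comp]
    _ = _ := by rw [Category.assoc, ← galAut_mul, inv_mul_cancel, galAut_one, Category.comp_id]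

/-- The scalar extension of a form of projective space, in other coordinates. -/
lemma isPullback_comp {l l' : Proj (grading k n) ⟶ Proj (grading k n)} (hl : l ≫ l' = 𝟙 _)
    (hl' : l' ≫ l = 𝟙 _) (hlk : l ≫ projStr k n = projStr k n)
    (h : IsPullback q (projStr k n) f (Spec.map (CommRingCat.ofHom (algebraMap K k)))) :
    IsPullback (l ≫ q) (projStr k n) f (Spec.map (CommRingCat.ofHom (algebraMap K k))) :=
  h.of_iso ⟨l', l, hl', hl⟩ (Iso.refl _) (Iso.refl _) (Iso.refl _)
    (by simp [reassoc_of% hl'])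
    ((Category.comp_id _).trans (by
      have := congrArg (l' ≫ ·) hlk
      simp only [reassoc_of% hl'] at this
      exact this)) (by simp) (by simp)

/-- Châtelet's theorem: a form of projective space with a rational point is trivial. The rational
point, seen as a Galois-invariant geometric point, makes the projective Galois representation
linear; in a basis of invariant vectors the Galois group then acts through the coordinates. -/
theorem exists_iso_of_fixed_pt {q : Proj (grading k (n + 1)) ⟶ S} [CharZero K] [IsAlgClosed k]
    [Algebra.IsAlgebraic K k] [LocallyOfFiniteType f] [IsSeparated f]
    (h : IsPullback q (projStr k (n + 1)) f (Spec.map (CommRingCat.ofHom (algebraMap K k))))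
    {w : Fin (n + 1 + 1) → k} (hw : w ≠ 0) (hfix : ∀ σ, galAut h σ⁻¹ (pt w hw) = pt w hw) :
    ∃ φ : S ≅ Proj (grading K (n + 1)), φ.hom ≫ projStr K (n + 1) = f := by
  obtain ⟨ρ, hρ⟩ := exists_projectiveAction h
  obtain ⟨ρ', hρ'⟩ := ρ.exists_semilinearAction hw fun σ ↦ by
    obtain ⟨hv', h1⟩ := hρ σ w hw
    exact (pt_eq_pt_iff hw hv').mp ((hfix σ).symm.trans h1)
  obtain ⟨b₀, hb₀⟩ := ρ'.exists_basis
  let b := b₀.reindex (finCongr (Module.finrank_fin_fun k))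
  have hb (σ i) : ρ'.act σ (b i) = b i := by
    rw [Module.Basis.reindex_apply, hb₀]
  -- The coordinate change `l` carries the standard basis to the basis of invariant vectors.
  let A := (Pi.basisFun k (Fin (n + 1 + 1))).toMatrix b
  let B := b.toMatrix (Pi.basisFun k (Fin (n + 1 + 1)))
  have hA (v) : A.mulVec v = ∑ i, v i • b i := by
    ext j
    simp [A, Matrix.mulVec, dotProduct, Module.Basis.toMatrix_apply, mul_comm]
  have hAB : A * B = 1 := Module.Basis.toMatrix_mul_toMatrix_flip _ _
  have hBA : B * A = 1 := Module.Basis.toMatrix_mul_toMatrix_flip _ _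
  have hA0 (v) (hv : v ≠ 0) : A.mulVec v ≠ 0 := fun h0 ↦ hv <| by
    rw [← Matrix.one_mulVec v, ← hBA, ← Matrix.mulVec_mulVec, h0, Matrix.mulVec_zero]
  obtain ⟨l, l', hl, hl', hlk, hpt⟩ := exists_coordinateChange hAB hBA
  have h1 := isPullback_comp hl hl' hlk h
  have h2 (σ) : galAut h1 σ ≫ l = l ≫ galAut h σ := by
    apply h.hom_ext
    · rw [Category.assoc, galAut_fst, Category.assoc, galAut_fst]
    · rw [Category.assoc, hlk, galAut_snd, Category.assoc, galAut_snd, reassoc_of% hlk]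
  refine exists_iso_of_galAut_pt h1 fun σ v hv hv' ↦ ?_
  have hinj : Function.Injective l := fun x y hxy ↦ by
    have := congrArg l' hxy
    rw [← Scheme.Hom.comp_apply, ← Scheme.Hom.comp_apply, hl] at this
    simpa using this
  apply hinj
  have h3 (x) : l (galAut h1 σ⁻¹ x) = galAut h σ⁻¹ (l x) := by
    rw [← Scheme.Hom.comp_apply, h2, Scheme.Hom.comp_apply]
  refine (h3 _).trans ?_
  refine (congrArg (galAut h σ⁻¹) (hpt v hv (hA0 v hv))).trans ?_
  refine Eq.trans ?_ (hpt _ hv' (hA0 _ hv')).symm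
  obtain ⟨hv₁, h4⟩ := hρ σ _ (hA0 v hv)
  refine h4.trans (Eq.symm ?_)
  refine (pt_eq_pt_iff _ _).mpr ?_
  obtain ⟨c, hc, h5⟩ := hρ' σ
  refine ⟨c, ?_⟩
  rw [h5, hA, hA, map_sum]
  simp only [ρ'.act_smul, hb]

end Chatelet

/-! ### Groups partitioned by the stabilizers of triples -/

section GroupTheory

open MulAction Pointwise

/-- The arithmetic behind the class equation of a group partitioned by conjugacy classes of
subgroups: a class of `k` subgroups of order `h` with normalizers of order `e * h` covers
`k * (h - 1)` nontrivial elements. With `n` the order of the group, a class with `e = 1` covers at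
least `2 * n / 3` of these and one with `e = 3` at least `2 * n / 9`, so that there are at most four
classes and few cases remain. -/
lemma false_of_class_equation {Q : Type*} [Fintype Q] {n : ℕ} (hn : 2 ≤ n) (k h e : Q → ℕ)
    (hk : ∀ ω, k ω * (e ω * h ω) = n) (hk2 : ∀ ω, 2 ≤ k ω)
    (he : ∀ ω, e ω = 1 ∧ (h ω = 3 ∨ 5 ≤ h ω) ∨ e ω = 3 ∧ (h ω = 3 ∨ 7 ≤ h ω))
    (hsum : ∑ ω, k ω * (h ω - 1) = n - 1) : False := by
  classical
  have key (ω) : (e ω = 1 ∧ k ω * (h ω - 1) + k ω = n ∧ (3 * k ω = n ∨ 5 * k ω ≤ n)) ∨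
      (e ω = 3 ∧ 3 * (k ω * (h ω - 1)) + 3 * k ω = n ∧ (9 * k ω = n ∨ 21 * k ω ≤ n)) := by
    obtain ⟨a, ha⟩ : ∃ a, h ω = a + 1 := ⟨h ω - 1, by have := he ω; omega⟩
    have h1 := hk ω
    have h2 := he ω
    rw [ha] at h1 h2 ⊢
    rw [Nat.add_sub_cancel]
    rcases h2 with ⟨h2, h3⟩ | ⟨h2, h3⟩
    · refine .inl ⟨h2, by rw [← h1, h2]; ring, ?_⟩
      rcases h3 with h3 | h3
      · exact .inl (by rw [← h1, h2, h3]; ring)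
      · exact .inr (by rw [← h1, h2]; nlinarith)
    · refine .inr ⟨h2, by rw [← h1, h2]; ring, ?_⟩
      rcases h3 with h3 | h3
      · exact .inl (by rw [← h1, h2, h3]; ring)
      · exact .inr (by rw [← h1, h2]; nlinarith)
  generalize hT : (fun ω ↦ k ω * (h ω - 1)) = T at *
  have hT' (ω) : k ω * (h ω - 1) = T ω := congrFun hT ω
  simp only [hT'] at key hsum
  -- Here `T ω` is the number of nontrivial elements covered by the class `ω`.
  have hbound (ω) : 2 * n ≤ 9 * T ω := by have := key ω; omega
  -- A class with `e = 1` leaves room for at most one other class; if all classes have `e = 3`,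
  -- there are exactly four of them, and comparing their numbers of subgroups leads to a class with
  -- `k = 1`.
  by_cases hex : ∃ ω, e ω = 1
  · obtain ⟨ω₀, h₀⟩ := hex
    have h1 := Finset.add_sum_erase Finset.univ T (Finset.mem_univ ω₀)
    rw [hsum] at h1
    have h2 : (Finset.univ.erase ω₀).card * (2 * n) ≤ 9 * ∑ ω ∈ Finset.univ.erase ω₀, T ω := by
      rw [Finset.mul_sum, ← smul_eq_mul]
      exact Finset.card_nsmul_le_sum _ _ _ fun ω _ ↦ hbound ω
    have h3 := key ω₀
    have h4 := hk2 ω₀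
    have h5 : (Finset.univ.erase ω₀).card ≤ 1 := by
      by_contra hc
      have : 2 * (2 * n) ≤ (Finset.univ.erase ω₀).card * (2 * n) :=
        Nat.mul_le_mul_right _ (by omega)
      omega
    have : Nonempty Q := ⟨ω₀⟩
    rcases Finset.card_le_one_iff_subset_singleton.mp h5 with ⟨ω₁, h6⟩
    rcases Finset.subset_singleton_iff.mp h6 with h7 | h7
    · rw [h7, Finset.sum_empty] at h1
      omega
    · rw [h7, Finset.sum_singleton] at h1
      have := key ω₁
      have := hk2 ω₁
      omega
  · push Not at hex
    have h1 : ∑ ω, (3 * T ω + 3 * k ω) = Fintype.card Q * n := by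
      rw [← smul_eq_mul, ← Finset.card_univ, ← Finset.sum_const]
      exact Finset.sum_congr rfl fun ω _ ↦ by have := key ω; have := hex ω; omega
    rw [Finset.sum_add_distrib, ← Finset.mul_sum, ← Finset.mul_sum, hsum] at h1
    have h2 : Fintype.card Q * (2 * n) ≤ 9 * ∑ ω, T ω := by
      rw [Finset.mul_sum, ← smul_eq_mul, ← Finset.card_univ]
      exact Finset.card_nsmul_le_sum _ _ _ fun ω _ ↦ hbound ω
    have h3 : Fintype.card Q * 2 ≤ ∑ ω, k ω := by
      rw [← smul_eq_mul, ← Finset.card_univ]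
      exact Finset.card_nsmul_le_sum _ _ _ fun ω _ ↦ hk2 ω
    rw [hsum] at h2
    have h4 : Fintype.card Q ≤ 4 := by
      by_contra hc
      have : 5 * (2 * n) ≤ Fintype.card Q * (2 * n) := Nat.mul_le_mul_right _ (by omega)
      omega
    have h5 : Fintype.card Q = 4 := by
      by_contra hc
      have : Fintype.card Q * n ≤ 3 * n := Nat.mul_le_mul_right _ (by omega)
      rcases Nat.eq_zero_or_pos (Fintype.card Q) with h0 | h0
      · rw [h0] at h1
        omega
      · omega
    let E := (Fintype.equivFinOfCardEq h5).symm
    rw [h5, ← E.sum_comp, Fin.sum_univ_four] at h1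
    have k0 := key (E 0)
    have k1 := key (E 1)
    have k2 := key (E 2)
    have k3 := key (E 3)
    have e0 := hex (E 0)
    have e1 := hex (E 1)
    have e2 := hex (E 2)
    have e3 := hex (E 3)
    have l0 := hk2 (E 0)
    have l1 := hk2 (E 1)
    have l2 := hk2 (E 2)
    have l3 := hk2 (E 3)
    omega

variable {G : Type*} [Group G] [Finite G]

/-- If a group `N` of order `15` normalizes a subgroup `H` of order `5`, then an element of order
`3` of `N` centralizes `H`. Its product `u` with a generator of `H` has order `15`, and `u ^ 6` lies
in `H` while `u ^ 10` does not. -/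
lemma exists_pow_of_card_eq_fifteen {H N : Subgroup G} (hHN : N ≤ Subgroup.normalizer (H : Set G))
    (hH : Nat.card H = 5) (hN : Nat.card N = 15) : ∃ u : G, u ^ 6 ∈ H ∧ u ^ 6 ≠ 1 ∧ u ^ 10 ∉ H := by
  have : Fact (Nat.Prime 5) := ⟨by norm_num⟩
  have : Fact (Nat.Prime 3) := ⟨by norm_num⟩
  have : IsCyclic H := isCyclic_of_prime_card hH
  obtain ⟨⟨t, htN⟩, ht⟩ := exists_prime_orderOf_dvd_card' (G := N) 3 (by rw [hN]; norm_num)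
  obtain ⟨⟨g, hgH⟩, hg⟩ := exists_prime_orderOf_dvd_card' (G := H) 5 (by rw [hH])
  rw [Subgroup.orderOf_mk] at ht hg
  -- Conjugation by `t` is an automorphism of order dividing `3` of a cyclic group of order `5`,
  -- whose automorphism group has order `4`.
  have hcomm : t * g = g * t := by
    let φ := H.normalizerMonoidHom.comp (Subgroup.inclusion hHN)
    have h1 : orderOf (φ ⟨t, htN⟩) ∣ 3 := by
      rw [← ht, ← Subgroup.orderOf_mk t htN]
      exact orderOf_map_dvd _ _
    have h2 : orderOf (φ ⟨t, htN⟩) ∣ 4 := by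
      have := orderOf_dvd_natCard (φ ⟨t, htN⟩)
      rwa [IsCyclic.card_mulAut, hH, Nat.totient_prime (by norm_num)] at this
    have h3 : φ ⟨t, htN⟩ = 1 := orderOf_eq_one_iff.mp (Nat.dvd_one.mp (Nat.dvd_gcd h1 h2))
    have h4 := congrArg Subtype.val (DFunLike.congr_fun h3 ⟨g, hgH⟩)
    have h5 : t * g * t⁻¹ = g := h4
    rw [← mul_inv_eq_iff_eq_mul, h5]
  have hc : Commute g t := hcomm.symm
  have hg5 : g ^ 5 = 1 := by rw [← hg, pow_orderOf_eq_one]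
  have ht3 : t ^ 3 = 1 := by rw [← ht, pow_orderOf_eq_one]
  have h6 : (g * t) ^ 6 = g := by
    rw [hc.mul_pow, show g ^ 6 = g ^ 5 * g by group, show t ^ 6 = (t ^ 3) ^ 2 by group, hg5, ht3]
    simp
  have h10 : (g * t) ^ 10 = t := by
    rw [hc.mul_pow, show g ^ 10 = (g ^ 5) ^ 2 by group, show t ^ 10 = (t ^ 3) ^ 3 * t by group,
      hg5, ht3]
    simp
  refine ⟨g * t, by rwa [h6], ?_, ?_⟩
  · rw [h6]
    rintro rfl
    simp at hg
  · rw [h10]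
    intro htH
    have := orderOf_dvd_natCard (⟨t, htH⟩ : H)
    rw [Subgroup.orderOf_mk, ht, hH] at this
    omega

/-- If a finite group without involutions acts so that the sets of fixed points of the nontrivial
elements have three elements and are equal or disjoint, then one of these sets is invariant.

The pointwise stabilizers `H` of these triples partition the group. If `E` is the stabilizer of a
triple as a set, then the index of `H` in `E` is the size of an orbit in the triple, hence one or
three because the group has odd order. If no triple is invariant, counting the nontrivial elements
by conjugacy classes of the subgroups `H` contradicts `false_of_class_equation`. -/
theorem exists_invariant_fixedBy [Nontrivial G] {X : Type*} [MulAction G X]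
    (h3 : ∀ g : G, g ≠ 1 → (fixedBy X g).ncard = 3)
    (heq : ∀ g g' : G, g ≠ 1 → g' ≠ 1 → ∀ x : X, g • x = x → g' • x = x →
      fixedBy X g = fixedBy X g')
    (h2 : ∀ g : G, orderOf g ≠ 2) :
    ∃ g : G, g ≠ 1 ∧ ∀ (a : G) (x : X), g • x = x → g • a • x = a • x := by
  classical
  by_contra! hcon
  have := Fintype.ofFinite G
  have hconj (a g : G) (x : X) : (a * g * a⁻¹) • a • x = a • x ↔ g • x = x := by
    rw [mul_smul, mul_smul, inv_smul_smul, smul_left_cancel_iff]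
  have hfix (a g : G) : a • fixedBy X g = fixedBy X (a * g * a⁻¹) := by
    ext x
    rw [Set.mem_smul_set_iff_inv_smul_mem, mem_fixedBy, mem_fixedBy, ← hconj a, smul_inv_smul]
  have hodd : ¬ 2 ∣ Nat.card G := fun hd ↦ by
    have : Fact (Nat.Prime 2) := ⟨Nat.prime_two⟩
    obtain ⟨g, hg⟩ := exists_prime_orderOf_dvd_card' 2 hd
    exact h2 g hg
  -- The sets of fixed points, which index the subgroups partitioning `G`.
  let Y := {O : Set X // ∃ g : G, g ≠ 1 ∧ fixedBy X g = O}
  let F (g : {g : G // g ≠ 1}) : Y := ⟨fixedBy X g.1, g.1, g.2, rfl⟩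
  have hF : Function.Surjective F := fun ⟨O, g, hg, h⟩ ↦ ⟨⟨g, hg⟩, Subtype.ext h⟩
  have : Finite Y := Finite.of_surjective F hF
  let := Fintype.ofFinite Y
  let : MulAction G Y :=
    { smul := fun a O ↦ ⟨a • O.1, by
        obtain ⟨g, hg, h⟩ := O.2
        exact ⟨a * g * a⁻¹, by simpa using hg, by rw [← hfix, h]⟩⟩
      one_smul := fun O ↦ Subtype.ext (one_smul G O.1)
      mul_smul := fun a b O ↦ Subtype.ext (mul_smul a b O.1) }
  have hsmul (a : G) (O : Y) : (a • O).1 = a • O.1 := rfl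
  let H (O : Y) : Subgroup G := fixingSubgroup G O.1
  have hmem (O : Y) (g : G) : g ∈ H O ↔ ∀ x ∈ O.1, g • x = x := mem_fixingSubgroup_iff G
  have hcard (O : Y) : O.1.ncard = 3 := by
    obtain ⟨g, hg, h⟩ := O.2
    rw [← h, h3 g hg]
  have hne (O : Y) : O.1.Nonempty := Set.nonempty_of_ncard_ne_zero (by rw [hcard]; norm_num)
  have hpt (O : Y) (x : X) (hx : x ∈ O.1) (g : G) (hg : g ≠ 1) (hgx : g • x = x) :
      fixedBy X g = O.1 := by
    obtain ⟨g', hg', h⟩ := O.2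
    rw [← h]
    rw [← h] at hx
    exact heq g g' hg hg' x hgx hx
  have hmem' (O : Y) (g : G) (hg : g ≠ 1) : g ∈ H O ↔ fixedBy X g = O.1 := by
    rw [hmem]
    constructor
    · intro h
      obtain ⟨x, hx⟩ := hne O
      exact hpt O x hx g hg (h x hx)
    · intro h x hx
      rw [← h] at hx
      exact hx
  have hHconj (a : G) (O : Y) (g : G) : a * g * a⁻¹ ∈ H (a • O) ↔ g ∈ H O := by
    by_cases hg : g = 1
    · simp [hg, one_mem]
    rw [hmem' O g hg, hmem' (a • O) _ (by simpa using hg), ← hfix, hsmul]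
    exact smul_left_cancel_iff a
  have hHcard (a : G) (O : Y) : Nat.card (H (a • O)) = Nat.card (H O) := by
    refine (Nat.card_congr (((MulAut.conj a).toEquiv).subtypeEquiv fun g ↦ ?_)).symm
    exact (hHconj a O g).symm
  have hle (O : Y) : H O ≤ stabilizer G O := fun g hg ↦ by
    rw [mem_stabilizer_iff]
    apply Subtype.ext
    rw [hsmul]
    ext x
    have := inv_mem hg
    rw [hmem] at this hg
    rw [Set.mem_smul_set_iff_inv_smul_mem]
    constructor
    · intro h
      have h1 := hg _ h
      rw [smul_inv_smul] at h1
      rwa [← h1] at h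
    · intro h
      rwa [this x h]
  have hnorm (O : Y) : stabilizer G O ≤ Subgroup.normalizer (H O : Set G) := fun a ha ↦ by
    rw [Subgroup.mem_normalizer_iff]
    intro g
    have := hHconj a O g
    rw [mem_stabilizer_iff.mp ha] at this
    exact this.symm
  have hindex (O : Y) : Nat.card (stabilizer G O) ≤ 3 * Nat.card (H O) := by
    obtain ⟨x, hx⟩ := hne O
    have h1 := Nat.card_congr (orbitProdStabilizerEquivGroup (stabilizer G O) x)
    rw [Nat.card_prod] at h1
    rw [← h1]
    refine Nat.mul_le_mul ?_ ?_
    · rw [← hcard O]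
      refine Set.ncard_le_ncard ?_ (Set.finite_of_ncard_ne_zero (by rw [hcard]; norm_num))
      rintro _ ⟨⟨a, ha⟩, rfl⟩
      have h2 : a • x ∈ a • O.1 := Set.smul_mem_smul_set hx
      rwa [← hsmul, mem_stabilizer_iff.mp ha] at h2
    · refine Nat.card_le_card_of_injective (fun a : stabilizer (stabilizer G O) x ↦
        (⟨a.1.1, ?_⟩ : H O)) fun a b hab ↦ Subtype.ext (Subtype.ext
        (congrArg (fun z : H O ↦ (z : G)) hab))
      by_cases ha : a.1.1 = 1
      · rw [ha]; exact one_mem _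
      rw [hmem' O _ ha]
      exact hpt O x hx _ ha a.2
  let Q := orbitRel.Quotient G Y
  let : Fintype Q := Fintype.ofFinite Q
  let h (ω : Q) : ℕ := Nat.card (H ω.out)
  let e (ω : Q) : ℕ := Nat.card (stabilizer G ω.out) / h ω
  let k (ω : Q) : ℕ := Nat.card (orbit G ω.out)
  have hh (O : Y) : Nat.card (H O) = h ⟦O⟧ := by
    obtain ⟨a, ha⟩ := (orbitRel_apply (G := G)).mp (Quotient.mk_out (s := orbitRel G Y) O)
    change _ = Nat.card (H (Quotient.out _))
    rw [← ha]
    exact (hHcard a O).symm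
  have hdvd (O : Y) : Nat.card (H O) ∣ Nat.card (stabilizer G O) := Subgroup.card_dvd_of_le (hle O)
  have hkn (ω : Q) : k ω * (e ω * h ω) = Nat.card G := by
    rw [Nat.div_mul_cancel (hdvd _)]
    have h1 := Nat.card_congr (orbitProdStabilizerEquivGroup G ω.out)
    rwa [Nat.card_prod] at h1
  have hodd_e (ω : Q) : ¬ 2 ∣ e ω := fun hd ↦ hodd (by
    rw [← hkn ω]; exact Dvd.dvd.mul_left (Dvd.dvd.mul_right hd _) _)
  have hodd_h (ω : Q) : ¬ 2 ∣ h ω := fun hd ↦ hodd (by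
    rw [← hkn ω]; exact Dvd.dvd.mul_left (Dvd.dvd.mul_left hd _) _)
  have he3 (ω : Q) : e ω ≤ 3 := Nat.div_le_of_le_mul (by rw [mul_comm]; exact hindex _)
  have hone (ω : Q) : h ω ≠ 1 := fun h1 ↦ by
    obtain ⟨⟨g, hg⟩, hgO⟩ := hF ω.out
    have h2 : g ∈ H ω.out := (hmem' _ g hg).mpr (congrArg Subtype.val hgO)
    rw [Subgroup.card_eq_one.mp h1] at h2
    exact hg h2
  refine false_of_class_equation (Q := Q) (n := Nat.card G) Finite.one_lt_card k h e hkn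
    (fun ω ↦ ?_) (fun ω ↦ ?_) ?_
  · -- No orbit is a singleton.
    have hk0 : k ω ≠ 0 := fun h0 ↦ by
      have := hkn ω
      rw [h0, zero_mul] at this
      exact Nat.card_pos.ne this
    have hk1 : k ω ≠ 1 := fun h1 ↦ by
      have h2 := hkn ω
      rw [h1, one_mul, Nat.div_mul_cancel (hdvd _)] at h2
      have h3 := Subgroup.eq_top_of_card_eq _ h2
      obtain ⟨⟨g, hg⟩, hgO⟩ := hF ω.out
      obtain ⟨a, x, hx, hax⟩ := hcon g hg
      have ha : a • ω.out = ω.out := mem_stabilizer_iff.mp (h3 ▸ Subgroup.mem_top a)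
      rw [← hgO] at ha
      refine hax ?_
      have h4 : a • x ∈ a • fixedBy X g := Set.smul_mem_smul_set hx
      have h5 : a • fixedBy X g = fixedBy X g := congrArg Subtype.val ha
      rw [h5] at h4
      exact h4
    omega
  · have := he3 ω
    have := hodd_e ω
    have := hodd_h ω
    have := hone ω
    -- All nontrivial powers of `u` have the same fixed points, so `u ^ 6 ∈ H` implies `u ^ 10 ∈ H`.
    have h5 : ¬ (e ω = 3 ∧ h ω = 5) := by
      rintro ⟨he, hh5⟩
      have h1 : Nat.card (stabilizer G ω.out) = 15 := by
        rw [← Nat.div_mul_cancel (hdvd ω.out)]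
        change e ω * h ω = 15
        rw [he, hh5]
      obtain ⟨u, hu, hu1, hu'⟩ := exists_pow_of_card_eq_fifteen (hnorm ω.out) hh5 h1
      have hune : u ≠ 1 := by
        rintro rfl
        simp at hu1
      have hune' : u ^ 10 ≠ 1 := fun h1 ↦ hu' (h1 ▸ one_mem _)
      obtain ⟨x, hx⟩ := hne (F ⟨u, hune⟩)
      have hx1 : u • x = x := hx
      have hpow (m : ℕ) : u ^ m • x = x := by
        induction m with
        | zero => rw [pow_zero, one_smul]
        | succ m ih => rw [pow_succ, mul_smul, hx1, ih]
      rw [hmem' _ _ hu1] at hu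
      refine hu' ((hmem' _ _ hune').mpr ?_)
      rw [← hu]
      exact heq _ _ hune' hu1 x (hpow 10) (hpow 6)
    omega
  · have h1 (ω : Q) : ∑ O : Y with (⟦O⟧ : Q) = ω, (Nat.card (H O) - 1) = k ω * (h ω - 1) := by
      have h3 : (Finset.univ.filter fun O : Y ↦ (⟦O⟧ : Q) = ω).card = k ω := by
        rw [← Set.ncard_coe_finset]
        change _ = (orbit G ω.out).ncard
        congr 1
        ext O
        rw [Finset.coe_filter, Set.mem_ofPred_eq, ← orbitRel_apply]
        refine (and_iff_right (Finset.mem_univ O)).trans ?_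
        conv_lhs => rw [← Quotient.out_eq ω]
        exact Quotient.eq (r := orbitRel G Y)
      rw [← h3]
      refine Finset.sum_const_nat fun O hO ↦ ?_
      rw [hh, (Finset.mem_filter.mp hO).2]
    rw [← Finset.sum_congr rfl fun ω _ ↦ h1 ω, Finset.sum_fiberwise]
    have h4 (O : Y) : (Finset.univ.filter fun g : {g : G // g ≠ 1} ↦ F g = O).card =
        Nat.card (H O) - 1 := by
      have h5 : Nat.card (H O) = (Finset.univ.filter fun g : G ↦ g ∈ H O).card := by
        rw [← Set.ncard_coe_finset, Finset.coe_filter]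
        simp only [Finset.mem_univ, true_and]
        rfl
      rw [h5, ← Finset.card_erase_of_mem (a := 1) (by simp [one_mem])]
      refine Finset.card_bij (fun g _ ↦ g.1) (fun g hg ↦ ?_) (fun g _ g' _ hgg ↦ Subtype.ext hgg)
        fun g hg ↦ ?_
      · simp only [Finset.mem_erase, Finset.mem_filter, Finset.mem_univ, true_and] at hg ⊢
        exact ⟨g.2, (hmem' O g.1 g.2).mpr (congrArg Subtype.val hg)⟩
      · simp only [Finset.mem_erase, Finset.mem_filter, Finset.mem_univ, true_and] at hg
        refine ⟨⟨g, hg.1⟩, ?_, rfl⟩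
        simp only [Finset.mem_filter, Finset.mem_univ, true_and]
        exact Subtype.ext ((hmem' O g hg.1).mp hg.2)
    rw [← Finset.sum_congr rfl fun O _ ↦ h4 O,
      ← Finset.card_eq_sum_card_fiberwise fun g _ ↦ Finset.mem_coe.mpr (Finset.mem_univ _),
      Finset.card_univ, ← Nat.card_eq_fintype_card]
    have h6 := Nat.card_congr (Equiv.sumCompl (fun g : G ↦ g = 1))
    rw [Nat.card_sum] at h6
    have h7 : Nat.card {g : G // g = 1} = 1 := by
      rw [Nat.card_eq_fintype_card, Fintype.card_subtype_eq]
    change Nat.card {g : G // ¬ g = 1} = _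
    omega

end GroupTheory

/-! ### Endomorphisms commuting with a projective representation -/

section Eigenvectors

open Module

variable {K k : Type u} {V : Type*} [Field K] [Field k] [Algebra K k] [AddCommGroup V] [Module k V]

namespace ProjectiveAction

variable (ρ : ProjectiveAction K k V)

/-- An endomorphism commuting with a projective action up to scalars. -/
def Compatible (T : End k V) : Prop :=
  ∀ σ, ∃ c : k, c ≠ 0 ∧ ∀ v, ρ.act σ (T v) = c • T (ρ.act σ v)

/-- A projective action without invariant lines. -/
def NoFixedLine : Prop := ∀ w : V, w ≠ 0 → ∃ σ, ∀ c : k, ρ.act σ w ≠ c • w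

variable {ρ}

/-- A stable subspace is not a line. -/
lemma NoFixedLine.finrank_ne_one (h : ρ.NoFixedLine) {W : Submodule k V}
    (hW : ∀ σ, ∀ v ∈ W, ρ.act σ v ∈ W) : finrank k W ≠ 1 := fun h1 ↦ by
  obtain ⟨w, hw, hspan⟩ := finrank_eq_one_iff'.mp h1
  obtain ⟨σ, hσ⟩ := h w (by simpa using hw)
  obtain ⟨c, hc⟩ := hspan ⟨_, hW σ _ w.2⟩
  exact hσ c (congrArg Subtype.val hc).symm

/-- The endomorphisms commuting with a projective action without invariant lines on a
three-dimensional space behave like elements of a division ring: kernel or image of a nonzero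
singular one would be an invariant line. -/
lemma NoFixedLine.eq_zero_of_apply_eq_zero (h : ρ.NoFixedLine) (h3 : finrank k V = 3)
    {T : End k V} (hT : ρ.Compatible T) {v : V} (hv : v ≠ 0) (hTv : T v = 0) : T = 0 := by
  have : FiniteDimensional k V := FiniteDimensional.of_finrank_pos (by omega)
  have h1 := T.finrank_range_add_finrank_ker
  have h2 := h.finrank_ne_one (W := LinearMap.ker T) fun σ v hv ↦ by
    obtain ⟨c, hc, h4⟩ := hT σ
    have h5 := h4 v
    rw [LinearMap.mem_ker] at hv ⊢
    rw [hv, map_zero] at h5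
    exact (smul_eq_zero_iff_right hc).mp h5.symm
  have h4 := h.finrank_ne_one (W := LinearMap.range T) fun σ v hv ↦ by
    obtain ⟨c, hc, h4⟩ := hT σ
    obtain ⟨w, rfl⟩ := hv
    rw [h4]
    exact Submodule.smul_mem _ _ ⟨_, rfl⟩
  have h5 : finrank k (LinearMap.ker T) ≠ 0 := fun h0 ↦ by
    have : v ∈ LinearMap.ker T := hTv
    rw [Submodule.finrank_eq_zero.mp h0, Submodule.mem_bot] at this
    exact hv this
  have h6 : finrank k (LinearMap.range T) = 0 := by omega
  exact LinearMap.range_eq_bot.mp (Submodule.finrank_eq_zero.mp h6)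

/-- A semilinear map commuting with `M` up to the factor `c` carries a polynomial in `M` with roots
`a` to one with roots `c⁻¹ * σ a`, up to a factor. -/
lemma act_aeval_prod {M : End k V} {σ : k ≃ₐ[K] k} {c : k} (hc : c ≠ 0)
    (hM : ∀ v, ρ.act σ (M v) = c • M (ρ.act σ v)) (s : Finset k) (v : V) :
    ρ.act σ (Polynomial.aeval M (∏ a ∈ s, (Polynomial.X - Polynomial.C a)) v) =
      c ^ s.card • Polynomial.aeval M
        (∏ a ∈ s, (Polynomial.X - Polynomial.C (c⁻¹ * σ a))) (ρ.act σ v) := by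
  classical
  induction s using Finset.induction_on generalizing v with
  | empty => simp
  | insert a s ha ih =>
    rw [Finset.prod_insert ha, Finset.prod_insert ha, Finset.card_insert_of_notMem ha,
      map_mul, map_mul, Module.End.mul_apply, Module.End.mul_apply]
    have h1 (w : V) : ρ.act σ (Polynomial.aeval M (Polynomial.X - Polynomial.C a) w) =
        c • Polynomial.aeval M (Polynomial.X - Polynomial.C (c⁻¹ * σ a)) (ρ.act σ w) := by
      simp only [map_sub, Polynomial.aeval_X, Polynomial.aeval_C, LinearMap.sub_apply,
        Module.algebraMap_end_apply, hM, ρ.act_smul, smul_sub, smul_smul]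
      rw [mul_inv_cancel_left₀ hc]
    rw [h1, ih, map_smul, smul_smul, pow_succ']

/-- The polynomial whose roots form a finite set of scalars that contains an eigenvalue and is
stable under the twisted Galois action `a ↦ c⁻¹ * σ a` annihilates `M`: its value at `M` commutes
with the action up to scalars and kills an eigenvector. -/
lemma NoFixedLine.aeval_prod_eq_zero (h : ρ.NoFixedLine) (h3 : finrank k V = 3) {M : End k V}
    {c : (k ≃ₐ[K] k) → k} (hc : ∀ σ, c σ ≠ 0)
    (hM : ∀ σ v, ρ.act σ (M v) = c σ • M (ρ.act σ v)) {s : Finset k}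
    (hs : ∀ σ, ∀ a ∈ s, (c σ)⁻¹ * σ a ∈ s) {a : k} (ha : a ∈ s) {v : V} (hv : v ≠ 0)
    (hva : M v = a • v) :
    Polynomial.aeval M (∏ a ∈ s, (Polynomial.X - Polynomial.C a)) = 0 := by
  classical
  refine h.eq_zero_of_apply_eq_zero h3 (fun σ ↦ ⟨c σ ^ s.card, pow_ne_zero _ (hc σ), fun w ↦ ?_⟩)
    hv ?_
  · have hinj : Function.Injective fun a ↦ (c σ)⁻¹ * σ a := fun x y hxy ↦
      σ.injective (mul_left_cancel₀ (inv_ne_zero (hc σ)) hxy)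
    have hmap : s.image (fun a ↦ (c σ)⁻¹ * σ a) = s :=
      Finset.eq_of_subset_of_card_le (Finset.image_subset_iff.mpr (hs σ))
        (by rw [Finset.card_image_of_injective _ hinj])
    rw [act_aeval_prod (hc σ) (hM σ)]
    conv_rhs => rw [← hmap, Finset.prod_image hinj.injOn,
      Finset.card_image_of_injective _ hinj]
  · rw [Module.End.aeval_apply_of_hasEigenvector (μ := a)
      ⟨Module.End.mem_eigenspace_iff.mpr hva, hv⟩,
      Polynomial.eval_prod, Finset.prod_eq_zero ha (by simp), zero_smul]

/-- All eigenvalues are among the roots of an annihilating polynomial. -/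
lemma mem_of_aeval_prod_eq_zero {M : End k V} {s : Finset k}
    (h : Polynomial.aeval M (∏ a ∈ s, (Polynomial.X - Polynomial.C a)) = 0) {a : k} {v : V}
    (hv : v ≠ 0) (hva : M v = a • v) : a ∈ s := by
  have h1 := Module.End.aeval_apply_of_hasEigenvector (f := M)
    (p := ∏ a ∈ s, (Polynomial.X - Polynomial.C a)) (μ := a)
    ⟨Module.End.mem_eigenspace_iff.mpr hva, hv⟩
  rw [h, LinearMap.zero_apply, eq_comm, smul_eq_zero_iff_left hv, Polynomial.eval_prod,
    Finset.prod_eq_zero_iff] at h1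
  obtain ⟨b, hb, h2⟩ := h1
  rw [Polynomial.eval_sub, Polynomial.eval_X, Polynomial.eval_C, sub_eq_zero] at h2
  rwa [h2]

/-- The action permutes eigenvectors, changing eigenvalues by `a ↦ c⁻¹ * σ a`. -/
lemma apply_act_eq_smul {M : End k V} {σ : k ≃ₐ[K] k} {c : k} (hc : c ≠ 0)
    (hM : ∀ v, ρ.act σ (M v) = c • M (ρ.act σ v)) {v : V} {a : k} (hva : M v = a • v) :
    M (ρ.act σ v) = (c⁻¹ * σ a) • ρ.act σ v := by
  have h1 := hM v
  rw [hva, ρ.act_smul] at h1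
  rw [mul_smul, h1, inv_smul_smul₀ hc]

/-- The Galois group permutes the eigenvalues transitively. -/
lemma NoFixedLine.exists_act_eigenvector (h : ρ.NoFixedLine) (h3 : finrank k V = 3) {M : End k V}
    (hM : ρ.Compatible M) {v w : V} (hv : v ≠ 0) (hw : w ≠ 0) {a b : k} (hva : M v = a • v)
    (hwb : M w = b • w) : ∃ σ, M (ρ.act σ v) = b • ρ.act σ v := by
  have : FiniteDimensional k V := FiniteDimensional.of_finrank_pos (by omega)
  choose c hc hM using hM
  have hfin : {b : k | ∃ σ, M (ρ.act σ v) = b • ρ.act σ v}.Finite := by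
    refine M.finite_hasEigenvalue.subset ?_
    rintro b ⟨σ, hσ⟩
    exact Module.End.hasEigenvalue_of_hasEigenvector
      ⟨Module.End.mem_eigenspace_iff.mpr hσ, ρ.act_ne_zero σ v hv⟩
  have hstable (τ) (b) (hb : b ∈ hfin.toFinset) : (c τ)⁻¹ * τ b ∈ hfin.toFinset := by
    rw [Set.Finite.mem_toFinset] at hb ⊢
    obtain ⟨σ, hσ⟩ := hb
    refine ⟨τ * σ, ?_⟩
    obtain ⟨d, hd⟩ := ρ.exists_act_mul τ σ v
    rw [hd, map_smul, apply_act_eq_smul (hc τ) (hM τ) hσ, smul_comm]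
  have h1 := h.aeval_prod_eq_zero h3 hc hM hstable (a := (c 1)⁻¹ * (1 : k ≃ₐ[K] k) a)
    (v := ρ.act 1 v) (hfin.mem_toFinset.mpr ⟨1, apply_act_eq_smul (hc 1) (hM 1) hva⟩)
    (ρ.act_ne_zero _ _ hv) (apply_act_eq_smul (hc 1) (hM 1) hva)
  exact hfin.mem_toFinset.mp (mem_of_aeval_prod_eq_zero h1 hw hwb)

/-- The action carries eigenspaces injectively to eigenspaces. -/
lemma finrank_eigenspace_le [FiniteDimensional k V] {M : End k V} {σ : k ≃ₐ[K] k} {c : k}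
    (hc : c ≠ 0) (hM : ∀ v, ρ.act σ (M v) = c • M (ρ.act σ v)) (a : k) :
    finrank k (M.eigenspace a) ≤ finrank k (M.eigenspace (c⁻¹ * σ a)) := by
  let B := finBasis k (M.eigenspace a)
  have h1 : LinearIndependent k fun i ↦ (B i : V) :=
    B.linearIndependent.map' (M.eigenspace a).subtype (Submodule.ker_subtype _)
  have h2 : LinearIndependent k fun i ↦ ρ.act σ (B i : V) :=
    h1.map_of_injective_injective σ.symm (ρ.act σ) (fun r hr ↦ by simpa using hr)
      (fun m hm ↦ by
        by_contra h0
        exact ρ.act_ne_zero _ _ h0 hm)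
      fun r m ↦ by rw [ρ.act_smul, σ.apply_symm_apply]
  have h3 (i) : ρ.act σ (B i : V) ∈ M.eigenspace (c⁻¹ * σ a) :=
    Module.End.mem_eigenspace_iff.mpr
      (apply_act_eq_smul hc hM (Module.End.mem_eigenspace_iff.mp (B i).2))
  have h4 : LinearIndependent k fun i ↦ (⟨_, h3 i⟩ : M.eigenspace (c⁻¹ * σ a)) :=
    LinearIndependent.of_comp (M.eigenspace _).subtype h2
  simpa using h4.fintype_card_le_finrank

/-- If the eigenvalues of a diagonal endomorphism are distinct, its eigenvectors are the multiples
of the basis vectors. -/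
lemma exists_eq_smul_of_apply_eq_smul {ι : Type*} {b : Basis ι k V} {μ : ι → k}
    (hμ : Function.Injective μ) {M : End k V} (hM : ∀ i, M (b i) = μ i • b i) {v : V} (hv : v ≠ 0)
    {a : k} (hva : M v = a • v) : ∃ i, μ i = a ∧ ∃ d : k, v = d • b i := by
  have h1 (i) : μ i * b.repr v i = a * b.repr v i := by
    have h2 : b.repr (M v) i = μ i * b.repr v i := by
      have h3 : (b.coord i).comp M = μ i • b.coord i := b.ext fun j ↦ by
        by_cases hij : i = j
        · subst hij
          simp [hM]
        · simp [hM, Ne.symm hij]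
      exact LinearMap.congr_fun h3 v
    rw [← h2, hva, map_smul, Finsupp.smul_apply, smul_eq_mul]
  obtain ⟨i, hi⟩ : ∃ i, b.repr v i ≠ 0 := by
    by_contra! h0
    exact hv (b.repr.map_eq_zero_iff.mp (Finsupp.ext h0))
  have hai := mul_right_cancel₀ hi (h1 i)
  refine ⟨i, hai, b.repr v i, b.repr.injective (Finsupp.ext fun j ↦ ?_)⟩
  by_cases hij : i = j
  · subst hij
    simp
  · have : b.repr v j = 0 := by
      by_contra h0
      exact hij (hμ (hai.trans (mul_right_cancel₀ h0 (h1 j)).symm))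
    simp [hij, this]

/-- An endomorphism of a three-dimensional space which is not a scalar and commutes up to scalars
with a projective action without invariant lines has exactly three eigenlines, and these are
permuted transitively. By transitivity all eigenspaces have the same dimension, a divisor of three;
if there is just one eigenvalue, the polynomial annihilating `M` shows that `M` is a scalar. -/
theorem NoFixedLine.exists_eigenbasis [IsAlgClosed k] (h : ρ.NoFixedLine) (h3 : finrank k V = 3)
    {M : End k V} (hM : ρ.Compatible M) (hns : ∀ a : k, M ≠ algebraMap k (End k V) a) :
    ∃ (b : Basis (Fin 3) k V) (μ : Fin 3 → k), Function.Injective μ ∧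
      (∀ i, M (b i) = μ i • b i) ∧ ∀ i j, ∃ (σ : k ≃ₐ[K] k) (d : k), ρ.act σ (b i) = d • b j := by
  classical
  have : FiniteDimensional k V := FiniteDimensional.of_finrank_pos (by omega)
  have : Nontrivial V := Module.nontrivial_of_finrank_pos (R := k) (by omega)
  have htrans {v w : V} (hv : v ≠ 0) (hw : w ≠ 0) {a b : k} (hva : M v = a • v)
    (hwb : M w = b • w) := h.exists_act_eigenvector h3 hM hv hw hva hwb
  choose c hc hM using hM
  have hfin := M.finite_hasEigenvalue
  obtain ⟨a, ha⟩ := Module.End.exists_eigenvalue M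
  obtain ⟨v, hva, hv⟩ := ha.exists_hasEigenvector
  rw [Module.End.mem_eigenspace_iff] at hva
  have hstable (σ) (a) (ha : a ∈ hfin.toFinset) : (c σ)⁻¹ * σ a ∈ hfin.toFinset := by
    rw [Set.Finite.mem_toFinset] at ha ⊢
    obtain ⟨v, hva, hv⟩ := Module.End.HasEigenvalue.exists_hasEigenvector ha
    rw [Module.End.mem_eigenspace_iff] at hva
    exact Module.End.hasEigenvalue_of_hasEigenvector
      ⟨Module.End.mem_eigenspace_iff.mpr (apply_act_eq_smul (hc σ) (hM σ) hva),
        ρ.act_ne_zero σ v hv⟩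
  have h1 := h.aeval_prod_eq_zero h3 hc hM hstable (hfin.mem_toFinset.mpr ha) hv hva
  -- A single eigenvalue would make `M` a scalar. Two eigenvalues would have eigenspaces of equal
  -- dimension `m`, which span as `M` is annihilated by a product of two distinct linear factors, so
  -- that `2 * m = 3`.
  have hcard : 3 ≤ hfin.toFinset.card := by
    by_contra hlt
    have hpos := Finset.card_pos.mpr ⟨a, hfin.mem_toFinset.mpr ha⟩
    obtain hc1 | hc2 : hfin.toFinset.card = 1 ∨ hfin.toFinset.card = 2 := by omega
    · obtain ⟨a', ha'⟩ := Finset.card_eq_one.mp hc1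
      rw [ha', Finset.prod_singleton, map_sub, Polynomial.aeval_X, Polynomial.aeval_C,
        sub_eq_zero] at h1
      exact hns a' h1
    · obtain ⟨a₁, a₂, hne, ha'⟩ := Finset.card_eq_two.mp hc2
      have hle {b₁ b₂ : k} (hb₁ : b₁ ∈ hfin.toFinset) (hb₂ : b₂ ∈ hfin.toFinset) :
          finrank k (M.eigenspace b₁) ≤ finrank k (M.eigenspace b₂) := by
        rw [Set.Finite.mem_toFinset] at hb₁ hb₂
        obtain ⟨v₁, hv₁, hv₁'⟩ := Module.End.HasEigenvalue.exists_hasEigenvector hb₁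
        obtain ⟨v₂, hv₂, hv₂'⟩ := Module.End.HasEigenvalue.exists_hasEigenvector hb₂
        rw [Module.End.mem_eigenspace_iff] at hv₁ hv₂
        obtain ⟨σ, hσ⟩ := htrans hv₁' hv₂' hv₁ hv₂
        have h4 := apply_act_eq_smul (hc σ) (hM σ) hv₁
        rw [hσ] at h4
        rw [smul_left_injective k (ρ.act_ne_zero σ _ hv₁') h4]
        exact finrank_eigenspace_le (hc σ) (hM σ) b₁
      have h4 := hle (b₁ := a₁) (b₂ := a₂) (by simp [ha']) (by simp [ha'])
      have h5 := hle (b₁ := a₂) (b₂ := a₁) (by simp [ha']) (by simp [ha'])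
      have h6 := Submodule.finrank_add_finrank_le_of_disjoint
        (M.eigenspaces_iSupIndep.pairwiseDisjoint hne)
      have h7 := (M - a₂ • (1 : End k V)).finrank_range_add_finrank_ker
      rw [← Module.End.eigenspace_def] at h7
      have h8 : LinearMap.range (M - a₂ • (1 : End k V)) ≤ M.eigenspace a₁ := by
        rintro _ ⟨w, rfl⟩
        rw [ha', Finset.prod_pair hne, map_mul, map_sub, map_sub, Polynomial.aeval_X,
          Polynomial.aeval_C, Polynomial.aeval_C, Algebra.algebraMap_eq_smul_one,
          Algebra.algebraMap_eq_smul_one] at h1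
        rw [Module.End.eigenspace_def, LinearMap.mem_ker]
        exact LinearMap.congr_fun h1 w
      have h9 := Submodule.finrank_mono h8
      omega
  obtain ⟨t, ht, htc⟩ := Finset.exists_subset_card_eq hcard
  let e := (Finset.equivFinOfCardEq htc).symm
  have hev (i : Fin 3) : M.HasEigenvalue (e i) := hfin.mem_toFinset.mp (ht (e i).2)
  choose w hw using fun i ↦ (hev i).exists_hasEigenvector
  have hinj : Function.Injective fun i ↦ (e i : k) := Subtype.val_injective.comp e.injective
  have hli := Module.End.eigenvectors_linearIndependent' M _ hinj w hw
  let b := basisOfLinearIndependentOfCardEqFinrank hli (by rw [h3, Fintype.card_fin])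
  have hb (i) : b i = w i := by simp [b]
  have hMb (i) : M (b i) = (e i : k) • b i := by
    rw [hb]
    exact (hw i).apply_eq_smul
  refine ⟨b, fun i ↦ e i, hinj, hMb, fun i j ↦ ?_⟩
  obtain ⟨σ, hσ⟩ := htrans (b.ne_zero i) (b.ne_zero j) (hMb i) (hMb j)
  obtain ⟨l, hl, d, hd⟩ :=
    exists_eq_smul_of_apply_eq_smul hinj hMb (ρ.act_ne_zero σ _ (b.ne_zero i)) hσ
  rw [hinj hl] at hd
  exact ⟨σ, d, hd⟩

variable (ρ)

/-- The neutral element acts by a scalar. -/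
lemma exists_smul_act_one : ∃ c : k, ∀ v, v = c • ρ.act 1 v := by
  obtain ⟨c, hc⟩ := ρ.exists_act_mul_eq 1 1
  refine ⟨c, fun v ↦ ρ.act_injective 1 ?_⟩
  rw [ρ.act_smul]
  have := hc v
  rwa [one_mul] at this

lemma act_bijective (σ : k ≃ₐ[K] k) : Function.Bijective (ρ.act σ) := by
  refine ⟨ρ.act_injective σ, fun v ↦ ?_⟩
  obtain ⟨c, hc⟩ := ρ.exists_smul_act_one
  obtain ⟨d, hd⟩ := ρ.exists_act_mul_eq σ σ⁻¹
  refine ⟨σ.symm (c * d) • ρ.act σ⁻¹ v, ?_⟩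
  rw [ρ.act_smul, σ.apply_symm_apply, mul_smul, ← hd, mul_inv_cancel, ← hc]

/-- Conjugation of an endomorphism by a semilinear map of a projective action. -/
noncomputable def conjEnd (σ : k ≃ₐ[K] k) (M : End k V) : End k V where
  toFun v := ρ.act σ (M ((AddEquiv.ofBijective _ (ρ.act_bijective σ)).symm v))
  map_add' v w := by simp only [map_add]
  map_smul' a v := by
    have h1 : (AddEquiv.ofBijective _ (ρ.act_bijective σ)).symm (a • v) =
        σ.symm a • (AddEquiv.ofBijective _ (ρ.act_bijective σ)).symm v := by
      rw [AddEquiv.symm_apply_eq]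
      change a • v = ρ.act σ (σ.symm a • _)
      rw [ρ.act_smul, σ.apply_symm_apply]
      congr 1
      exact ((AddEquiv.ofBijective _ (ρ.act_bijective σ)).apply_symm_apply v).symm
    rw [h1, map_smul, ρ.act_smul, σ.apply_symm_apply, RingHom.id_apply]

lemma conjEnd_act (σ : k ≃ₐ[K] k) (M : End k V) (v : V) :
    ρ.conjEnd σ M (ρ.act σ v) = ρ.act σ (M v) := by
  change ρ.act σ (M ((AddEquiv.ofBijective _ (ρ.act_bijective σ)).symm _)) = _
  congr 2
  exact (AddEquiv.ofBijective _ (ρ.act_bijective σ)).symm_apply_apply v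

lemma conjEnd_eq_iff {σ : k ≃ₐ[K] k} {M M' : End k V} :
    ρ.conjEnd σ M = M' ↔ ∀ v, ρ.act σ (M v) = M' (ρ.act σ v) := by
  constructor
  · rintro rfl v
    rw [conjEnd_act]
  · intro h
    ext v
    obtain ⟨w, rfl⟩ := (ρ.act_bijective σ).2 v
    rw [conjEnd_act, h]

/-- The semilinear action on endomorphisms induced by a projective action, by conjugation. The
scalars by which the projective action fails to be an action cancel. -/
noncomputable def endAction [FiniteDimensional k V] [Algebra.IsAlgebraic K k] :
    SemilinearAction K k (End k V) where
  act σ :=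
    { toFun := ρ.conjEnd σ
      map_zero' := ρ.conjEnd_eq_iff.mpr fun v ↦ by simp
      map_add' M M' := ρ.conjEnd_eq_iff.mpr fun v ↦ by
        simp only [LinearMap.add_apply, map_add, conjEnd_act] }
  act_smul σ c M := ρ.conjEnd_eq_iff.mpr fun v ↦ by
    change _ = σ c • ρ.conjEnd σ M (ρ.act σ v)
    rw [conjEnd_act, LinearMap.smul_apply, ρ.act_smul]
  act_mul σ τ M := ρ.conjEnd_eq_iff.mpr fun v ↦ by
    change _ = ρ.conjEnd σ (ρ.conjEnd τ M) _
    obtain ⟨d, hd⟩ := ρ.exists_act_mul_eq σ τ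
    rw [hd, hd, map_smul, conjEnd_act, conjEnd_act]
  exists_fixing M := by
    -- An automorphism fixing the lines of the basis vectors and of their sum multiplies all basis
    -- vectors by the same factor, and commutes with `M` if it fixes the entries of its matrix.
    let B := finBasis k V
    choose L hL hfix using fun i ↦ ρ.exists_fixing (B i)
    obtain ⟨L', hL', hfix'⟩ := ρ.exists_fixing (∑ i, B i)
    let s : Set k := Set.range fun p : _ × _ ↦ B.repr (M (B p.1)) p.2
    have : FiniteDimensional K (IntermediateField.adjoin K s) :=
      IntermediateField.finiteDimensional_adjoin fun x _ ↦ Algebra.IsIntegral.isIntegral x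
    refine ⟨(⨆ i, L i) ⊔ L' ⊔ IntermediateField.adjoin K s, inferInstance, fun σ hσ ↦ ?_⟩
    choose c hc using fun i ↦ hfix i σ fun x hx ↦
      hσ x (le_sup_left (α := IntermediateField K k) (le_sup_left (α := IntermediateField K k)
        (le_iSup L i hx)))
    obtain ⟨d, hd⟩ := hfix' σ fun x hx ↦
      hσ x (le_sup_left (α := IntermediateField K k) (le_sup_right (α := IntermediateField K k) hx))
    have hs (i j) : σ (B.repr (M (B i)) j) = B.repr (M (B i)) j :=
      hσ _ (le_sup_right (α := IntermediateField K k)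
        (IntermediateField.subset_adjoin K s ⟨(i, j), rfl⟩))
    have hcd (i) : c i = d := by
      have h1 : ∑ i, (c i - d) • B i = 0 := by
        rw [map_sum, Finset.smul_sum, ← sub_eq_zero, ← Finset.sum_sub_distrib] at hd
        rw [← hd]
        exact Finset.sum_congr rfl fun i _ ↦ by rw [hc, sub_smul]
      exact sub_eq_zero.mp (Fintype.linearIndependent_iff.mp B.linearIndependent _ h1 i)
    have h2 (i) : ρ.act σ (M (B i)) = M (ρ.act σ (B i)) := by
      rw [hc, map_smul, ← B.sum_repr (M (B i)), map_sum, Finset.smul_sum]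
      refine Finset.sum_congr rfl fun j _ ↦ ?_
      rw [ρ.act_smul, hs, hc, smul_comm, hcd, hcd]
    refine B.ext fun i ↦ ?_
    have hci : c i ≠ 0 := fun h0 ↦ ρ.act_ne_zero σ _ (B.ne_zero i) (by rw [hc, h0, zero_smul])
    have h3 : ρ.conjEnd σ M (ρ.act σ (B i)) = M (ρ.act σ (B i)) := by
      rw [conjEnd_act, h2]
    rw [hc, map_smul, map_smul] at h3
    exact smul_right_injective V hci h3

/-- In dimension greater than one there are endomorphisms other than scalars commuting with a
projective action, as the endomorphisms are spanned by the invariant ones. -/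
lemma exists_compatible_ne_algebraMap [FiniteDimensional k V] [Algebra.IsAlgebraic K k]
    [IsAlgClosed k] (hV : 1 < finrank k V) :
    ∃ M : End k V, ρ.Compatible M ∧ ∀ a : k, M ≠ algebraMap k (End k V) a := by
  by_contra! hcon
  have h1 : Submodule.span k {M | ∀ σ, ρ.endAction.act σ M = M} ≤
      Submodule.span k {(1 : End k V)} := by
    rw [Submodule.span_le]
    intro M hM
    obtain ⟨a, ha⟩ := hcon M fun σ ↦ ⟨1, one_ne_zero, fun v ↦ by
      rw [one_smul]
      exact ρ.conjEnd_eq_iff.mp (hM σ) v⟩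
    rw [ha, Algebra.algebraMap_eq_smul_one]
    exact Submodule.smul_mem _ _ (Submodule.mem_span_singleton_self _)
  rw [ρ.endAction.span_invariants] at h1
  have h2 := (Submodule.finrank_mono h1).trans (finrank_span_le_card _)
  rw [finrank_top, finrank_linearMap, Set.toFinset_singleton, Finset.card_singleton] at h2
  nlinarith

end ProjectiveAction
end Eigenvectors

/-! ### Fixed points of automorphisms of forms of projective space -/

section FixedPoints

/-- An automorphism acting trivially on geometric points is trivial. -/
lemma eq_id_of_baseAut_pt {K k : Type u} [Field K] [Field k] [Algebra K k] [IsAlgClosed k] {n : ℕ}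
    {S : Scheme.{u}} {f : S ⟶ Spec (.of K)} {q : Proj (grading k n) ⟶ S}
    {h : IsPullback q (projStr k n) f (Spec.map (CommRingCat.ofHom (algebraMap K k)))}
    {g : S ⟶ S} (hg : g ≫ f = f)
    (hpt : ∀ v hv, baseAut h g hg (pt v hv) = pt v hv) : g = 𝟙 S := by
  have h1 := eq_id_of_apply_pt (baseAut_snd h g hg) hpt
  have := flat_fst h
  have := surjective_fst h
  have := quasiCompact_fst h
  have : Epi q := Flat.epi_of_flat_of_surjective q
  rw [← cancel_epi q, ← baseAut_fst h g hg, h1, Category.id_comp, Category.comp_id]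

open Module

variable {K k : Type u} [Field K] [Field k] [Algebra K k] [IsAlgClosed k] {n : ℕ}
  {S : Scheme.{u}} {f : S ⟶ Spec (.of K)}
  {q : Proj (grading k (n + 1)) ⟶ S}
  {h : IsPullback q (projStr k (n + 1)) f (Spec.map (CommRingCat.ofHom (algebraMap K k)))}
  {ρ : ProjectiveAction K k (Fin (n + 1 + 1) → k)}

/-- An automorphism of a form of projective space acts on geometric points by a linear map which
commutes with the Galois action up to scalars. -/
lemma exists_linear_baseAut [CharZero K]
    (hρ : ∀ σ v hv, ∃ hv', galAut h σ⁻¹ (pt v hv) = pt (ρ.act σ v) hv') {g g' : S ⟶ S}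
    (hg : g ≫ f = f) (hg' : g' ≫ f = f) (h₁ : g ≫ g' = 𝟙 S) (h₂ : g' ≫ g = 𝟙 S) :
    ∃ M : End k (Fin (n + 1 + 1) → k), ρ.Compatible M ∧
      ∀ v hv, ∃ hv', baseAut h g hg (pt v hv) = pt (M v) hv' := by
  have : CharZero k := charZero_of_injective_algebraMap (algebraMap K k).injective
  obtain ⟨R, hR, hpt⟩ := exists_semilinear (ψ := baseAut h g hg) (ψ' := baseAut h g' hg')
    (by rw [← baseAut_comp, ← baseAut_id h]; congr 1)
    (by rw [← baseAut_comp, ← baseAut_id h]; congr 1) (RingEquiv.refl k) (by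
      rw [baseAut_snd]
      exact ((congrArg (projStr k (n + 1) ≫ ·) (Spec.map_id _)).trans (Category.comp_id _)).symm)
  refine ⟨{ R with map_smul' := hR }, fun σ ↦ ?_, hpt⟩
  have hR0 (v) (hv : v ≠ 0) : R v ≠ 0 := (hpt v hv).1
  -- The automorphism commutes with the Galois action on points, so the maps agree up to scalars.
  have hpw (v) : ∃ c : k, ((ρ.act σ).comp R) v = c • (R.comp (ρ.act σ)) v := by
    by_cases hv : v = 0
    · exact ⟨0, by simp [hv]⟩
    refine (pt_eq_pt_iff (hR0 _ (ρ.act_ne_zero σ v hv)) (ρ.act_ne_zero σ _ (hR0 v hv))).mp ?_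
    obtain ⟨_, h1⟩ := hpt v hv
    obtain ⟨_, h2⟩ := hρ σ v hv
    obtain ⟨_, h3⟩ := hpt _ (ρ.act_ne_zero σ v hv)
    obtain ⟨_, h4⟩ := hρ σ _ (hR0 v hv)
    have h5 (x) : baseAut h g hg (galAut h σ⁻¹ x) = galAut h σ⁻¹ (baseAut h g hg x) := by
      rw [← Scheme.Hom.comp_apply, ← baseAut_comp_galAut, Scheme.Hom.comp_apply]
    exact h3.symm.trans ((congrArg (baseAut h g hg) h2.symm).trans ((h5 _).trans
      ((congrArg (galAut h σ⁻¹) h1).trans h4)))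
  obtain ⟨c, hc⟩ := exists_eq_smul_of_forall (σ := (σ : k ≃+* k)) (R := R.comp (ρ.act σ))
    (R' := (ρ.act σ).comp R)
    (fun c v ↦ (congrArg R (ρ.act_smul σ c v)).trans (hR _ _))
    (fun c v ↦ (congrArg (ρ.act σ) (hR c v)).trans (ρ.act_smul _ _ _))
    (fun v hv ↦ hR0 _ (ρ.act_ne_zero σ v hv)) hpw
  refine ⟨c, ?_, hc⟩
  rintro rfl
  obtain ⟨v, hv⟩ := exists_ne (0 : Fin (n + 1 + 1) → k)
  refine ρ.act_ne_zero σ _ (hR0 v hv) ?_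
  have := hc v
  rwa [zero_smul] at this

/-- A form of projective space which is not trivial has no geometric point fixed by the Galois
group. -/
lemma noFixedLine [CharZero K] [Algebra.IsAlgebraic K k] [LocallyOfFiniteType f] [IsSeparated f]
    (hρ : ∀ σ v hv, ∃ hv', galAut h σ⁻¹ (pt v hv) = pt (ρ.act σ v) hv')
    (hS : ∀ φ : S ≅ Proj (grading K (n + 1)), φ.hom ≫ projStr K (n + 1) ≠ f) :
    ρ.NoFixedLine := by
  intro w hw
  by_contra! hcon
  obtain ⟨φ, hφ⟩ := exists_iso_of_fixed_pt h hw fun σ ↦ by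
    obtain ⟨hv', h1⟩ := hρ σ w hw
    exact h1.trans ((pt_eq_pt_iff hw hv').mpr (hcon σ)).symm
  exact hS φ hφ

/-- The three eigenlines of a nonscalar endomorphism commuting with the Galois action up to scalars
are a Galois orbit, that is, the closed points of a fibre of `ℙ² ⟶ S`. -/
lemma exists_eigenbasis_fiber [Algebra.IsAlgebraic K k] (hn : finrank k (Fin (n + 1 + 1) → k) = 3)
    (hρ : ∀ σ v hv, ∃ hv', galAut h σ⁻¹ (pt v hv) = pt (ρ.act σ v) hv') (hno : ρ.NoFixedLine)
    {M : End k (Fin (n + 1 + 1) → k)} (hM : ρ.Compatible M)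
    (hns : ∀ a : k, M ≠ algebraMap k (End k (Fin (n + 1 + 1) → k)) a) :
    ∃ (b : Basis (Fin 3) k (Fin (n + 1 + 1) → k)) (μ : Fin 3 → k), Function.Injective μ ∧
      (∀ i, M (b i) = μ i • b i) ∧ ∀ i (y : ProjectiveSpectrum (grading k (n + 1))),
        IsClosed {(show Proj (grading k (n + 1)) from y)} →
          (q y = q (pt (b i) (b.ne_zero i)) ↔ ∃ j, y = pt (b j) (b.ne_zero j)) := by
  obtain ⟨b, μ, hμ, hb, htrans⟩ := hno.exists_eigenbasis hn hM hns
  refine ⟨b, μ, hμ, hb, fun i y hy ↦ ⟨fun hq ↦ ?_, ?_⟩⟩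
  · obtain ⟨σ, hσ⟩ := exists_galAut_inv_eq h (isClosed_pt _ (b.ne_zero i)) hy hq.symm
    obtain ⟨hv', h1⟩ := hρ σ _ (b.ne_zero i)
    obtain ⟨c, hc, hcM⟩ := hM σ
    obtain ⟨j, -, d, hd⟩ := ProjectiveAction.exists_eq_smul_of_apply_eq_smul hμ hb hv'
      (ProjectiveAction.apply_act_eq_smul hc hcM (hb i))
    refine ⟨j, (hσ.symm.trans h1).trans ?_⟩
    exact ((pt_eq_pt_iff _ _).mpr ⟨d, hd⟩).symm
  · rintro ⟨j, rfl⟩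
    obtain ⟨σ, d, hd⟩ := htrans i j
    obtain ⟨hv', h1⟩ := hρ σ _ (b.ne_zero i)
    have h3 (x) : q (galAut h σ⁻¹ x) = q x := by rw [← Scheme.Hom.comp_apply, galAut_fst]
    have h2 : pt (b j) (b.ne_zero j) = pt _ hv' := (pt_eq_pt_iff _ _).mpr ⟨d, hd⟩
    refine (congrArg q (h2.trans h1.symm)).trans ?_
    exact h3 _

end FixedPoints

/-! ### The pointwise stabilizer of an invariant triple -/

section FixingSubgroup

open MulAction

/-- Under the hypotheses of `exists_invariant_fixedBy`, if moreover elements with a common fixed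
point commute, the elements acting trivially on the invariant set form an abelian normal subgroup of
index one or three. This subgroup is the stabilizer of any point `x` of the invariant set, and its
index is the size of the orbit of `x`. -/
lemma exists_invariant_fixedBy_and_abelian {G : Type*} [Group G] [Finite G] [Nontrivial G]
    {X : Type*} [MulAction G X] (h3 : ∀ g : G, g ≠ 1 → (fixedBy X g).ncard = 3)
    (heq : ∀ g g' : G, g ≠ 1 → g' ≠ 1 → ∀ x : X, g • x = x → g' • x = x →
      fixedBy X g = fixedBy X g')
    (h2 : ∀ g : G, orderOf g ≠ 2)
    (hcomm : ∀ g g' : G, g ≠ 1 → g' ≠ 1 → ∀ x : X, g • x = x → g' • x = x → g * g' = g' * g) :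
    (∃ g : G, g ≠ 1 ∧ ∀ (a : G) (x : X), g • x = x → g • a • x = a • x) ∧
      ((∀ a b : G, a * b = b * a) ∨
        ∃ N : Subgroup G, N.Normal ∧ (∀ a b : N, a * b = b * a) ∧ N.index = 3) := by
  obtain ⟨g, hg, hinv⟩ := exists_invariant_fixedBy h3 heq h2
  refine ⟨⟨g, hg, hinv⟩, ?_⟩
  obtain ⟨x, hx⟩ : (fixedBy X g).Nonempty :=
    Set.nonempty_of_ncard_ne_zero (by rw [h3 g hg]; norm_num)
  have hstab (a : G) (ha : a • x = x) (y : X) (hy : g • y = y) : a • y = y := by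
    by_cases h1 : a = 1
    · rw [h1, one_smul]
    · have : y ∈ fixedBy X a := by
        rw [heq a g h1 hg x ha hx]
        exact hy
      exact this
  have hab (a b : G) (ha : a • x = x) (hb : b • x = x) : a * b = b * a := by
    by_cases h1 : a = 1
    · rw [h1, one_mul, mul_one]
    by_cases h2 : b = 1
    · rw [h2, one_mul, mul_one]
    exact hcomm a b h1 h2 x ha hb
  have hnormal : (stabilizer G x).Normal := ⟨fun a ha c ↦ by
    rw [mem_stabilizer_iff] at ha ⊢
    rw [mul_smul, mul_smul, hstab a ha _ (hinv c⁻¹ x hx), smul_inv_smul]⟩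
  have hle : (stabilizer G x).index ≤ 3 := by
    rw [index_stabilizer, ← h3 g hg]
    refine Set.ncard_le_ncard ?_ (Set.finite_of_ncard_ne_zero (by rw [h3 g hg]; norm_num))
    rintro _ ⟨a, rfl⟩
    exact hinv a x hx
  have hne0 : (stabilizer G x).index ≠ 0 := Subgroup.index_ne_zero_of_finite
  have hne2 : (stabilizer G x).index ≠ 2 := fun h ↦ by
    have : Fact (Nat.Prime 2) := ⟨Nat.prime_two⟩
    obtain ⟨a, ha⟩ := exists_prime_orderOf_dvd_card' (G := G) 2
      (h ▸ (stabilizer G x).index_dvd_card)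
    exact h2 a ha
  obtain h1 | h1 : (stabilizer G x).index = 1 ∨ (stabilizer G x).index = 3 := by omega
  · left
    intro a b
    rw [Subgroup.index_eq_one] at h1
    exact hab a b (mem_stabilizer_iff.mp (h1 ▸ Subgroup.mem_top a))
      (mem_stabilizer_iff.mp (h1 ▸ Subgroup.mem_top b))
  · exact .inr ⟨_, hnormal, fun a b ↦ Subtype.ext (hab a b a.2 b.2), h1⟩

end FixingSubgroup

/-! ### The set of closed points of projective space -/

section ClosedPoints

open Module

variable {k : Type u} [Field k] {n : ℕ}

/-- The closed points of projective space. -/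
abbrev ClosedPt (k : Type u) [Field k] (n : ℕ) : Type u :=
  {x : Proj (grading k n) // IsClosed {x}}

/-- The closed point of projective space with given homogeneous coordinates. -/
noncomputable def closedPt (v : Fin (n + 1) → k) (hv : v ≠ 0) : ClosedPt k n :=
  ⟨pt v hv, isClosed_pt v hv⟩

lemma closedPt_eq_iff {v w : Fin (n + 1) → k} (hv : v ≠ 0) (hw : w ≠ 0) :
    closedPt v hv = closedPt w hw ↔ ∃ c : k, w = c • v :=
  Subtype.ext_iff.trans (pt_eq_pt_iff hv hw)

lemma exists_eq_closedPt [IsAlgClosed k] (x : ClosedPt k n) : ∃ v hv, x = closedPt v hv := by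
  obtain ⟨v, hv, h⟩ := exists_eq_pt x.1 x.2
  exact ⟨v, hv, Subtype.ext h⟩

lemma closedPt_basis_injective (b : Basis (Fin 3) k (Fin (n + 1) → k)) :
    Function.Injective fun i ↦ closedPt (b i) (b.ne_zero i) := fun i j hij ↦ by
  obtain ⟨c, hc⟩ := (closedPt_eq_iff _ _).mp hij
  by_contra hne
  have h1 := congrArg (b.repr · j) hc
  simp [hne] at h1

lemma ncard_range_closedPt (b : Basis (Fin 3) k (Fin (n + 1) → k)) :
    (Set.range fun i ↦ closedPt (b i) (b.ne_zero i)).ncard = 3 := by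
  rw [← Set.image_univ, Set.ncard_image_of_injective _ (closedPt_basis_injective b),
    Set.ncard_univ, Nat.card_fin]

end ClosedPoints

/-! ### Automorphisms of the form as automorphisms of projective space -/

section AutMap

variable {K k : Type u} [Field K] [Field k] [Algebra K k] {n : ℕ} {S : Over (Spec (.of K))}
  {q : Proj (grading k (n + 1)) ⟶ S.left}

/-- The morphism of `ℙⁿ` over `k` induced by an automorphism of a form `S` over `K`. -/
noncomputable def autMap
    (h : IsPullback q (projStr k (n + 1)) S.hom (Spec.map (CommRingCat.ofHom (algebraMap K k))))
    (g : Aut S) : Proj (grading k (n + 1)) ⟶ Proj (grading k (n + 1)) :=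
  baseAut h g.hom.left (Over.w g.hom)

lemma autMap_mul
    (h : IsPullback q (projStr k (n + 1)) S.hom (Spec.map (CommRingCat.ofHom (algebraMap K k))))
    (g g' : Aut S) : autMap h (g * g') = autMap h g' ≫ autMap h g :=
  baseAut_comp h _ _ _ _

lemma autMap_one
    (h : IsPullback q (projStr k (n + 1)) S.hom (Spec.map (CommRingCat.ofHom (algebraMap K k)))) :
    autMap h 1 = 𝟙 _ := baseAut_id h

end AutMap

/-! ### Finite groups acting on nontrivial forms of the projective plane -/

section Surfaces

open Module

variable {K k : Type u} [Field K] [Field k] [Algebra K k] [CharZero K] [IsAlgClosed k]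
  [Algebra.IsAlgebraic K k] {n : ℕ} {S : Over (Spec (.of K))} [LocallyOfFiniteType S.hom]
  {q : Proj (grading k (n + 1)) ⟶ S.left}

/-- A fibre of `ℙ² ⟶ S` consisting of three points lies over a point of degree three. -/
lemma isPointOfDegree_three
    (h : IsPullback q (projStr k (n + 1)) S.hom (Spec.map (CommRingCat.ofHom (algebraMap K k))))
    (b : Basis (Fin 3) k (Fin (n + 1 + 1) → k)) (i : Fin 3)
    (hb : ∀ y : ClosedPt k (n + 1), q y.1 = q (closedPt (b i) (b.ne_zero i)).1 ↔
      y ∈ Set.range fun i ↦ closedPt (b i) (b.ne_zero i)) :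
    IsPointOfDegree S 3 (q (closedPt (b i) (b.ne_zero i)).1) := by
  have hcl := isClosed_apply h (closedPt (b i) (b.ne_zero i)).2
  refine ⟨hcl, (natCard_fiber h hcl).symm.trans ?_⟩
  refine Eq.trans ?_ (ncard_range_closedPt b)
  rw [← Nat.card_coe_set_eq]
  refine Nat.card_congr ((Equiv.subtypeSubtypeEquivSubtypeInter _ _).symm.trans
    (Equiv.subtypeEquivRight hb))

variable [IsSeparated S.hom]

/-- A finite group of automorphisms of a nontrivial form `S` of the projective plane is abelian or
has an abelian normal subgroup of index three, and fixes a point of degree three. The scalar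
extension of `S` to `k` is identified with the projective plane over `k`, whose dimension enters
through `hn`. -/
theorem exists_invariant_point_and_abelian (hn : finrank k (Fin (n + 1 + 1) → k) = 3)
    (h : IsPullback q (projStr k (n + 1)) S.hom (Spec.map (CommRingCat.ofHom (algebraMap K k))))
    (hS : ∀ φ : S.left ≅ Proj (grading K (n + 1)), φ.hom ≫ projStr K (n + 1) ≠ S.hom)
    (G : Subgroup (Aut S)) [Finite G] :
    ((∀ a b : G, a * b = b * a) ∨
      ∃ N : Subgroup G, N.Normal ∧ (∀ a b : N, a * b = b * a) ∧ N.index = 3) ∧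
    ∃ P : S.left, IsPointOfDegree S 3 P ∧ IsInvariantPoint G P := by
  obtain ⟨ρ, hρ⟩ := exists_projectiveAction h
  have hno := noFixedLine hρ hS
  have hfiber {M : End k (Fin (n + 1 + 1) → k)} (hM : ρ.Compatible M)
      (hns : ∀ a : k, M ≠ algebraMap k (End k (Fin (n + 1 + 1) → k)) a) :
      ∃ (b : Basis (Fin 3) k (Fin (n + 1 + 1) → k)) (μ : Fin 3 → k), Function.Injective μ ∧
        (∀ i, M (b i) = μ i • b i) ∧ ∀ i (y : ClosedPt k (n + 1)),
          q y.1 = q (closedPt (b i) (b.ne_zero i)).1 ↔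
            y ∈ Set.range fun i ↦ closedPt (b i) (b.ne_zero i) := by
    obtain ⟨b, μ, hμ, hb, hq⟩ := exists_eigenbasis_fiber hn hρ hno hM hns
    refine ⟨b, μ, hμ, hb, fun i y ↦ (hq i y.1 y.2).trans ?_⟩
    exact ⟨fun ⟨j, hj⟩ ↦ ⟨j, Subtype.ext hj.symm⟩, fun ⟨j, hj⟩ ↦
      ⟨j, congrArg Subtype.val hj.symm⟩⟩
  rcases subsingleton_or_nontrivial G with hG | hG
  · -- For the trivial group any endomorphism commuting with the Galois action will do.
    refine ⟨.inl fun a b ↦ Subsingleton.elim _ _, ?_⟩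
    obtain ⟨M, hM, hns⟩ := ρ.exists_compatible_ne_algebraMap (by rw [hn]; norm_num)
    obtain ⟨b, μ, -, -, hq⟩ := hfiber hM hns
    refine ⟨_, isPointOfDegree_three h b 0 (hq 0), fun g hg ↦ ?_⟩
    have h1 : g = 1 := congrArg Subtype.val (Subsingleton.elim (⟨g, hg⟩ : G) 1)
    rw [h1]
    rfl
  have hlin (g : G) : ∃ M : End k (Fin (n + 1 + 1) → k), ρ.Compatible M ∧
      ∀ v hv, ∃ hv', autMap h g.1 (pt v hv) = pt (M v) hv' :=
    exists_linear_baseAut hρ (Over.w g.1.hom) (Over.w g.1.inv)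
      (by rw [← Over.comp_left, g.1.hom_inv_id, Over.id_left])
      (by rw [← Over.comp_left, g.1.inv_hom_id, Over.id_left])
  choose M hM hpt using hlin
  have hM0 (g v) (hv : v ≠ 0) : M g v ≠ 0 := (hpt g v hv).1
  have hMpt (g v) (hv : v ≠ 0) : autMap h g.1 (pt v hv) = pt (M g v) (hM0 g v hv) := (hpt g v hv).2
  let : MulAction G (ClosedPt k (n + 1)) :=
    { smul := fun g x ↦ ⟨autMap h g.1 x.1, by
        obtain ⟨v, hv, rfl⟩ := exists_eq_closedPt x
        have h1 : autMap h g.1 (closedPt v hv).1 = pt (M g v) (hM0 g v hv) := hMpt g v hv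
        rw [h1]
        exact isClosed_pt _ _⟩
      one_smul := fun x ↦ Subtype.ext (by
        change autMap h 1 x.1 = x.1
        rw [autMap_one]
        rfl)
      mul_smul := fun g g' x ↦ Subtype.ext (by
        change autMap h (g.1 * g'.1) x.1 = autMap h g.1 (autMap h g'.1 x.1)
        rw [autMap_mul]
        rfl) }
  have hsmul (g : G) (v) (hv : v ≠ 0) : g • closedPt v hv = closedPt (M g v) (hM0 g v hv) :=
    Subtype.ext (hMpt g v hv)
  have hfixed (g : G) (v) (hv : v ≠ 0) : g • closedPt v hv = closedPt v hv ↔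
      ∃ c : k, M g v = c • v := by
    rw [hsmul, eq_comm, closedPt_eq_iff]
  have hfaithful (g : G) (hg : ∀ x : ClosedPt k (n + 1), g • x = x) : g = 1 := by
    have h1 : g.1.hom.left = 𝟙 _ := eq_id_of_baseAut_pt (h := h) (Over.w g.1.hom)
      fun v hv ↦ congrArg Subtype.val (hg (closedPt v hv))
    exact Subtype.ext (Iso.ext (Over.OverMorphism.ext h1))
  have hns (g : G) (hg : g ≠ 1) (a : k) : M g ≠ algebraMap k (End k (Fin (n + 1 + 1) → k)) a :=
    fun ha ↦ hg <| hfaithful g fun x ↦ by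
      obtain ⟨v, hv, rfl⟩ := exists_eq_closedPt x
      rw [hfixed]
      exact ⟨a, by rw [ha]; rfl⟩
  have hqsmul (g : G) (x : ClosedPt k (n + 1)) : q (g • x).1 = g.1.hom.left (q x.1) := by
    change q (autMap h g.1 x.1) = _
    rw [← Scheme.Hom.comp_apply, autMap, baseAut_fst, Scheme.Hom.comp_apply]
  -- The fixed points of a nontrivial element are its three eigenlines, a fibre of `q`.
  have hfix (g : G) (hg : g ≠ 1) : ∃ (b : Basis (Fin 3) k (Fin (n + 1 + 1) → k)) (μ : Fin 3 → k),
      Function.Injective μ ∧ (∀ i, M g (b i) = μ i • b i) ∧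
      (MulAction.fixedBy (ClosedPt k (n + 1)) g =
        Set.range fun i ↦ closedPt (b i) (b.ne_zero i)) ∧ ∀ i (y : ClosedPt k (n + 1)),
          q y.1 = q (closedPt (b i) (b.ne_zero i)).1 ↔
            y ∈ Set.range fun i ↦ closedPt (b i) (b.ne_zero i) := by
    obtain ⟨b, μ, hμ, hb, hq⟩ := hfiber (hM g) (hns g hg)
    refine ⟨b, μ, hμ, hb, ?_, hq⟩
    ext y
    obtain ⟨v, hv, rfl⟩ := exists_eq_closedPt y
    rw [MulAction.mem_fixedBy, hfixed]
    constructor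
    · rintro ⟨c, hc⟩
      obtain ⟨i, -, d, hd⟩ := ProjectiveAction.exists_eq_smul_of_apply_eq_smul hμ hb hv hc
      exact ⟨i, (closedPt_eq_iff _ _).mpr ⟨d, hd⟩⟩
    · rintro ⟨i, hi⟩
      obtain ⟨d, hd⟩ := (closedPt_eq_iff _ _).mp hi
      exact ⟨μ i, by rw [hd, map_smul, hb, smul_comm]⟩
  have hfixq (g : G) (hg : g ≠ 1) (x y : ClosedPt k (n + 1)) (hx : g • x = x) :
      g • y = y ↔ q y.1 = q x.1 := by
    obtain ⟨b, μ, -, -, h1, h2⟩ := hfix g hg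
    have hx' : x ∈ MulAction.fixedBy (ClosedPt k (n + 1)) g := hx
    rw [h1] at hx'
    obtain ⟨i, rfl⟩ := hx'
    rw [h2 i y, ← h1]
    rfl
  have heq (g g' : G) (hg : g ≠ 1) (hg' : g' ≠ 1) (x : ClosedPt k (n + 1)) (hx : g • x = x)
      (hx' : g' • x = x) : MulAction.fixedBy (ClosedPt k (n + 1)) g =
        MulAction.fixedBy (ClosedPt k (n + 1)) g' := by
    ext y
    exact (hfixq g hg x y hx).trans (hfixq g' hg' x y hx').symm
  have hcard (g : G) (hg : g ≠ 1) : (MulAction.fixedBy (ClosedPt k (n + 1)) g).ncard = 3 := by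
    obtain ⟨b, μ, -, -, h1, -⟩ := hfix g hg
    rw [h1, ncard_range_closedPt]
  have hinvol (g : G) : orderOf g ≠ 2 := fun hg ↦ by
    -- The squares of the three eigenvalues of an involution would agree.
    have hg1 : g ≠ 1 := by
      rintro rfl
      simp at hg
    obtain ⟨b, μ, hμ, hb, -⟩ := hfix g hg1
    obtain ⟨c, hc⟩ := exists_eq_smul_of_forall (σ := RingEquiv.refl k)
      (R := AddMonoidHom.id (Fin (n + 1 + 1) → k))
      (R' := (M g * M g).toAddMonoidHom) (fun c v ↦ rfl)
      (fun c v ↦ (M g * M g).map_smul c v) (fun v hv ↦ hv) fun v ↦ by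
        by_cases hv : v = 0
        · exact ⟨0, by rw [hv, map_zero, zero_smul]⟩
        refine (closedPt_eq_iff hv (hM0 g _ (hM0 g v hv))).mp ?_
        rw [← hsmul g _ (hM0 g v hv), ← hsmul g v hv, ← mul_smul, ← pow_two, ← hg,
          pow_orderOf_eq_one, one_smul]
    have hsq (i) : μ i * μ i = c := by
      have h1 : M g (M g (b i)) = c • b i := hc (b i)
      rw [hb, map_smul, hb, smul_smul] at h1
      exact smul_left_injective k (b.ne_zero i) h1
    have h01 : μ 0 ≠ μ 1 := hμ.ne (by decide)
    have h02 : μ 0 ≠ μ 2 := hμ.ne (by decide)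
    have h12 : μ 1 ≠ μ 2 := hμ.ne (by decide)
    rcases mul_self_eq_mul_self_iff.mp ((hsq 1).trans (hsq 0).symm) with h1 | h1
    · exact h01 h1.symm
    rcases mul_self_eq_mul_self_iff.mp ((hsq 2).trans (hsq 0).symm) with h2 | h2
    · exact h02 h2.symm
    exact h12 (h1.trans h2.symm)
  have hcomm (g g' : G) (hg : g ≠ 1) (hg' : g' ≠ 1) (x : ClosedPt k (n + 1)) (hx : g • x = x)
      (hx' : g' • x = x) : g * g' = g' * g := by
    -- Elements with the same eigenlines commute.
    obtain ⟨b, μ, -, hb, h1, -⟩ := hfix g hg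
    have hb' (i) : ∃ c : k, M g' (b i) = c • b i := by
      rw [← hfixed g' _ (b.ne_zero i), ← MulAction.mem_fixedBy, ← heq g g' hg hg' x hx hx', h1]
      exact ⟨i, rfl⟩
    choose ν hν using hb'
    have hMM : M g * M g' = M g' * M g := b.ext fun i ↦ by
      rw [Module.End.mul_apply, Module.End.mul_apply, hν, hb, map_smul, map_smul, hν, hb,
        smul_comm]
    rw [← mul_inv_eq_one]
    refine hfaithful _ fun y ↦ ?_
    obtain ⟨z, rfl⟩ : ∃ z, y = (g' * g) • z := ⟨(g' * g)⁻¹ • y, (smul_inv_smul _ _).symm⟩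
    rw [mul_smul, inv_smul_smul]
    obtain ⟨v, hv, rfl⟩ := exists_eq_closedPt z
    rw [mul_smul, mul_smul, hsmul, hsmul, hsmul, hsmul, closedPt_eq_iff]
    exact ⟨1, by rw [one_smul]; exact (LinearMap.congr_fun hMM v).symm⟩
  obtain ⟨⟨g, hg, hinv⟩, hab⟩ :=
    exists_invariant_fixedBy_and_abelian (X := ClosedPt k (n + 1)) hcard heq hinvol hcomm
  refine ⟨hab, ?_⟩
  obtain ⟨b, μ, -, -, h1, h2⟩ := hfix g hg
  refine ⟨_, isPointOfDegree_three h b 0 (h2 0), fun a ha ↦ ?_⟩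
  have h3 : g • closedPt (b 0) (b.ne_zero 0) = closedPt (b 0) (b.ne_zero 0) := by
    have : closedPt (b 0) (b.ne_zero 0) ∈ MulAction.fixedBy (ClosedPt k (n + 1)) g := by
      rw [h1]
      exact ⟨0, rfl⟩
    exact this
  rw [← hqsmul ⟨a, ha⟩, ← hfixq g hg _ _ h3]
  exact hinv ⟨a, ha⟩ _ h3

end Surfaces

/-! ### Severi–Brauer surfaces as forms of the projective plane -/

lemma IsProjective.isSeparated {K : Type u} [Field K] {S : Over (Spec (.of K))}
    (hS : IsProjective S) : IsSeparated S.hom := by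
  obtain ⟨m, i, hi⟩ := hS
  rw [← Over.w i]
  exact MorphismProperty.comp_mem _ _ _ (inferInstanceAs (IsSeparated i.left))
    (inferInstanceAs (IsSeparated (projStr K m)))

lemma IsProjective.locallyOfFiniteType {K : Type u} [Field K] {S : Over (Spec (.of K))}
    (hS : IsProjective S) : LocallyOfFiniteType S.hom := by
  obtain ⟨m, i, hi⟩ := hS
  rw [← Over.w i]
  exact MorphismProperty.comp_mem _ _ _ (inferInstanceAs (LocallyOfFiniteType i.left))
    (inferInstanceAs (LocallyOfFiniteType (projStr K m)))

/-- An identification of the geometric fibre with projective space, as a pullback square. -/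
lemma isPullback_of_geometricFiber_iso {K : Type u} [Field K] {S : Over (Spec (.of K))} {n : ℕ}
    (θ : geometricFiber S ≅ projectiveSpace n (AlgebraicClosure K)) :
    IsPullback (θ.inv.left ≫ Limits.pullback.fst S.hom _) (projStr (AlgebraicClosure K) n)
      S.hom (Spec.map (CommRingCat.ofHom (algebraMap K (AlgebraicClosure K)))) :=
  (IsPullback.of_hasPullback S.hom _).of_iso' ((Over.forget _).mapIso θ.symm) (Iso.refl _)
    (Iso.refl _) (Iso.refl _) (Category.comp_id _).symm
    ((Over.w θ.inv).trans (Category.comp_id _).symm) (by simp) (by simp)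

end SeveriBrauer

theorem corollary4p3 {K : Type*} [Field K] [CharZero K]
    (S : CategoryTheory.Over (AlgebraicGeometry.Spec (.of K)))
    (hS : SeveriBrauer.IsNontrivialSeveriBrauerSurface S)
    (G : Subgroup (CategoryTheory.Aut S)) [Finite G] :
    ((∀ a b : G, a * b = b * a) ∨
      ∃ N : Subgroup G, N.Normal ∧ (∀ a b : N, a * b = b * a) ∧ N.index = 3) ∧
    ∃ P : S.left, SeveriBrauer.IsPointOfDegree S 3 P ∧ SeveriBrauer.IsInvariantPoint G P := by
  have := hS.isSeveriBrauer.isProjective.isSeparated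
  have := hS.isSeveriBrauer.isProjective.locallyOfFiniteType
  obtain ⟨θ⟩ := hS.isSeveriBrauer.geometricFiber_iso
  exact SeveriBrauer.exists_invariant_point_and_abelian (n := 1) (Module.finrank_fin_fun _)
    (SeveriBrauer.isPullback_of_geometricFiber_iso θ)
    (fun φ hφ ↦ hS.nontrivial.false (Over.isoMk φ hφ)) G
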